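/- Let $d\ge 1$, $\nu>1$, $\mu\in\{1,-1\}$, and let $k>d/2$ be an integer. If $\nu$ is not an odd integer, assume moreover that $\nu\ge k+1$. Consider the nonlinear fourth-order Schrödinger equation $$ i\partial_t u+\Delta^2u=-\mu|u|^{\nu-1}u \quad\text{on } \mathbb R^d,\qquad u(0)=u_0, \tag{NL4S}$$ and put $\gamma_c=\frac d2-\frac4{\nu-1}$. For $T>0$ and a Schwartz function $u_0\in\mathcal S(\mathbb R^d)$, a solution of (NL4S) on $[0,T]$ is a function $u\in C([0,T],H^k(\mathbb R^d))$ with $u(0)=u_0$ that satisfies the equation in the sense of tempered distributions for every $t\in[0,T]$. Here $\|f\|_{H^\gamma}=\|(1-\Delta)^{\gamma/2}f\|_{L^2}$ for $\gamma\in\mathbb R$. Then (NL4S) is ill-posed in $H^\gamma$ for every $\gamma\in\big((-\infty,-d/2]\cap(-\infty,\gamma_c)\big)\cup[0,\gamma_c)$, in the following precise sense. (1) Let $\gamma\in\big((-\infty,-d/2]\cap(-\infty,\gamma_c)\big)\cup(0,\gamma_c)$. For every $t>0$ the solution map $\mathcal S\ni u(0)\mapsto u(t)$ fails to be continuous at $0$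 in the $H^\gamma$ topology; that is, it is not the case that for every $\varepsilon>0$ there is $\delta>0$ such that every $u_0\in\mathcal S$ with $\|u_0\|_{H^\gamma}<\delta$ has a solution on $[0,t]$ with $\|u(t)\|_{H^\gamma}<\varepsilon$. Moreover, for every $\varepsilon>0$ there are $t\in(0,\varepsilon)$ and a solution $u$ on $[0,t]$ with $u(0)\in\mathcal S$, $\|u(0)\|_{H^\gamma}<\varepsilon$ and $\|u(t)\|_{H^\gamma}>\varepsilon^{-1}$. (2) Let $\gamma_c>0$. For every $t>0$ the solution map $u(0)\mapsto u(t)$ fails to be uniformly continuous on $L^2$, even on small balls; that is, for all $t>0$ and $R>0$ it is not the case that for every $\varepsilon>0$ there is $\delta>0$ such that any $u_0,v_0\in\mathcal S$ with $\|u_0\|_{L^2},\|v_0\|_{L^2}\le R$ and $\|u_0-v_0\|_{L^2}<\delta$ have solutions $u,v$ on $[0,t]$ with $\|u(t)-v(t)\|_{L^2}<\varepsilon$. Moreover, there is $c>0$ such that for all $R,\sigma,\tau>0$ there are $t\in(0,\tau)$ and solutions $u,v$ on $[0,t]$ with data in $\mathcal S$ such that $\|u(0)\|_{L^2},\|v(0)\|_{L^2}\le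 R$, $\|u(0)-v(0)\|_{L^2}<\sigma$ and $\|u(t)-v(t)\|_{L^2}\ge cR$. -/

import Mathlib

open MeasureTheory Filter Topology
open scoped SchwartzMap FourierTransform Laplacian ENNReal

noncomputable section

namespace NL4S

/-- Euclidean space `ℝ^d`. -/
abbrev Space (d : ℕ) : Type := EuclideanSpace ℝ (Fin d)

/-- The complex Hilbert space `L²(ℝ^d)`. -/
abbrev L2 (d : ℕ) : Type := Lp ℂ 2 (volume : Measure (Space d))

/-- The Sobolev norm `‖⟨Λ⟩^γ f‖_{L²}`, `Λ = √(-Δ)`, with value `∞` if `f ∉ H^γ`, computed on the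
Fourier side by Plancherel. With the normalization `𝓕 f ξ = ∫ e^{-2πi x·ξ} f x dx` the operator
`Λ` is multiplication by `2π|ξ|`. -/
def sobolevNorm {d : ℕ} (γ : ℝ) (f : L2 d) : ℝ≥0∞ :=
  eLpNorm (fun ξ : Space d ↦
    (((1 + (2 * Real.pi * ‖ξ‖) ^ 2) ^ (γ / 2) : ℝ) : ℂ) * (𝓕 f : L2 d) ξ) 2 volume

/-- The critical regularity exponent `γ_c = d/2 - 4/(ν-1)`. -/
def criticalExponent (d : ℕ) (ν : ℝ) : ℝ := (d : ℝ) / 2 - 4 / (ν - 1)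

/-- `u ∈ C([0,T], H^k)` solves `i ∂ₜ u + Δ² u = -μ |u|^{ν-1} u` on `[0,T] × ℝ^d` with `u(0) = u₀`.
The equation holds in the sense of tempered distributions at every time, that is
`∂ₜ ⟨u, φ⟩ = i (⟨u, Δ² φ⟩ + μ ⟨|u|^{ν-1} u, φ⟩)` for every Schwartz function `φ`
(with one-sided time derivatives at the endpoints of `[0,T]`). -/
structure IsSolution {d : ℕ} (ν μ : ℝ) (k : ℕ) (T : ℝ) (u₀ : 𝓢(Space d, ℂ)) (u : ℝ → L2 d) :
    Prop where
  mem_sobolev : ∀ t ∈ Set.Icc 0 T, sobolevNorm (k : ℝ) (u t) < ∞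
  continuous_sobolev : ∀ t ∈ Set.Icc 0 T,
    Tendsto (fun s ↦ sobolevNorm (k : ℝ) (u s - u t)) (𝓝[Set.Icc 0 T] t) (𝓝 0)
  initial : u 0 = u₀.toLp 2 volume
  equation : ∀ φ : 𝓢(Space d, ℂ), ∀ t ∈ Set.Icc 0 T,
    HasDerivWithinAt (fun s ↦ ∫ x, u s x * φ x)
      (Complex.I * ((∫ x, u t x * (Δ (Δ φ)) x) +
        (μ : ℂ) * ∫ x, ((‖u t x‖ ^ (ν - 1) : ℝ) : ℂ) * u t x * φ x))
      (Set.Icc 0 T) t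

/-- The solution map `u(0) ↦ u(t)` on Schwartz data is defined near `0` in the `H^γ` topology, and
continuous at `0` in that topology (the solution with zero data being zero). -/
def SolutionMapContinuousAtZero (d : ℕ) (ν μ : ℝ) (k : ℕ) (γ t : ℝ) : Prop :=
  ∀ ε : ℝ, 0 < ε → ∃ δ : ℝ, 0 < δ ∧ ∀ u₀ : 𝓢(Space d, ℂ),
    sobolevNorm γ (u₀.toLp 2 volume) < ENNReal.ofReal δ →
      ∃ u : ℝ → L2 d, IsSolution ν μ k t u₀ u ∧ sobolevNorm γ (u t) < ENNReal.ofReal ε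

/-- The solution map `u(0) ↦ u(t)` is defined on the Schwartz data of `L²` norm at most `R`, and
uniformly continuous there in the `L²` topology. -/
def SolutionMapUniformContinuousOnBall (d : ℕ) (ν μ : ℝ) (k : ℕ) (R t : ℝ) : Prop :=
  ∀ ε : ℝ, 0 < ε → ∃ δ : ℝ, 0 < δ ∧ ∀ u₀ v₀ : 𝓢(Space d, ℂ),
    ‖u₀.toLp 2 volume‖ ≤ R → ‖v₀.toLp 2 volume‖ ≤ R →
    ‖u₀.toLp 2 volume - v₀.toLp 2 volume‖ < δ →
      ∃ u v : ℝ → L2 d, IsSolution ν μ k t u₀ u ∧ IsSolution ν μ k t v₀ v ∧ ‖u t - v t‖ < ε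

/-- Norm inflation in `H^γ`: Schwartz data that are arbitrarily small in `H^γ` have solutions that
become arbitrarily large in `H^γ` within an arbitrarily short time. -/
def NormInflation (d : ℕ) (ν μ : ℝ) (k : ℕ) (γ : ℝ) : Prop :=
  ∀ ε : ℝ, 0 < ε → ∃ (u₀ : 𝓢(Space d, ℂ)) (t : ℝ) (u : ℝ → L2 d),
    0 < t ∧ t < ε ∧ IsSolution ν μ k t u₀ u ∧
    sobolevNorm γ (u₀.toLp 2 volume) < ENNReal.ofReal ε ∧
    ENNReal.ofReal ε⁻¹ < sobolevNorm γ (u t)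

/-- Decoherence in `L²`: in every ball of `L²` there are pairs of Schwartz data, arbitrarily close
in `L²`, whose solutions are separated by a fixed fraction of the radius within an arbitrarily
short time. -/
def Decoherence (d : ℕ) (ν μ : ℝ) (k : ℕ) : Prop :=
  ∃ c : ℝ, 0 < c ∧ ∀ R σ τ : ℝ, 0 < R → 0 < σ → 0 < τ →
    ∃ (u₀ v₀ : 𝓢(Space d, ℂ)) (t : ℝ) (u v : ℝ → L2 d),
      0 < t ∧ t < τ ∧ IsSolution ν μ k t u₀ u ∧ IsSolution ν μ k t v₀ v ∧
      ‖u₀.toLp 2 volume‖ ≤ R ∧ ‖v₀.toLp 2 volume‖ ≤ R ∧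
      ‖u₀.toLp 2 volume - v₀.toLp 2 volume‖ < σ ∧ c * R ≤ ‖u t - v t‖

end NL4S

end

open scoped NNReal BoundedContinuousFunction ComplexConjugate LineDeriv

noncomputable section

namespace NL4S

variable {d : ℕ}

/-! ### Sobolev weights -/

/-- The weight `⟨ξ⟩^s`, the symbol of `(1 - Δ)^{s/2}`. -/
def wt (s : ℝ) (ξ : Space d) : ℝ := (1 + (2 * Real.pi * ‖ξ‖) ^ 2) ^ (s / 2)

lemma wt_base_pos (ξ : Space d) : 0 < 1 + (2 * Real.pi * ‖ξ‖) ^ 2 := by positivity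

lemma one_le_wt_base (ξ : Space d) : 1 ≤ 1 + (2 * Real.pi * ‖ξ‖) ^ 2 := by
  nlinarith [sq_nonneg (2 * Real.pi * ‖ξ‖)]

lemma wt_pos (s : ℝ) (ξ : Space d) : 0 < wt s ξ := Real.rpow_pos_of_pos (wt_base_pos ξ) _

lemma wt_nonneg (s : ℝ) (ξ : Space d) : 0 ≤ wt s ξ := (wt_pos s ξ).le

lemma wt_add (s t : ℝ) (ξ : Space d) : wt (s + t) ξ = wt s ξ * wt t ξ := by
  rw [wt, wt, wt, ← Real.rpow_add (wt_base_pos ξ), add_div]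

@[simp] lemma wt_zero (ξ : Space d) : wt 0 ξ = 1 := by simp [wt]

lemma wt_neg_mul (s : ℝ) (ξ : Space d) : wt (-s) ξ * wt s ξ = 1 := by
  rw [← wt_add]; simp

lemma wt_mul_neg (s : ℝ) (ξ : Space d) : wt s ξ * wt (-s) ξ = 1 := by
  rw [← wt_add]; simp

lemma wt_mono {s t : ℝ} (h : s ≤ t) (ξ : Space d) : wt s ξ ≤ wt t ξ :=
  Real.rpow_le_rpow_of_exponent_le (one_le_wt_base ξ) (by linarith)

lemma wt_le_one {s : ℝ} (h : s ≤ 0) (ξ : Space d) : wt s ξ ≤ 1 := by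
  simpa using wt_mono h ξ

lemma wt_sq (s : ℝ) (ξ : Space d) : wt s ξ ^ 2 = (1 + (2 * Real.pi * ‖ξ‖) ^ 2) ^ s := by
  rw [wt, ← Real.rpow_mul_natCast (wt_base_pos ξ).le]; congr 1; push_cast; ring

@[simp] lemma wt_apply_neg (s : ℝ) (ξ : Space d) : wt s (-ξ) = wt s ξ := by simp [wt]

lemma hasTemperateGrowth_wt (s : ℝ) :
    Function.HasTemperateGrowth (wt s : Space d → ℝ) := by
  have h1 := Function.hasTemperateGrowth_one_add_norm_sq_rpow (Space d) (s / 2)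
  have h2 : Function.HasTemperateGrowth (fun ξ : Space d ↦ (2 * Real.pi) • ξ) :=
    ((2 * Real.pi) • ContinuousLinearMap.id ℝ (Space d)).hasTemperateGrowth
  have h3 : (wt s : Space d → ℝ) =
      (fun x ↦ (1 + ‖x‖ ^ 2) ^ (s / 2)) ∘ fun ξ ↦ (2 * Real.pi) • ξ := by
    funext ξ
    simp [wt, norm_smul, abs_of_pos Real.pi_pos]
  rw [h3]
  exact h1.comp h2

lemma continuous_wt (s : ℝ) : Continuous (wt s : Space d → ℝ) :=
  (hasTemperateGrowth_wt s).1.continuous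

lemma hasTemperateGrowth_wt_complex (s : ℝ) :
    Function.HasTemperateGrowth (fun ξ : Space d ↦ (wt s ξ : ℂ)) := by
  have := hasTemperateGrowth_wt (d := d) s
  fun_prop

/-- The square of `⟨ξ⟩^{-s}` is integrable for `s > d/2`. -/
lemma integrable_wt_sq {s : ℝ} (hs : (d : ℝ) / 2 < s) :
    Integrable (fun ξ : Space d ↦ wt (-s) ξ ^ 2) := by
  have h := integrable_rpow_neg_one_add_norm_sq (E := Space d) (μ := volume) (r := 2 * s)
    (by simp; linarith)
  have h2 := h.comp_smul (R := 2 * Real.pi) (by positivity)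
  refine h2.congr (Eventually.of_forall fun ξ ↦ ?_)
  simp only [wt_sq, norm_smul, Real.norm_eq_abs, abs_of_pos (show 0 < 2 * Real.pi by positivity)]
  congr 1; ring

/-! ### Multiplication operators on `L²` -/

lemma memLp_mul_bdd (m : Space d →ᵇ ℂ) (f : L2 d) :
    MemLp (fun x ↦ m x * f x) 2 volume := by
  refine MemLp.of_le_mul (c := ‖m‖) (Lp.memLp f)
    (m.continuous.aestronglyMeasurable.mul (Lp.aestronglyMeasurable f)) ?_
  refine Eventually.of_forall fun x ↦ ?_
  rw [norm_mul]
  gcongr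
  exact m.norm_coe_le_norm x

/-- Multiplication by a bounded continuous function on `L²`. -/
def mulL2 (m : Space d →ᵇ ℂ) : L2 d →L[ℂ] L2 d :=
  LinearMap.mkContinuous
    { toFun := fun f ↦ (memLp_mul_bdd m f).toLp _
      map_add' := fun f g ↦ by
        apply Lp.ext
        filter_upwards [(memLp_mul_bdd m (f + g)).coeFn_toLp, (memLp_mul_bdd m f).coeFn_toLp,
          (memLp_mul_bdd m g).coeFn_toLp, Lp.coeFn_add f g,
          Lp.coeFn_add ((memLp_mul_bdd m f).toLp _) ((memLp_mul_bdd m g).toLp _)]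
          with x h1 h2 h3 h4 h5
        rw [h1, h5, Pi.add_apply, h2, h3, h4, Pi.add_apply]; ring
      map_smul' := fun c f ↦ by
        apply Lp.ext
        filter_upwards [(memLp_mul_bdd m (c • f)).coeFn_toLp, (memLp_mul_bdd m f).coeFn_toLp,
          Lp.coeFn_smul c f, Lp.coeFn_smul c ((memLp_mul_bdd m f).toLp _)]
          with x h1 h2 h3 h4
        simp only [RingHom.id_apply]
        rw [h1, h4, Pi.smul_apply, h2, h3, Pi.smul_apply]; simp only [smul_eq_mul]; ring }
    ‖m‖ (fun f ↦ by
      refine Lp.norm_le_mul_norm_of_ae_le_mul ?_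
      filter_upwards [(memLp_mul_bdd m f).coeFn_toLp] with x hx
      simp only [LinearMap.coe_mk, AddHom.coe_mk]
      rw [hx, norm_mul]
      gcongr
      exact m.norm_coe_le_norm x)

lemma mulL2_coe (m : Space d →ᵇ ℂ) (f : L2 d) :
    mulL2 m f =ᵐ[volume] fun x ↦ m x * f x :=
  (memLp_mul_bdd m f).coeFn_toLp

lemma mulL2_mul (m n : Space d →ᵇ ℂ) (f : L2 d) : mulL2 m (mulL2 n f) = mulL2 (m * n) f := by
  apply Lp.ext
  filter_upwards [mulL2_coe m (mulL2 n f), mulL2_coe n f, mulL2_coe (m * n) f] with x h1 h2 h3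
  rw [h1, h2, h3, BoundedContinuousFunction.mul_apply]; ring

@[simp] lemma mulL2_one (f : L2 d) : mulL2 1 f = f := by
  apply Lp.ext
  filter_upwards [mulL2_coe 1 f] with x h1
  rw [h1]; simp

lemma norm_mulL2_le_of_le {m n : Space d →ᵇ ℂ} (h : ∀ x, ‖m x‖ ≤ ‖n x‖) (f : L2 d) :
    ‖mulL2 m f‖ ≤ ‖mulL2 n f‖ := by
  apply Lp.norm_le_norm_of_ae_le
  filter_upwards [mulL2_coe m f, mulL2_coe n f] with x h1 h2
  rw [h1, h2, norm_mul, norm_mul]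
  gcongr
  exact h x

lemma norm_mulL2_le (m : Space d →ᵇ ℂ) {C : ℝ} (h : ∀ x, ‖m x‖ ≤ C) (f : L2 d) :
    ‖mulL2 m f‖ ≤ C * ‖f‖ := by
  refine Lp.norm_le_mul_norm_of_ae_le_mul ?_
  filter_upwards [mulL2_coe m f] with x h1
  rw [h1, norm_mul]
  gcongr
  exact h x

lemma norm_mulL2_eq (m : Space d →ᵇ ℂ) (h : ∀ x, ‖m x‖ = 1) (f : L2 d) :
    ‖mulL2 m f‖ = ‖f‖ := by
  apply le_antisymm
  · simpa using norm_mulL2_le m (fun x ↦ (h x).le) f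
  · conv_lhs => rw [← mulL2_one f]
    exact norm_mulL2_le_of_le (fun x ↦ by simp [h x]) f

lemma enorm_mulL2 (m : Space d →ᵇ ℂ) (f : L2 d) :
    ‖mulL2 m f‖ₑ = eLpNorm (fun x ↦ m x * f x) 2 volume := by
  rw [Lp.enorm_def]; exact eLpNorm_congr_ae (mulL2_coe m f)

/-- The weight `⟨ξ⟩^{-s}`, `s ≥ 0`, as a bounded continuous function. -/
def wtB (s : ℝ) : Space d →ᵇ ℂ :=
  BoundedContinuousFunction.ofNormedAddCommGroup (fun ξ ↦ ((wt (-max s 0) ξ : ℝ) : ℂ))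
    (Complex.continuous_ofReal.comp (continuous_wt _)) 1 (fun ξ ↦ by
      rw [Complex.norm_real, Real.norm_of_nonneg (wt_nonneg _ _)]
      exact wt_le_one (by simp) ξ)

lemma wtB_apply {s : ℝ} (hs : 0 ≤ s) (ξ : Space d) : wtB s ξ = ((wt (-s) ξ : ℝ) : ℂ) := by
  simp [wtB, max_eq_left hs]

/-! ### The Fourier profile of a Sobolev function -/

/-- The isometric parametrization of `H^k` by `L²`: the function with Fourier transform
`⟨ξ⟩^{-k} h`. -/
def ofProfile (k : ℕ) : L2 d →L[ℂ] L2 d :=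
  ((Lp.fourierTransformₗᵢ (Space d) ℂ).symm.toContinuousLinearEquiv : L2 d →L[ℂ] L2 d) ∘L
    mulL2 (wtB k)

lemma ofProfile_apply (k : ℕ) (h : L2 d) : ofProfile k h = 𝓕⁻ (mulL2 (wtB k) h) := rfl

lemma fourier_ofProfile (k : ℕ) (h : L2 d) : 𝓕 (ofProfile k h) = mulL2 (wtB k) h := by
  rw [ofProfile_apply, FourierTransform.fourier_fourierInv_eq]

lemma fourier_ofProfile_coe (k : ℕ) (h : L2 d) :
    (𝓕 (ofProfile k h) : L2 d) =ᵐ[volume] fun ξ ↦ ((wt (-k) ξ : ℝ) : ℂ) * h ξ := by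
  rw [fourier_ofProfile]
  filter_upwards [mulL2_coe (wtB k) h] with ξ hξ
  rw [hξ, wtB_apply (by positivity)]

lemma ofProfile_injective (k : ℕ) : Function.Injective (ofProfile (d := d) k) := by
  intro h h' hh
  have := congrArg (fun f : L2 d ↦ (𝓕 f : L2 d)) hh
  simp only [fourier_ofProfile] at this
  apply Lp.ext
  filter_upwards [mulL2_coe (wtB k) h, mulL2_coe (wtB k) h'] with ξ h1 h2
  rw [this, h2] at h1
  exact (mul_left_cancel₀ (by rw [wtB_apply (by positivity)]; exact_mod_cast (wt_pos _ _).ne')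
    h1).symm

lemma norm_ofProfile_le (k : ℕ) (h : L2 d) : ‖ofProfile k h‖ ≤ ‖h‖ := by
  rw [← Lp.norm_fourier_eq, fourier_ofProfile]
  simpa using norm_mulL2_le (wtB k) (C := 1) (fun x ↦ by
    rw [wtB_apply (by positivity), Complex.norm_real, Real.norm_of_nonneg (wt_nonneg _ _)]
    exact wt_le_one (by simp) x) h

lemma sobolevNorm_ofProfile {s : ℝ} {k : ℕ} (hs : s ≤ k) (h : L2 d) :
    sobolevNorm s (ofProfile k h) = ‖mulL2 (wtB (k - s)) h‖ₑ := by
  rw [enorm_mulL2, sobolevNorm]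
  apply eLpNorm_congr_ae
  filter_upwards [fourier_ofProfile_coe k h] with ξ hξ
  rw [hξ, wtB_apply (by linarith), ← mul_assoc]
  congr 1
  change ((wt s ξ : ℝ) : ℂ) * _ = _
  rw [← Complex.ofReal_mul, ← wt_add]
  congr 2; ring

lemma wtB_zero : (wtB 0 : Space d →ᵇ ℂ) = 1 := by
  ext ξ; rw [wtB_apply le_rfl]; simp

lemma sobolevNorm_ofProfile_self (k : ℕ) (h : L2 d) :
    sobolevNorm (k : ℝ) (ofProfile k h) = ‖h‖ₑ := by
  rw [sobolevNorm_ofProfile le_rfl, sub_self, wtB_zero, mulL2_one]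

lemma exists_ofProfile_eq {k : ℕ} {f : L2 d} (hf : sobolevNorm (k : ℝ) f < ∞) :
    ∃ h, ofProfile k h = f := by
  have hm : MemLp (fun ξ : Space d ↦ ((wt k ξ : ℝ) : ℂ) * (𝓕 f : L2 d) ξ) 2 volume :=
    ⟨(Complex.continuous_ofReal.comp (continuous_wt _)).aestronglyMeasurable.mul
      (Lp.aestronglyMeasurable _), hf⟩
  refine ⟨hm.toLp _, ?_⟩
  apply (Lp.fourierTransformₗᵢ (Space d) ℂ).injective
  change 𝓕 (ofProfile k _) = 𝓕 f
  apply Lp.ext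
  filter_upwards [fourier_ofProfile_coe k (hm.toLp _), hm.coeFn_toLp] with ξ h1 h2
  rw [h1, h2, ← mul_assoc, ← Complex.ofReal_mul, wt_neg_mul]
  simp

/-- The inclusion `H^k ⊂ H^s`, measured by the profile. -/
lemma sobolevNorm_ofProfile_eq_ofReal {s : ℝ} {k : ℕ} (hs : s ≤ k) (h : L2 d) :
    sobolevNorm s (ofProfile k h) = ENNReal.ofReal ‖mulL2 (wtB (k - s)) h‖ := by
  rw [sobolevNorm_ofProfile hs, ofReal_norm]

/-! ### Schwartz functions -/

/-- The `H^s` profile `⟨ξ⟩^s 𝓕 f` of a Schwartz function. -/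
def profile (s : ℝ) (f : 𝓢(Space d, ℂ)) : 𝓢(Space d, ℂ) :=
  SchwartzMap.smulLeftCLM ℂ (fun ξ ↦ (wt s ξ : ℂ)) (𝓕 f)

lemma profile_apply (s : ℝ) (f : 𝓢(Space d, ℂ)) (ξ : Space d) :
    profile s f ξ = (wt s ξ : ℂ) * 𝓕 f ξ := by
  rw [profile, SchwartzMap.smulLeftCLM_apply_apply (hasTemperateGrowth_wt_complex s), smul_eq_mul]

/-- The `H^s` norm of a Schwartz function. -/
def sob (s : ℝ) (f : 𝓢(Space d, ℂ)) : ℝ := ‖(profile s f).toLp 2 volume‖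

lemma sob_nonneg (s : ℝ) (f : 𝓢(Space d, ℂ)) : 0 ≤ sob s f := norm_nonneg _

lemma profile_add (s : ℝ) (f g : 𝓢(Space d, ℂ)) : profile s (f + g) = profile s f + profile s g := by
  simp [profile, FourierTransform.fourier_add]

lemma profile_sub (s : ℝ) (f g : 𝓢(Space d, ℂ)) : profile s (f - g) = profile s f - profile s g := by
  have := map_sub (FourierTransform.fourierCLM ℂ 𝓢(Space d, ℂ)) f g
  simp only [FourierTransform.fourierCLM_apply] at this
  simp [profile, this]

lemma toLp_add (f g : 𝓢(Space d, ℂ)) :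
    (f + g).toLp 2 volume = f.toLp 2 volume + g.toLp 2 volume := rfl

lemma toLp_sub (f g : 𝓢(Space d, ℂ)) :
    (f - g).toLp 2 volume = f.toLp 2 volume - g.toLp 2 volume := rfl

lemma toLp_smul (c : ℂ) (f : 𝓢(Space d, ℂ)) :
    (c • f).toLp 2 volume = c • f.toLp 2 volume := rfl

lemma sob_add_le (s : ℝ) (f g : 𝓢(Space d, ℂ)) : sob s (f + g) ≤ sob s f + sob s g := by
  rw [sob, profile_add, toLp_add]; exact norm_add_le _ _

lemma norm_toLp_le_of_le {f g : 𝓢(Space d, ℂ)} (h : ∀ x, ‖f x‖ ≤ ‖g x‖) :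
    ‖f.toLp 2 volume‖ ≤ ‖g.toLp 2 volume‖ := by
  apply Lp.norm_le_norm_of_ae_le
  filter_upwards [f.coeFn_toLp 2 volume, g.coeFn_toLp 2 volume] with x h1 h2
  rw [h1, h2]; exact h x

lemma norm_toLp_le_mul_of_le {f g : 𝓢(Space d, ℂ)} {C : ℝ} (h : ∀ x, ‖f x‖ ≤ C * ‖g x‖) :
    ‖f.toLp 2 volume‖ ≤ C * ‖g.toLp 2 volume‖ := by
  apply Lp.norm_le_mul_norm_of_ae_le_mul
  filter_upwards [f.coeFn_toLp 2 volume, g.coeFn_toLp 2 volume] with x h1 h2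
  rw [h1, h2]; exact h x

lemma norm_profile_apply (s : ℝ) (f : 𝓢(Space d, ℂ)) (ξ : Space d) :
    ‖profile s f ξ‖ = wt s ξ * ‖𝓕 f ξ‖ := by
  rw [profile_apply, norm_mul, Complex.norm_real, Real.norm_of_nonneg (wt_nonneg _ _)]

lemma sob_mono {s t : ℝ} (h : s ≤ t) (f : 𝓢(Space d, ℂ)) : sob s f ≤ sob t f := by
  apply norm_toLp_le_of_le
  intro ξ
  rw [norm_profile_apply, norm_profile_apply]
  gcongr
  exact wt_mono h ξ

lemma sob_zero (f : 𝓢(Space d, ℂ)) : sob 0 f = ‖f.toLp 2 volume‖ := by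
  rw [← SchwartzMap.norm_fourier_toL2_eq f, sob]
  congr 2
  ext ξ; simp [profile_apply]

lemma ofProfile_profile (k : ℕ) (f : 𝓢(Space d, ℂ)) :
    ofProfile k ((profile k f).toLp 2 volume) = f.toLp 2 volume := by
  apply (Lp.fourierTransformₗᵢ (Space d) ℂ).injective
  change 𝓕 (ofProfile k _) = 𝓕 (f.toLp 2 volume)
  rw [SchwartzMap.toLp_fourier_eq]
  apply Lp.ext
  filter_upwards [fourier_ofProfile_coe k ((profile k f).toLp 2 volume),
    (profile k f).coeFn_toLp 2 volume, (𝓕 f).coeFn_toLp 2 volume] with ξ h1 h2 h3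
  rw [h1, h2, h3, profile_apply, ← mul_assoc, ← Complex.ofReal_mul, wt_neg_mul]
  simp

lemma sobolevNorm_toLp (s : ℝ) (f : 𝓢(Space d, ℂ)) :
    sobolevNorm s (f.toLp 2 volume) = ENNReal.ofReal (sob s f) := by
  rw [sob, ofReal_norm, Lp.enorm_def, sobolevNorm, SchwartzMap.toLp_fourier_eq]
  apply eLpNorm_congr_ae
  filter_upwards [(profile s f).coeFn_toLp 2 volume, (𝓕 f).coeFn_toLp 2 volume] with ξ h1 h2
  rw [h1, h2, profile_apply]; rfl

lemma profile_surjective (s : ℝ) : Function.Surjective (profile (d := d) s) := by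
  intro g
  refine ⟨𝓕⁻ (SchwartzMap.smulLeftCLM ℂ (fun ξ ↦ (wt (-s) ξ : ℂ)) g), ?_⟩
  ext ξ
  rw [profile_apply, FourierTransform.fourier_fourierInv_eq,
    SchwartzMap.smulLeftCLM_apply_apply (hasTemperateGrowth_wt_complex _), smul_eq_mul,
    ← mul_assoc, ← Complex.ofReal_mul, wt_mul_neg]
  simp

/-- Schwartz functions are dense in `H^s`. -/
lemma denseRange_profile (s : ℝ) :
    DenseRange (fun f : 𝓢(Space d, ℂ) ↦ (profile s f).toLp 2 volume) :=
  (SchwartzMap.denseRange_toLpCLM (F := ℂ) (E := Space d) (μ := volume) (p := 2)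
    ENNReal.ofNat_ne_top).comp (profile_surjective s).denseRange
    (SchwartzMap.toLpCLM ℝ ℂ 2 volume).continuous

lemma exists_seq_profile (s : ℝ) (h : L2 d) : ∃ f : ℕ → 𝓢(Space d, ℂ),
    Tendsto (fun n ↦ (profile s (f n)).toLp 2 volume) atTop (𝓝 h) := by
  obtain ⟨u, hu, hlim⟩ := mem_closure_iff_seq_limit.1 ((denseRange_profile s).closure_range ▸
    Set.mem_univ h)
  choose f hf using hu
  exact ⟨f, by simpa [hf] using hlim⟩

/-! ### Products of Schwartz functions in Sobolev spaces -/

/-- The pointwise product of two Schwartz functions. -/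
def mulS (f g : 𝓢(Space d, ℂ)) : 𝓢(Space d, ℂ) := SchwartzMap.smulLeftCLM ℂ f g

@[simp] lemma mulS_apply (f g : 𝓢(Space d, ℂ)) (x : Space d) : mulS f g x = f x * g x := by
  rw [mulS, SchwartzMap.smulLeftCLM_apply_apply f.hasTemperateGrowth, smul_eq_mul]

lemma fourier_eq_fourierInv_neg (f : 𝓢(Space d, ℂ)) (ξ : Space d) : 𝓕 f ξ = 𝓕⁻ f (-ξ) := by
  rw [SchwartzMap.fourier_coe, SchwartzMap.fourierInv_coe, Real.fourierInv_eq_fourier_neg, neg_neg]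

lemma fourierInv_fourier_schwartz (f : 𝓢(Space d, ℂ)) : 𝓕⁻ (𝓕 f) = f :=
  FourierTransform.fourierInv_fourier_eq f

lemma fourier_mulS (f g : 𝓢(Space d, ℂ)) (ξ : Space d) :
    𝓕 (mulS f g) ξ = ∫ η, 𝓕 f η * 𝓕 g (ξ - η) := by
  have h1 : mulS f g = SchwartzMap.pairing (ContinuousLinearMap.mul ℂ ℂ) f g := by
    ext x; simp
  have h2 : 𝓕⁻ (mulS f g) =
      SchwartzMap.convolution (ContinuousLinearMap.mul ℂ ℂ) (𝓕⁻ f) (𝓕⁻ g) := by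
    rw [h1, ← fourierInv_fourier_schwartz
      (SchwartzMap.convolution (ContinuousLinearMap.mul ℂ ℂ) (𝓕⁻ f) (𝓕⁻ g)),
      SchwartzMap.fourier_convolution]
    simp
  rw [fourier_eq_fourierInv_neg, h2, SchwartzMap.convolution_apply]
  change ∫ t, (𝓕⁻ f t) * (𝓕⁻ g (-ξ - t)) = _
  rw [← integral_neg_eq_self]
  refine integral_congr_ae (Eventually.of_forall fun η ↦ ?_)
  simp only [fourier_eq_fourierInv_neg]
  congr 2; abel

/-- Young's inequality `L¹ * L² ⊂ L²`. -/
lemma lintegral_convolution_sq_le {A B : Space d → ℝ≥0∞} (hA : Measurable A) (hB : Measurable B) :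
    ∫⁻ ξ, (∫⁻ η, A η * B (ξ - η)) ^ 2 ≤ (∫⁻ η, A η) ^ 2 * ∫⁻ η, B η ^ 2 := by
  have key : ∀ ξ, (∫⁻ η, A η * B (ξ - η)) ^ 2 ≤ (∫⁻ η, A η) * ∫⁻ η, A η * B (ξ - η) ^ 2 := by
    intro ξ
    have hm1 : Measurable fun η ↦ A η ^ (1 / 2 : ℝ) := by fun_prop
    have hm2 : Measurable fun η ↦ A η ^ (1 / 2 : ℝ) * B (ξ - η) := by fun_prop
    have h := ENNReal.lintegral_mul_le_Lp_mul_Lq volume (p := 2) (q := 2)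
      (by constructor <;> norm_num) hm1.aemeasurable hm2.aemeasurable
    have e1 : ∀ η, A η ^ (1 / 2 : ℝ) * (A η ^ (1 / 2 : ℝ) * B (ξ - η)) = A η * B (ξ - η) := by
      intro η
      rw [← mul_assoc, ← ENNReal.rpow_add_of_nonneg _ _ (by norm_num) (by norm_num)]
      norm_num
    have e2 : ∀ x : ℝ≥0∞, (x ^ (1 / 2 : ℝ)) ^ (2 : ℝ) = x := by
      intro x; rw [← ENNReal.rpow_mul]; norm_num
    simp only [Pi.mul_apply, e1, ENNReal.mul_rpow_of_nonneg _ _ (show (0 : ℝ) ≤ 2 by norm_num), e2]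
      at h
    calc (∫⁻ η, A η * B (ξ - η)) ^ 2
        ≤ ((∫⁻ η, A η) ^ (1 / 2 : ℝ) * (∫⁻ η, A η * B (ξ - η) ^ (2 : ℝ)) ^ (1 / 2 : ℝ)) ^ 2 := by
          gcongr
      _ = _ := by
          rw [mul_pow]
          simp only [← ENNReal.rpow_natCast, Nat.cast_ofNat, e2]
  calc ∫⁻ ξ, (∫⁻ η, A η * B (ξ - η)) ^ 2
      ≤ ∫⁻ ξ, (∫⁻ η, A η) * ∫⁻ η, A η * B (ξ - η) ^ 2 := lintegral_mono key
    _ = (∫⁻ η, A η) * ∫⁻ ξ, ∫⁻ η, A η * B (ξ - η) ^ 2 := by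
        rw [lintegral_const_mul]
        apply Measurable.lintegral_prod_right' (f := fun p : Space d × Space d ↦
          A p.2 * B (p.1 - p.2) ^ 2)
        fun_prop
    _ = (∫⁻ η, A η) * ∫⁻ η, ∫⁻ ξ, A η * B (ξ - η) ^ 2 := by
        rw [lintegral_lintegral_swap]
        apply Measurable.aemeasurable
        change Measurable fun p : Space d × Space d ↦ A p.2 * B (p.1 - p.2) ^ 2
        fun_prop
    _ = (∫⁻ η, A η) * ∫⁻ η, A η * ∫⁻ ξ, B ξ ^ 2 := by
        congr 1
        refine lintegral_congr fun η ↦ ?_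
        rw [lintegral_const_mul _ (by fun_prop),
          lintegral_sub_right_eq_self (fun ξ ↦ B ξ ^ 2) η]
    _ = _ := by
        rw [lintegral_mul_const _ hA, sq, mul_assoc]

lemma ofReal_norm_toLp_sq (f : 𝓢(Space d, ℂ)) :
    ENNReal.ofReal ‖f.toLp 2 volume‖ ^ 2 = ∫⁻ x, ‖f x‖ₑ ^ 2 := by
  rw [ofReal_norm, Lp.enorm_def, eLpNorm_congr_ae (f.coeFn_toLp 2 volume),
    eLpNorm_eq_lintegral_rpow_enorm_toReal (by norm_num) (by norm_num), ← ENNReal.rpow_natCast,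
    ← ENNReal.rpow_mul]
  simp

lemma lintegral_mul_sq_le {A B : Space d → ℝ≥0∞} (hA : Measurable A) (hB : Measurable B) :
    (∫⁻ η, A η * B η) ^ 2 ≤ (∫⁻ η, A η ^ 2) * ∫⁻ η, B η ^ 2 := by
  have h := ENNReal.lintegral_mul_le_Lp_mul_Lq volume (p := 2) (q := 2)
    (by constructor <;> norm_num) hA.aemeasurable hB.aemeasurable
  have e2 : ∀ x : ℝ≥0∞, (x ^ (1 / 2 : ℝ)) ^ (2 : ℝ) = x := by
    intro x; rw [← ENNReal.rpow_mul]; norm_num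
  calc (∫⁻ η, A η * B η) ^ 2 ≤ ((∫⁻ η, A η ^ (2 : ℝ)) ^ (1 / 2 : ℝ) *
        (∫⁻ η, B η ^ (2 : ℝ)) ^ (1 / 2 : ℝ)) ^ 2 := by gcongr; exact h
    _ = _ := by
      rw [mul_pow]
      simp only [← ENNReal.rpow_natCast, Nat.cast_ofNat, e2]

lemma wt_add_le {s : ℝ} (hs : 0 ≤ s) (ξ η : Space d) :
    wt s (ξ + η) ≤ 2 ^ s * (wt s ξ + wt s η) := by
  set a := 1 + (2 * Real.pi * ‖ξ‖) ^ 2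
  set b := 1 + (2 * Real.pi * ‖η‖) ^ 2
  have ha : 0 < a := wt_base_pos ξ
  have hb : 0 < b := wt_base_pos η
  have h1 : 1 + (2 * Real.pi * ‖ξ + η‖) ^ 2 ≤ 4 * max a b := by
    have h2 : 2 * Real.pi * ‖ξ + η‖ ≤ 2 * Real.pi * ‖ξ‖ + 2 * Real.pi * ‖η‖ := by
      rw [← mul_add]; gcongr; exact norm_add_le _ _
    have h3 : (2 * Real.pi * ‖ξ + η‖) ^ 2 ≤ (2 * Real.pi * ‖ξ‖ + 2 * Real.pi * ‖η‖) ^ 2 := by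
      gcongr
    have h4 := le_max_left a b
    have h5 := le_max_right a b
    nlinarith [sq_nonneg (2 * Real.pi * ‖ξ‖ - 2 * Real.pi * ‖η‖), sq_nonneg (2 * Real.pi * ‖ξ‖)]
  have h6 : (4 : ℝ) ^ (s / 2) = 2 ^ s := by
    rw [show (4 : ℝ) = 2 ^ (2 : ℝ) by norm_num, ← Real.rpow_mul (by norm_num)]
    congr 1; ring
  calc wt s (ξ + η) ≤ (4 * max a b) ^ (s / 2) :=
        Real.rpow_le_rpow (wt_base_pos _).le h1 (by positivity)
    _ = 2 ^ s * (max a b) ^ (s / 2) := by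
        rw [Real.mul_rpow (by norm_num) (le_max_of_le_left ha.le), h6]
    _ ≤ 2 ^ s * (wt s ξ + wt s η) := by
        gcongr
        rcases max_cases a b with ⟨h, -⟩ | ⟨h, -⟩
        · rw [h]; exact le_add_of_nonneg_right (wt_nonneg _ _)
        · rw [h]; exact le_add_of_nonneg_left (wt_nonneg _ _)

lemma wt_neg_mul_wt_neg_le {a b k : ℝ} (ha : 0 ≤ a) (hb : 0 ≤ b) (hk : k ≤ a + b)
    (ξ η : Space d) : wt (-a) ξ * wt (-b) η ≤ wt (-k) ξ + wt (-k) η := by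
  rcases le_total ‖ξ‖ ‖η‖ with h | h
  · have : wt (-b) η ≤ wt (-b) ξ := by
      apply Real.rpow_le_rpow_of_nonpos (wt_base_pos _) _ (by linarith)
      gcongr
    calc wt (-a) ξ * wt (-b) η ≤ wt (-a) ξ * wt (-b) ξ := by
          gcongr; exact wt_nonneg _ _
      _ = wt (-(a + b)) ξ := by rw [← wt_add]; congr 1; ring
      _ ≤ wt (-k) ξ := wt_mono (by linarith) _
      _ ≤ _ := le_add_of_nonneg_right (wt_nonneg _ _)
  · have : wt (-a) ξ ≤ wt (-a) η := by
      apply Real.rpow_le_rpow_of_nonpos (wt_base_pos _) _ (by linarith)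
      gcongr
    calc wt (-a) ξ * wt (-b) η ≤ wt (-a) η * wt (-b) η := by
          gcongr; exact wt_nonneg _ _
      _ = wt (-(a + b)) η := by rw [← wt_add]; congr 1; ring
      _ ≤ wt (-k) η := wt_mono (by linarith) _
      _ ≤ _ := le_add_of_nonneg_left (wt_nonneg _ _)

lemma norm_fourier_eq_profile (s : ℝ) (f : 𝓢(Space d, ℂ)) (ξ : Space d) :
    ‖𝓕 f ξ‖ = wt (-s) ξ * ‖profile s f ξ‖ := by
  rw [norm_profile_apply, ← mul_assoc, wt_neg_mul, one_mul]

/-- The product estimate `H^p · H^q ⊂ H^s` for `0 ≤ s ≤ min p q` and `p + q - s > d/2`. -/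
lemma sob_mulS_le {s p q k : ℝ} (hk : (d : ℝ) / 2 < k) (hs : 0 ≤ s) (hsp : s ≤ p) (hsq : s ≤ q)
    (hpq : k ≤ p + q - s) :
    ∃ C, 0 ≤ C ∧ ∀ f g : 𝓢(Space d, ℂ), sob s (mulS f g) ≤ C * sob p f * sob q g := by
  set W : ℝ≥0∞ := ∫⁻ ξ : Space d, ENNReal.ofReal (wt (-k) ξ) ^ 2 with hW
  have hWfin : W < ∞ := by
    have := (integrable_wt_sq hk).lintegral_lt_top
    simpa [hW, ENNReal.ofReal_pow (wt_nonneg _ _)] using this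
  obtain ⟨c, hc⟩ : ∃ c : ℝ, c = 2 * 2 ^ s := ⟨_, rfl⟩
  have hc0 : 0 ≤ c := by rw [hc]; positivity
  refine ⟨2 * c * √W.toReal, by positivity, fun f g ↦ ?_⟩
  set F : Space d → ℝ≥0∞ := fun ξ ↦ ‖profile p f ξ‖ₑ
  set G : Space d → ℝ≥0∞ := fun ξ ↦ ‖profile q g ξ‖ₑ
  set w : Space d → ℝ≥0∞ := fun ξ ↦ ENNReal.ofReal (wt (-k) ξ)
  have hF : Measurable F := (profile p f).continuous.enorm.measurable
  have hG : Measurable G := (profile q g).continuous.enorm.measurable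
  have hw : Measurable w := (continuous_wt _).measurable.ennreal_ofReal
  have key : ∀ ξ η : Space d, ENNReal.ofReal (wt s ξ) * ‖𝓕 f η * 𝓕 g (ξ - η)‖ₑ ≤
      ENNReal.ofReal c * ((w η * F η) * G (ξ - η) + F η * (w (ξ - η) * G (ξ - η))) := by
    intro ξ η
    have h1 : wt s ξ * (wt (-p) η * wt (-q) (ξ - η)) ≤ c * (wt (-k) η + wt (-k) (ξ - η)) := by
      have h2 : wt s ξ ≤ 2 ^ s * (wt s η + wt s (ξ - η)) := by
        simpa using wt_add_le hs η (ξ - η)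
      have h3 := wt_neg_mul_wt_neg_le (a := p - s) (b := q) (k := k) (by linarith) (by linarith)
        (by linarith) η (ξ - η)
      have h4 := wt_neg_mul_wt_neg_le (a := p) (b := q - s) (k := k) (by linarith) (by linarith)
        (by linarith) η (ξ - η)
      have e1 : wt (-(p - s)) η = wt s η * wt (-p) η := by rw [← wt_add]; congr 1; ring
      have e2 : wt (-(q - s)) (ξ - η) = wt s (ξ - η) * wt (-q) (ξ - η) := by
        rw [← wt_add]; congr 1; ring
      rw [e1] at h3
      rw [e2] at h4
      calc wt s ξ * (wt (-p) η * wt (-q) (ξ - η))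
          ≤ 2 ^ s * (wt s η + wt s (ξ - η)) * (wt (-p) η * wt (-q) (ξ - η)) := by
            gcongr
            exact mul_nonneg (wt_nonneg _ _) (wt_nonneg _ _)
        _ = 2 ^ s * (wt s η * wt (-p) η * wt (-q) (ξ - η) +
              wt (-p) η * (wt s (ξ - η) * wt (-q) (ξ - η))) := by ring
        _ ≤ 2 ^ s * ((wt (-k) η + wt (-k) (ξ - η)) + (wt (-k) η + wt (-k) (ξ - η))) := by
            gcongr
        _ = _ := by rw [hc]; ring
    have h5 : wt s ξ * ‖𝓕 f η * 𝓕 g (ξ - η)‖ ≤ c * (wt (-k) η * ‖profile p f η‖ *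
        ‖profile q g (ξ - η)‖ + ‖profile p f η‖ * (wt (-k) (ξ - η) * ‖profile q g (ξ - η)‖)) := by
      rw [norm_mul, norm_fourier_eq_profile p f, norm_fourier_eq_profile q g]
      calc _ = wt s ξ * (wt (-p) η * wt (-q) (ξ - η)) *
            (‖profile p f η‖ * ‖profile q g (ξ - η)‖) := by ring
        _ ≤ c * (wt (-k) η + wt (-k) (ξ - η)) *
            (‖profile p f η‖ * ‖profile q g (ξ - η)‖) := by gcongr
        _ = _ := by ring
    have h6 := ENNReal.ofReal_le_ofReal h5
    have n1 := wt_nonneg s ξ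
    have n2 := wt_nonneg (-k) η
    have n3 := wt_nonneg (-k) (ξ - η)
    rw [ENNReal.ofReal_mul n1, ENNReal.ofReal_mul hc0, ENNReal.ofReal_add (by positivity)
      (by positivity), ENNReal.ofReal_mul (by positivity), ENNReal.ofReal_mul n2,
      ENNReal.ofReal_mul (by positivity), ENNReal.ofReal_mul n3] at h6
    simpa only [ofReal_norm] using h6
  have pt : ∀ ξ, ‖profile s (mulS f g) ξ‖ₑ ^ 2 ≤ ENNReal.ofReal c ^ 2 *
      (2 * (∫⁻ η, (w η * F η) * G (ξ - η)) ^ 2 + 2 * (∫⁻ η, (w η * G η) * F (ξ - η)) ^ 2) := by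
    intro ξ
    have h1 : ‖profile s (mulS f g) ξ‖ₑ ≤ ENNReal.ofReal c *
        ((∫⁻ η, (w η * F η) * G (ξ - η)) + (∫⁻ η, (w η * G η) * F (ξ - η))) := by
      calc ‖profile s (mulS f g) ξ‖ₑ
          = ENNReal.ofReal (wt s ξ) * ‖∫ η, 𝓕 f η * 𝓕 g (ξ - η)‖ₑ := by
            rw [profile_apply, enorm_mul, fourier_mulS]
            congr 1
            rw [← ofReal_norm, Complex.norm_real, Real.norm_of_nonneg (wt_nonneg _ _)]
        _ ≤ ENNReal.ofReal (wt s ξ) * ∫⁻ η, ‖𝓕 f η * 𝓕 g (ξ - η)‖ₑ := by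
            gcongr; exact enorm_integral_le_lintegral_enorm _
        _ = ∫⁻ η, ENNReal.ofReal (wt s ξ) * ‖𝓕 f η * 𝓕 g (ξ - η)‖ₑ := by
            rw [lintegral_const_mul']; exact ENNReal.ofReal_ne_top
        _ ≤ ∫⁻ η, ENNReal.ofReal c * ((w η * F η) * G (ξ - η) +
              F η * (w (ξ - η) * G (ξ - η))) := lintegral_mono (key ξ)
        _ = ENNReal.ofReal c * ((∫⁻ η, (w η * F η) * G (ξ - η)) +
              ∫⁻ η, F η * (w (ξ - η) * G (ξ - η))) := by
            rw [lintegral_const_mul' _ _ ENNReal.ofReal_ne_top, lintegral_add_left (by fun_prop)]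
        _ = _ := by
            congr 2
            rw [← lintegral_sub_left_eq_self _ ξ]
            refine lintegral_congr fun η ↦ ?_
            simp only [sub_sub_cancel]
            ring
    calc ‖profile s (mulS f g) ξ‖ₑ ^ 2 ≤ (ENNReal.ofReal c *
        ((∫⁻ η, (w η * F η) * G (ξ - η)) + (∫⁻ η, (w η * G η) * F (ξ - η)))) ^ 2 := by gcongr
      _ ≤ _ := by
        rw [mul_pow]
        gcongr
        have := ENNReal.rpow_add_le_mul_rpow_add_rpow (∫⁻ η, (w η * F η) * G (ξ - η))
          (∫⁻ η, (w η * G η) * F (ξ - η)) (p := 2) (by norm_num)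
        norm_num at this
        simpa [mul_add] using this
  have hsF : (∫⁻ η, F η ^ 2) = ENNReal.ofReal (sob p f) ^ 2 := (ofReal_norm_toLp_sq _).symm
  have hsG : (∫⁻ η, G η ^ 2) = ENNReal.ofReal (sob q g) ^ 2 := (ofReal_norm_toLp_sq _).symm
  have fin : ENNReal.ofReal (sob s (mulS f g)) ^ 2 ≤ ENNReal.ofReal c ^ 2 *
      (4 * (W * ENNReal.ofReal (sob p f) ^ 2 * ENNReal.ofReal (sob q g) ^ 2)) := by
    rw [sob, ofReal_norm_toLp_sq]
    calc ∫⁻ ξ, ‖profile s (mulS f g) ξ‖ₑ ^ 2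
        ≤ ∫⁻ ξ, ENNReal.ofReal c ^ 2 * (2 * (∫⁻ η, (w η * F η) * G (ξ - η)) ^ 2 +
          2 * (∫⁻ η, (w η * G η) * F (ξ - η)) ^ 2) := lintegral_mono pt
      _ = ENNReal.ofReal c ^ 2 * (2 * (∫⁻ ξ, (∫⁻ η, (w η * F η) * G (ξ - η)) ^ 2) +
          2 * ∫⁻ ξ, (∫⁻ η, (w η * G η) * F (ξ - η)) ^ 2) := by
          rw [lintegral_const_mul' _ _ (by finiteness), lintegral_add_left,
            lintegral_const_mul' _ _ (by norm_num), lintegral_const_mul' _ _ (by norm_num)]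
          apply Measurable.const_mul
          apply Measurable.pow_const
          apply Measurable.lintegral_prod_right' (f := fun p : Space d × Space d ↦
            w p.2 * F p.2 * G (p.1 - p.2))
          fun_prop
      _ ≤ ENNReal.ofReal c ^ 2 * (2 * (W * (∫⁻ η, F η ^ 2) * ∫⁻ η, G η ^ 2) +
          2 * (W * (∫⁻ η, G η ^ 2) * ∫⁻ η, F η ^ 2)) := by
          gcongr
          · refine (lintegral_convolution_sq_le (by fun_prop) hG).trans ?_
            gcongr
            exact lintegral_mul_sq_le hw hF
          · refine (lintegral_convolution_sq_le (by fun_prop) hF).trans ?_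
            gcongr
            exact lintegral_mul_sq_le hw hG
      _ = _ := by rw [hsF, hsG]; ring
  have hWr : W = ENNReal.ofReal (√W.toReal) ^ 2 := by
    rw [← ENNReal.ofReal_pow (by positivity), Real.sq_sqrt ENNReal.toReal_nonneg,
      ENNReal.ofReal_toReal hWfin.ne]
  rw [hWr] at fin
  have e : ENNReal.ofReal c ^ 2 * (4 * (ENNReal.ofReal (√W.toReal) ^ 2 *
      ENNReal.ofReal (sob p f) ^ 2 * ENNReal.ofReal (sob q g) ^ 2)) =
      ENNReal.ofReal (2 * c * √W.toReal * sob p f * sob q g) ^ 2 := by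
    have n1 := sob_nonneg p f
    rw [ENNReal.ofReal_mul (by positivity), ENNReal.ofReal_mul (by positivity),
      ENNReal.ofReal_mul (by positivity), ENNReal.ofReal_mul (by positivity)]
    norm_num
    ring
  rw [e] at fin
  have := (ENNReal.pow_le_pow_left_iff (by norm_num)).1 fin
  exact (ENNReal.ofReal_le_ofReal_iff (by have := sob_nonneg p f; have := sob_nonneg q g; positivity)).1 this

/-- The embedding `H^k ⊂ L^∞` for `k > d/2`. -/
lemma norm_apply_le_sob {k : ℝ} (hk : (d : ℝ) / 2 < k) :
    ∃ C, 0 ≤ C ∧ ∀ (f : 𝓢(Space d, ℂ)) (x : Space d), ‖f x‖ ≤ C * sob k f := by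
  set W : ℝ≥0∞ := ∫⁻ ξ : Space d, ENNReal.ofReal (wt (-k) ξ) ^ 2 with hW
  have hWfin : W < ∞ := by
    have := (integrable_wt_sq hk).lintegral_lt_top
    simpa [hW, ENNReal.ofReal_pow (wt_nonneg _ _)] using this
  refine ⟨√W.toReal, by positivity, fun f x ↦ ?_⟩
  have hWr : W = ENNReal.ofReal (√W.toReal) ^ 2 := by
    rw [← ENNReal.ofReal_pow (by positivity), Real.sq_sqrt ENNReal.toReal_nonneg,
      ENNReal.ofReal_toReal hWfin.ne]
  have h1 : ‖f x‖ₑ ≤ ∫⁻ ξ, ‖𝓕 f ξ‖ₑ := by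
    conv_lhs => rw [← fourierInv_fourier_schwartz f]
    rw [SchwartzMap.fourierInv_coe, Real.fourierInv_eq]
    refine (enorm_integral_le_lintegral_enorm _).trans (lintegral_mono fun ξ ↦ ?_)
    rw [← ofReal_norm, ← ofReal_norm, Circle.norm_smul]
  have h2 : ∫⁻ ξ, ‖𝓕 f ξ‖ₑ = ∫⁻ ξ, ENNReal.ofReal (wt (-k) ξ) * ‖profile k f ξ‖ₑ := by
    refine lintegral_congr fun ξ ↦ ?_
    rw [← ofReal_norm, norm_fourier_eq_profile k, ENNReal.ofReal_mul (wt_nonneg _ _), ofReal_norm]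
  have h3 : ‖f x‖ₑ ^ 2 ≤ ENNReal.ofReal (√W.toReal * sob k f) ^ 2 := by
    calc ‖f x‖ₑ ^ 2 ≤ (∫⁻ ξ, ENNReal.ofReal (wt (-k) ξ) * ‖profile k f ξ‖ₑ) ^ 2 := by
          rw [← h2]; gcongr
      _ ≤ W * ∫⁻ ξ, ‖profile k f ξ‖ₑ ^ 2 :=
          lintegral_mul_sq_le (continuous_wt _).measurable.ennreal_ofReal
            (profile k f).continuous.enorm.measurable
      _ = _ := by
          rw [← ofReal_norm_toLp_sq, ENNReal.ofReal_mul (by positivity), mul_pow, ← hWr, sob]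
  have h4 := (ENNReal.pow_le_pow_left_iff (by norm_num)).1 h3
  rw [← ofReal_norm] at h4
  exact (ENNReal.ofReal_le_ofReal_iff (by have := sob_nonneg k f; positivity)).1 h4

/-- The `j`-th partial derivative. -/
def pd (j : Fin d) (f : 𝓢(Space d, ℂ)) : 𝓢(Space d, ℂ) :=
  ∂_{(EuclideanSpace.single j (1 : ℝ) : Space d)} f

lemma pd_apply (j : Fin d) (f : 𝓢(Space d, ℂ)) (x : Space d) :
    pd j f x = fderiv ℝ f x (EuclideanSpace.single j (1 : ℝ)) := by
  rw [pd, SchwartzMap.lineDerivOp_apply_eq_fderiv]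

lemma pd_sub (j : Fin d) (f g : 𝓢(Space d, ℂ)) : pd j (f - g) = pd j f - pd j g := by
  ext x
  have h1 : (⇑(f - g) : Space d → ℂ) = fun y ↦ f y - g y := rfl
  simp only [pd_apply, _root_.sub_apply, h1]
  rw [fderiv_fun_sub f.differentiableAt g.differentiableAt]
  rfl

lemma fourier_pd (j : Fin d) (f : 𝓢(Space d, ℂ)) (ξ : Space d) :
    𝓕 (pd j f) ξ = 2 * Real.pi * Complex.I * (ξ j : ℂ) * 𝓕 f ξ := by
  rw [pd, SchwartzMap.fourier_lineDerivOp_eq]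
  have : (inner ℝ · (EuclideanSpace.single j (1 : ℝ) : Space d)).HasTemperateGrowth := by fun_prop
  rw [_root_.smul_apply, SchwartzMap.smulLeftCLM_apply_apply this]
  simp only [EuclideanSpace.inner_single_right]
  simp [mul_assoc]

lemma norm_profile_pd (s : ℝ) (j : Fin d) (f : 𝓢(Space d, ℂ)) (ξ : Space d) :
    ‖profile s (pd j f) ξ‖ = wt s ξ * (2 * Real.pi * |ξ j| * ‖𝓕 f ξ‖) := by
  rw [norm_profile_apply, fourier_pd]
  simp [abs_of_pos Real.pi_pos]

lemma wt_one (ξ : Space d) : wt 1 ξ = √(1 + (2 * Real.pi * ‖ξ‖) ^ 2) := by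
  rw [wt, Real.sqrt_eq_rpow]

lemma abs_coord_le_wt (ξ : Space d) (j : Fin d) : 2 * Real.pi * |ξ j| ≤ wt 1 ξ := by
  rw [wt_one]
  apply Real.le_sqrt_of_sq_le
  have h : |ξ j| ≤ ‖ξ‖ := by simpa using PiLp.norm_apply_le ξ j
  have : (2 * Real.pi * |ξ j|) ^ 2 ≤ (2 * Real.pi * ‖ξ‖) ^ 2 := by gcongr
  linarith

lemma sob_pd_le (s : ℝ) (j : Fin d) (f : 𝓢(Space d, ℂ)) : sob s (pd j f) ≤ sob (s + 1) f := by
  apply norm_toLp_le_of_le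
  intro ξ
  rw [norm_profile_pd, norm_profile_apply, wt_add, mul_assoc (wt s ξ)]
  gcongr
  · exact wt_nonneg _ _
  · exact abs_coord_le_wt ξ j

lemma wt_one_le (ξ : Space d) : wt 1 ξ ≤ 1 + ∑ j, 2 * Real.pi * |ξ j| := by
  rw [wt_one]
  have h : ‖ξ‖ ≤ ∑ j, |ξ j| := by
    rw [EuclideanSpace.norm_eq]
    apply Real.sqrt_le_iff.2 ⟨by positivity, ?_⟩
    simpa using Finset.sum_sq_le_sq_sum_of_nonneg (s := Finset.univ) (f := fun j ↦ |ξ j|)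
      (fun j _ ↦ abs_nonneg _)
  rw [← Finset.mul_sum]
  apply Real.sqrt_le_iff.2 ⟨by positivity, ?_⟩
  have : (2 * Real.pi * ‖ξ‖) ^ 2 ≤ (2 * Real.pi * ∑ j, |ξ j|) ^ 2 := by gcongr
  have h0 : 0 ≤ 2 * Real.pi * ∑ j, |ξ j| := by positivity
  nlinarith

lemma sob_add_one_le (s : ℝ) (f : 𝓢(Space d, ℂ)) :
    sob (s + 1) f ≤ sob s f + ∑ j, sob s (pd j f) := by
  have e : ∀ g : 𝓢(Space d, ℂ), ENNReal.ofReal ‖g.toLp 2 volume‖ = eLpNorm (fun x ↦ ‖g x‖) 2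
      volume := by
    intro g
    rw [ofReal_norm, Lp.enorm_def, eLpNorm_congr_ae (g.coeFn_toLp 2 volume), eLpNorm_norm]
  have m : ∀ g : 𝓢(Space d, ℂ), AEStronglyMeasurable (fun x ↦ ‖g x‖) volume :=
    fun g ↦ g.continuous.norm.aestronglyMeasurable
  rw [← ENNReal.ofReal_le_ofReal_iff
    (add_nonneg (sob_nonneg _ _) (Finset.sum_nonneg fun j _ ↦ sob_nonneg _ _)),
    ENNReal.ofReal_add (sob_nonneg _ _) (Finset.sum_nonneg fun j _ ↦ sob_nonneg _ _),
    ENNReal.ofReal_sum_of_nonneg (fun j _ ↦ sob_nonneg _ _)]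
  simp only [sob, e]
  calc eLpNorm (fun ξ ↦ ‖profile (s + 1) f ξ‖) 2 volume
      ≤ eLpNorm ((fun ξ ↦ ‖profile s f ξ‖) + ∑ j, fun ξ ↦ ‖profile s (pd j f) ξ‖) 2 volume := by
        apply eLpNorm_mono_real
        intro ξ
        rw [norm_norm]
        simp only [Pi.add_apply, Finset.sum_apply, norm_profile_pd]
        simp only [norm_profile_apply, wt_add]
        rw [← Finset.mul_sum, ← Finset.sum_mul, mul_assoc, ← mul_add]
        gcongr
        · exact wt_nonneg _ _
        · calc wt 1 ξ * ‖𝓕 f ξ‖ ≤ (1 + ∑ j, 2 * Real.pi * |ξ j|) * ‖𝓕 f ξ‖ := by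
                gcongr; exact wt_one_le ξ
            _ = _ := by ring
    _ ≤ _ := by
        refine (eLpNorm_add_le (m _) (by
          apply Finset.aestronglyMeasurable_sum; exact fun j _ ↦ m _) (by norm_num)).trans ?_
        gcongr
        exact eLpNorm_sum_le (fun j _ ↦ m _) (by norm_num)

/-- Complex conjugation of Schwartz functions. -/
def conjS (f : 𝓢(Space d, ℂ)) : 𝓢(Space d, ℂ) :=
  SchwartzMap.postcompCLM (𝕜 := ℝ) (Complex.conjCLE : ℂ →L[ℝ] ℂ) f

@[simp] lemma conjS_apply (f : 𝓢(Space d, ℂ)) (x : Space d) : conjS f x = conj (f x) := rfl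

lemma fourier_conjS (f : 𝓢(Space d, ℂ)) (ξ : Space d) : 𝓕 (conjS f) ξ = conj (𝓕 f (-ξ)) := by
  rw [SchwartzMap.fourier_coe, SchwartzMap.fourier_coe, Real.fourier_eq, Real.fourier_eq,
    ← integral_conj]
  refine integral_congr_ae (Eventually.of_forall fun x ↦ ?_)
  simp [Circle.smul_def, ← Circle.coe_inv_eq_conj, AddChar.map_neg_eq_inv]

lemma sob_conjS (s : ℝ) (f : 𝓢(Space d, ℂ)) : sob s (conjS f) = sob s f := by
  have h : ENNReal.ofReal (sob s (conjS f)) ^ 2 = ENNReal.ofReal (sob s f) ^ 2 := by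
    rw [sob, sob, ofReal_norm_toLp_sq, ofReal_norm_toLp_sq, ← lintegral_neg_eq_self]
    refine lintegral_congr fun ξ ↦ ?_
    rw [← ofReal_norm, ← ofReal_norm, norm_profile_apply, norm_profile_apply, fourier_conjS]
    simp
  have h2 : ENNReal.ofReal (sob s (conjS f)) = ENNReal.ofReal (sob s f) :=
    le_antisymm ((ENNReal.pow_le_pow_left_iff (by norm_num)).1 h.le)
      ((ENNReal.pow_le_pow_left_iff (by norm_num)).1 h.ge)
  exact (ENNReal.ofReal_eq_ofReal_iff (sob_nonneg _ _) (sob_nonneg _ _)).1 h2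

/-! ### Regularized power nonlinearities -/

/-- A family of functions on `ℂ`, indexed by a regularization parameter, that is of temperate
growth and bounded on bounded sets, uniformly in the parameter. -/
def TameBase (G : ℝ → ℂ → ℂ) : Prop :=
  (∀ ε, 0 < ε → Function.HasTemperateGrowth (G ε)) ∧
    ∀ R : ℝ, ∃ C, 0 ≤ C ∧ ∀ ε ∈ Set.Ioc (0 : ℝ) 1, ∀ z : ℂ, ‖z‖ ≤ R → ‖G ε z‖ ≤ C

/-- A family of functions on `ℂ` all of whose Wirtinger derivatives of order at most `m` are bounded
on bounded sets, uniformly in the parameter. -/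
def Tame : ℕ → (ℝ → ℂ → ℂ) → Prop
  | 0, G => TameBase G
  | m + 1, G => TameBase G ∧ ∃ G₁ G₂ : ℝ → ℂ → ℂ, Tame m G₁ ∧ Tame m G₂ ∧ ∀ ε, 0 < ε → ∀ z,
      HasFDerivAt (G ε) (G₁ ε z • (1 : ℂ →L[ℝ] ℂ) + G₂ ε z • (Complex.conjCLE : ℂ →L[ℝ] ℂ)) z

lemma Tame.base {m : ℕ} {G : ℝ → ℂ → ℂ} (h : Tame m G) : TameBase G := by
  cases m with
  | zero => exact h
  | succ m => exact h.1

lemma Tame.of_succ {m : ℕ} {G : ℝ → ℂ → ℂ} (h : Tame (m + 1) G) : Tame m G := by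
  induction m generalizing G with
  | zero => exact h.1
  | succ m ih =>
    obtain ⟨h0, G₁, G₂, h1, h2, h3⟩ := h
    exact ⟨h0, G₁, G₂, ih h1, ih h2, h3⟩

lemma TameBase.const_mul {G : ℝ → ℂ → ℂ} (h : TameBase G) (c : ℂ) :
    TameBase (fun ε z ↦ c * G ε z) := by
  refine ⟨fun ε hε ↦ (Function.HasTemperateGrowth.const c).mul (h.1 ε hε), fun R ↦ ?_⟩
  obtain ⟨C, hC, h2⟩ := h.2 R
  refine ⟨‖c‖ * C, by positivity, fun ε hε z hz ↦ ?_⟩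
  rw [norm_mul]
  gcongr
  exact h2 ε hε z hz

lemma TameBase.add {G H : ℝ → ℂ → ℂ} (hG : TameBase G) (hH : TameBase H) :
    TameBase (fun ε z ↦ G ε z + H ε z) := by
  refine ⟨fun ε hε ↦ (hG.1 ε hε).add (hH.1 ε hε), fun R ↦ ?_⟩
  obtain ⟨C, hC, h2⟩ := hG.2 R
  obtain ⟨C', hC', h2'⟩ := hH.2 R
  exact ⟨C + C', by positivity, fun ε hε z hz ↦
    (norm_add_le _ _).trans (add_le_add (h2 ε hε z hz) (h2' ε hε z hz))⟩

lemma Tame.const_mul {m : ℕ} {G : ℝ → ℂ → ℂ} (h : Tame m G) (c : ℂ) :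
    Tame m (fun ε z ↦ c * G ε z) := by
  induction m generalizing G with
  | zero => exact TameBase.const_mul h c
  | succ m ih =>
    obtain ⟨h0, G₁, G₂, h1, h2, h3⟩ := h
    refine ⟨h0.const_mul c, _, _, ih h1, ih h2, fun ε hε z ↦ ?_⟩
    refine ((h3 ε hε z).const_mul c).congr_fderiv ?_
    rw [smul_add, smul_smul, smul_smul]

lemma Tame.add {m : ℕ} {G H : ℝ → ℂ → ℂ} (hG : Tame m G) (hH : Tame m H) :
    Tame m (fun ε z ↦ G ε z + H ε z) := by
  induction m generalizing G H with
  | zero => exact TameBase.add hG hH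
  | succ m ih =>
    obtain ⟨h0, G₁, G₂, h1, h2, h3⟩ := hG
    obtain ⟨h0', H₁, H₂, h1', h2', h3'⟩ := hH
    refine ⟨h0.add h0', _, _, ih h1 h1', ih h2 h2', fun ε hε z ↦ ?_⟩
    refine ((h3 ε hε z).add (h3' ε hε z)).congr_fderiv ?_
    apply ContinuousLinearMap.ext
    intro w
    simp only [_root_.add_apply, _root_.smul_apply, smul_eq_mul]
    ring

lemma tame_zero (m : ℕ) : Tame m (fun _ _ ↦ 0) := by
  have h0 : TameBase (fun _ _ ↦ 0) :=
    ⟨fun ε _ ↦ Function.HasTemperateGrowth.const 0, fun R ↦ ⟨0, le_rfl, by simp⟩⟩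
  induction m with
  | zero => exact h0
  | succ m ih =>
    refine ⟨h0, _, _, ih, ih, fun ε hε z ↦ ?_⟩
    refine (hasFDerivAt_const (𝕜 := ℝ) (0 : ℂ) z).congr_fderiv ?_
    apply ContinuousLinearMap.ext
    intro w
    simp

/-- The function `z^a z̄^b (ε² + |z|²)^p`. -/
def regPow (a b : ℕ) (p : ℝ) (ε : ℝ) (z : ℂ) : ℂ :=
  z ^ a * conj z ^ b * (((ε ^ 2 + ‖z‖ ^ 2) ^ p : ℝ) : ℂ)

lemma hasTemperateGrowth_regPow (a b : ℕ) (p : ℝ) {ε : ℝ} (hε : 0 < ε) :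
    Function.HasTemperateGrowth (regPow a b p ε) := by
  have h1 : Function.HasTemperateGrowth (fun z : ℂ ↦ (ε ^ 2 + ‖z‖ ^ 2) ^ p) := by
    have h2 := (Function.hasTemperateGrowth_one_add_norm_sq_rpow ℂ p).comp
      (ε⁻¹ • ContinuousLinearMap.id ℝ ℂ).hasTemperateGrowth
    have h3 := (Function.HasTemperateGrowth.const (E := ℂ) ((ε ^ 2) ^ p)).mul h2
    suffices e : (fun z : ℂ ↦ (ε ^ 2 + ‖z‖ ^ 2) ^ p) = (fun _ ↦ (ε ^ 2) ^ p) *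
        (fun x : ℂ ↦ (1 + ‖x‖ ^ 2) ^ p) ∘ ⇑(ε⁻¹ • ContinuousLinearMap.id ℝ ℂ) by
      rw [e]; exact h3
    funext z
    simp only [Pi.mul_apply, Function.comp_apply, _root_.smul_apply,
      ContinuousLinearMap.id_apply, norm_smul, Real.norm_eq_abs, abs_of_pos (inv_pos.2 hε)]
    rw [← Real.mul_rpow (by positivity) (by positivity)]
    congr 1
    field_simp
  have h4 : Function.HasTemperateGrowth (fun z : ℂ ↦ (((ε ^ 2 + ‖z‖ ^ 2) ^ p : ℝ) : ℂ)) := by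
    fun_prop
  have h5 : Function.HasTemperateGrowth (fun z : ℂ ↦ conj z) :=
    (Complex.conjCLE : ℂ →L[ℝ] ℂ).hasTemperateGrowth
  exact ((Function.HasTemperateGrowth.id'.pow a).mul (h5.pow b)).mul h4

lemma norm_regPow_le (a b : ℕ) (p : ℝ) (ε : ℝ) (hε : 0 < ε) (z : ℂ) :
    ‖regPow a b p ε z‖ ≤ (ε ^ 2 + ‖z‖ ^ 2) ^ ((a + b) / 2 + p) := by
  have hq : 0 < ε ^ 2 + ‖z‖ ^ 2 := by positivity
  have h1 : ‖z‖ ≤ (ε ^ 2 + ‖z‖ ^ 2) ^ (1 / 2 : ℝ) := by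
    rw [← Real.sqrt_eq_rpow]
    apply Real.le_sqrt_of_sq_le
    linarith [sq_nonneg ε]
  rw [regPow, norm_mul, norm_mul, norm_pow, norm_pow, RCLike.norm_conj, Complex.norm_real,
    Real.norm_of_nonneg (by positivity), ← pow_add, Real.rpow_add hq]
  gcongr
  calc ‖z‖ ^ (a + b) ≤ ((ε ^ 2 + ‖z‖ ^ 2) ^ (1 / 2 : ℝ)) ^ (a + b) := by gcongr
    _ = _ := by
      rw [← Real.rpow_mul_natCast hq.le]; congr 1; push_cast; ring

lemma tameBase_regPow (a b : ℕ) {p : ℝ} (hp : 0 ≤ a + b + 2 * p) : TameBase (regPow a b p) := by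
  refine ⟨fun ε hε ↦ hasTemperateGrowth_regPow a b p hε, fun R ↦ ?_⟩
  refine ⟨(1 + R ^ 2) ^ (((a : ℝ) + b) / 2 + p), by positivity, fun ε hε z hz ↦ ?_⟩
  refine (norm_regPow_le a b p ε hε.1 z).trans ?_
  have h1 : ε ^ 2 ≤ 1 := by nlinarith [hε.1, hε.2]
  have h2 : ‖z‖ ^ 2 ≤ R ^ 2 := by gcongr
  gcongr
  linarith

lemma hasFDerivAt_regPow (a b : ℕ) (p : ℝ) {ε : ℝ} (hε : 0 < ε) (z : ℂ) :
    HasFDerivAt (regPow a b p ε)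
      ((a * regPow (a - 1) b p ε z + p * regPow a (b + 1) (p - 1) ε z) • (1 : ℂ →L[ℝ] ℂ) +
        (b * regPow a (b - 1) p ε z + p * regPow (a + 1) b (p - 1) ε z) •
          (Complex.conjCLE : ℂ →L[ℝ] ℂ)) z := by
  have hq : 0 < ε ^ 2 + ‖z‖ ^ 2 := by positivity
  have h1 : HasFDerivAt (fun z : ℂ ↦ z ^ a) ((a * z ^ (a - 1)) • (1 : ℂ →L[ℝ] ℂ)) z := by
    have := (hasDerivAt_pow a z).hasFDerivAt.restrictScalars ℝ
    refine this.congr_fderiv ?_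
    apply ContinuousLinearMap.ext
    intro w
    simp [mul_comm]
  have h2 : HasFDerivAt (fun z : ℂ ↦ conj z ^ b)
      ((b * conj z ^ (b - 1)) • (Complex.conjCLE : ℂ →L[ℝ] ℂ)) z := by
    have h := (hasDerivAt_pow b (conj z)).hasFDerivAt.restrictScalars ℝ
    have := h.comp z (Complex.conjCLE : ℂ →L[ℝ] ℂ).hasFDerivAt
    refine this.congr_fderiv ?_
    apply ContinuousLinearMap.ext
    intro w
    simp [mul_comm]
  have h3 : HasFDerivAt (fun z : ℂ ↦ (((ε ^ 2 + ‖z‖ ^ 2) ^ p : ℝ) : ℂ))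
      ((p * (((ε ^ 2 + ‖z‖ ^ 2) ^ (p - 1) : ℝ) : ℂ)) • (conj z • (1 : ℂ →L[ℝ] ℂ) +
        z • (Complex.conjCLE : ℂ →L[ℝ] ℂ))) z := by
    have h := ((hasFDerivAt_id z).norm_sq.const_add (ε ^ 2)).rpow_const (p := p) (Or.inl hq.ne')
    have := (Complex.ofRealCLM.hasFDerivAt).comp z h
    refine this.congr_fderiv ?_
    apply ContinuousLinearMap.ext
    intro w
    simp [Complex.inner]
    apply Complex.ext <;> simp <;> ring
  have h4 := (h1.fun_mul h2).fun_mul h3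
  refine h4.congr_fderiv ?_
  apply ContinuousLinearMap.ext
  intro w
  simp only [regPow, _root_.add_apply, _root_.smul_apply,
    one_apply_eq_self, smul_eq_mul, pow_succ, ContinuousLinearEquiv.coe_coe,
    Complex.conjCLE_apply]
  ring

/-- The order of homogeneity of `regPow a b p` bounds the number of its tame derivatives, unless
`regPow a b p` is a polynomial. -/
lemma tame_regPow (m a b : ℕ) (p : ℝ) (h : (∃ n : ℕ, p = n) ∨ (m : ℝ) ≤ a + b + 2 * p) :
    Tame m (regPow a b p) := by
  induction m generalizing a b p with
  | zero =>
    apply tameBase_regPow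
    rcases h with ⟨n, rfl⟩ | h
    · positivity
    · simpa using h
  | succ m ih =>
    have hb : TameBase (regPow a b p) := by
      apply tameBase_regPow
      rcases h with ⟨n, rfl⟩ | h
      · positivity
      · push_cast at h; have : (0 : ℝ) ≤ m := by positivity
        linarith
    have ha' : Tame m (fun ε z ↦ (a : ℂ) * regPow (a - 1) b p ε z) := by
      rcases a with _ | a
      · simpa using tame_zero m
      · refine (ih a b p ?_).const_mul _
        rcases h with h | h
        · exact Or.inl h
        · right; push_cast at h ⊢; linarith
    have hb' : Tame m (fun ε z ↦ (b : ℂ) * regPow a (b - 1) p ε z) := by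
      rcases b with _ | b
      · simpa using tame_zero m
      · refine (ih a b p ?_).const_mul _
        rcases h with h | h
        · exact Or.inl h
        · right; push_cast at h ⊢; linarith
    have hp : p = 0 ∨ ((∃ n : ℕ, p - 1 = n) ∨ ((m : ℝ) + 1 ≤ a + b + 2 * p)) := by
      rcases h with ⟨n, rfl⟩ | h
      · rcases n with _ | n
        · simp
        · right; left; exact ⟨n, by push_cast; ring⟩
      · right; right; exact_mod_cast h
    have hp1 : Tame m (fun ε z ↦ (p : ℂ) * regPow a (b + 1) (p - 1) ε z) := by
      rcases hp with rfl | hp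
      · simpa using tame_zero m
      · refine (ih a (b + 1) (p - 1) ?_).const_mul _
        rcases hp with hp | hp
        · exact Or.inl hp
        · right; push_cast; linarith
    have hp2 : Tame m (fun ε z ↦ (p : ℂ) * regPow (a + 1) b (p - 1) ε z) := by
      rcases hp with rfl | hp
      · simpa using tame_zero m
      · refine (ih (a + 1) b (p - 1) ?_).const_mul _
        rcases hp with hp | hp
        · exact Or.inl hp
        · right; push_cast; linarith
    exact ⟨hb, _, _, ha'.add hp1, hb'.add hp2, fun ε hε z ↦ hasFDerivAt_regPow a b p hε z⟩

/-! ### Composition with tame families in Sobolev spaces -/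

/-- The Schwartz function `G(u) v`. -/
def compMul (G : ℂ → ℂ) (u v : 𝓢(Space d, ℂ)) : 𝓢(Space d, ℂ) :=
  SchwartzMap.smulLeftCLM ℂ (fun x ↦ G (u x)) v

lemma compMul_apply {G : ℂ → ℂ} (hG : Function.HasTemperateGrowth G) (u v : 𝓢(Space d, ℂ))
    (x : Space d) : compMul G u v x = G (u x) * v x := by
  have h : Function.HasTemperateGrowth (fun x ↦ G (u x)) := hG.comp u.hasTemperateGrowth
  rw [compMul, SchwartzMap.smulLeftCLM_apply_apply h, smul_eq_mul]

lemma fderiv_comp_apply {G : ℂ → ℂ} {g₁ g₂ : ℂ} (u : 𝓢(Space d, ℂ)) (x : Space d) (j : Fin d)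
    (h : HasFDerivAt G (g₁ • (1 : ℂ →L[ℝ] ℂ) + g₂ • (Complex.conjCLE : ℂ →L[ℝ] ℂ)) (u x)) :
    DifferentiableAt ℝ (fun y ↦ G (u y)) x ∧
    fderiv ℝ (fun y ↦ G (u y)) x (EuclideanSpace.single j (1 : ℝ)) =
      g₁ * pd j u x + g₂ * conj (pd j u x) := by
  have h1 := h.comp x (u.hasFDerivAt x)
  refine ⟨h1.differentiableAt, ?_⟩
  have h2 : fderiv ℝ (fun y ↦ G (u y)) x = _ := h1.fderiv
  rw [h2, pd_apply]
  simp

lemma pd_compMul {G G₁ G₂ : ℂ → ℂ} (hG : Function.HasTemperateGrowth G)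
    (hG₁ : Function.HasTemperateGrowth G₁) (hG₂ : Function.HasTemperateGrowth G₂)
    (hd : ∀ z, HasFDerivAt G (G₁ z • (1 : ℂ →L[ℝ] ℂ) + G₂ z • (Complex.conjCLE : ℂ →L[ℝ] ℂ)) z)
    (u v : 𝓢(Space d, ℂ)) (j : Fin d) :
    pd j (compMul G u v) = compMul G₁ u (mulS (pd j u) v) +
      compMul G₂ u (mulS (conjS (pd j u)) v) + compMul G u (pd j v) := by
  ext x
  obtain ⟨h1, h2⟩ := fderiv_comp_apply u x j (hd (u x))
  have e : (⇑(compMul G u v) : Space d → ℂ) = fun y ↦ G (u y) * v y := by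
    funext y; exact compMul_apply hG u v y
  rw [pd_apply, e, fderiv_fun_mul h1 v.differentiableAt]
  simp only [_root_.add_apply, _root_.smul_apply, h2, smul_eq_mul,
    compMul_apply hG, compMul_apply hG₁, compMul_apply hG₂, mulS_apply,
    conjS_apply, pd_apply]
  ring

lemma sob_le_sob_of_norm_le {f g : 𝓢(Space d, ℂ)} {C : ℝ} (h : ∀ x, ‖f x‖ ≤ C * ‖g x‖) :
    sob 0 f ≤ C * sob 0 g := by
  rw [sob_zero, sob_zero]; exact norm_toLp_le_mul_of_le h

lemma sob_compMul_le {k : ℕ} (hk : (d : ℝ) / 2 < k) (m : ℕ) (hm : m ≤ k) {G : ℝ → ℂ → ℂ}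
    (hG : Tame m G) (M : ℝ) :
    ∃ C, 0 ≤ C ∧ ∀ ε ∈ Set.Ioc (0 : ℝ) 1, ∀ u v : 𝓢(Space d, ℂ), sob k u ≤ M →
      sob m (compMul (G ε) u v) ≤ C * sob m v := by
  induction m generalizing G with
  | zero =>
    obtain ⟨B, hB, hB2⟩ := norm_apply_le_sob hk
    obtain ⟨C, hC, hC2⟩ := hG.2 (B * M)
    refine ⟨C, hC, fun ε hε u v hu ↦ ?_⟩
    simp only [Nat.cast_zero]
    apply sob_le_sob_of_norm_le
    intro x
    rw [compMul_apply (hG.1 ε hε.1), norm_mul]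
    gcongr
    apply hC2 ε hε
    exact (hB2 u x).trans (by gcongr)
  | succ m ih =>
    obtain ⟨C₀, hC₀, H₀⟩ := ih (by lia) hG.of_succ
    obtain ⟨hb, G₁, G₂, h1, h2, h3⟩ := hG
    obtain ⟨C₁, hC₁, H₁⟩ := ih (by lia) h1
    obtain ⟨C₂, hC₂, H₂⟩ := ih (by lia) h2
    have hmk : (m : ℝ) + 1 ≤ k := by exact_mod_cast hm
    obtain ⟨P, hP, HP⟩ := sob_mulS_le (d := d) (s := m) (p := k - 1) (q := m + 1) hk (by positivity)
      (by linarith) (by linarith) (by linarith)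
    refine ⟨C₀ + d * (C₁ * (P * |M|) + C₂ * (P * |M|) + C₀), by positivity,
      fun ε hε u v hu ↦ ?_⟩
    have hM : sob k u ≤ |M| := hu.trans (le_abs_self M)
    have hv0 := sob_nonneg (m + 1 : ℝ) v
    have hpd : ∀ j, sob (k - 1) (pd j u) ≤ |M| := fun j ↦ by
      have := sob_pd_le (k - 1 : ℝ) j u
      rw [sub_add_cancel] at this
      exact this.trans hM
    have hvm : sob m v ≤ sob (m + 1) v := sob_mono (by linarith) v
    have e1 : sob m (compMul (G ε) u v) ≤ C₀ * sob (m + 1) v :=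
      (H₀ ε hε u v hu).trans (by gcongr)
    have e2 : ∀ j, sob m (pd j (compMul (G ε) u v)) ≤
        (C₁ * (P * |M|) + C₂ * (P * |M|) + C₀) * sob (m + 1) v := by
      intro j
      rw [pd_compMul (hb.1 ε hε.1) (h1.base.1 ε hε.1) (h2.base.1 ε hε.1) (h3 ε hε.1)]
      have t1 : sob m (compMul (G₁ ε) u (mulS (pd j u) v)) ≤
          C₁ * (P * |M|) * sob (m + 1) v := by
        calc _ ≤ C₁ * sob m (mulS (pd j u) v) := H₁ ε hε u _ hu
          _ ≤ C₁ * (P * |M| * sob (m + 1) v) := by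
            gcongr
            refine (HP _ _).trans ?_
            gcongr
            exact hpd j
          _ = _ := by ring
      have t2 : sob m (compMul (G₂ ε) u (mulS (conjS (pd j u)) v)) ≤
          C₂ * (P * |M|) * sob (m + 1) v := by
        calc _ ≤ C₂ * sob m (mulS (conjS (pd j u)) v) := H₂ ε hε u _ hu
          _ ≤ C₂ * (P * |M| * sob (m + 1) v) := by
            gcongr
            refine (HP _ _).trans ?_
            rw [sob_conjS]
            gcongr
            exact hpd j
          _ = _ := by ring
      have t3 : sob m (compMul (G ε) u (pd j v)) ≤ C₀ * sob (m + 1) v :=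
        (H₀ ε hε u _ hu).trans (by gcongr; exact sob_pd_le _ _ _)
      calc _ ≤ sob m (compMul (G₁ ε) u (mulS (pd j u) v)) +
            sob m (compMul (G₂ ε) u (mulS (conjS (pd j u)) v)) +
            sob m (compMul (G ε) u (pd j v)) :=
            (sob_add_le _ _ _).trans (by gcongr; exact sob_add_le _ _ _)
        _ ≤ _ := by linarith
    push_cast
    calc sob (m + 1) (compMul (G ε) u v) ≤ sob m (compMul (G ε) u v) +
          ∑ j, sob m (pd j (compMul (G ε) u v)) := sob_add_one_le _ _
      _ ≤ C₀ * sob (m + 1) v + ∑ j : Fin d,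
          (C₁ * (P * |M|) + C₂ * (P * |M|) + C₀) * sob (m + 1) v := by
          gcongr with j; exact e2 j
      _ = _ := by
          rw [Finset.sum_const, Finset.card_univ, Fintype.card_fin, nsmul_eq_mul]; ring

/-- A tame family is Lipschitz on bounded sets, uniformly in the parameter. -/
lemma Tame.lipschitz {G : ℝ → ℂ → ℂ} (hG : Tame 1 G) (R : ℝ) :
    ∃ C, 0 ≤ C ∧ ∀ ε ∈ Set.Ioc (0 : ℝ) 1, ∀ z w : ℂ, ‖z‖ ≤ R → ‖w‖ ≤ R →
      ‖G ε z - G ε w‖ ≤ C * ‖z - w‖ := by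
  obtain ⟨hb, G₁, G₂, h1, h2, h3⟩ := hG
  obtain ⟨C₁, hC₁, H₁⟩ := h1.2 R
  obtain ⟨C₂, hC₂, H₂⟩ := h2.2 R
  refine ⟨C₁ + C₂, by positivity, fun ε hε z w hz hw ↦ ?_⟩
  apply (convex_closedBall (0 : ℂ) R).norm_image_sub_le_of_norm_hasFDerivWithin_le
    (fun x _ ↦ (h3 ε hε.1 x).hasFDerivWithinAt) _ (by simpa using hw) (by simpa using hz)
  intro x hx
  have hx' : ‖x‖ ≤ R := by simpa using hx
  apply ContinuousLinearMap.opNorm_le_bound _ (by positivity)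
  intro y
  simp only [_root_.add_apply, _root_.smul_apply,
    one_apply_eq_self, ContinuousLinearEquiv.coe_coe, Complex.conjCLE_apply,
    smul_eq_mul]
  refine (norm_add_le _ _).trans ?_
  rw [norm_mul, norm_mul, RCLike.norm_conj, add_mul]
  gcongr
  · exact H₁ ε hε x hx'
  · exact H₂ ε hε x hx'

lemma compMul_sub (G : ℂ → ℂ) (u v w : 𝓢(Space d, ℂ)) :
    compMul G u (v - w) = compMul G u v - compMul G u w := map_sub _ _ _

lemma mulS_sub_left (f g h : 𝓢(Space d, ℂ)) : mulS (f - g) h = mulS f h - mulS g h := by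
  ext x; simp [sub_mul]

lemma conjS_sub (f g : 𝓢(Space d, ℂ)) : conjS (f - g) = conjS f - conjS g := by
  ext x; simp

lemma sob_compMul_sub_le {k : ℕ} (hk : (d : ℝ) / 2 < k) (m : ℕ) (hm : m ≤ k) {G : ℝ → ℂ → ℂ}
    (hG : Tame (m + 1) G) (M : ℝ) :
    ∃ C, 0 ≤ C ∧ ∀ ε ∈ Set.Ioc (0 : ℝ) 1, ∀ u₁ u₂ v : 𝓢(Space d, ℂ), sob k u₁ ≤ M → sob k u₂ ≤ M →
      sob m (compMul (G ε) u₁ v - compMul (G ε) u₂ v) ≤ C * sob k (u₁ - u₂) * sob m v := by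
  induction m generalizing G with
  | zero =>
    obtain ⟨B, hB, hB2⟩ := norm_apply_le_sob hk
    obtain ⟨C, hC, hC2⟩ := hG.lipschitz (B * M)
    refine ⟨C * B, by positivity, fun ε hε u₁ u₂ v hu₁ hu₂ ↦ ?_⟩
    simp only [Nat.cast_zero]
    apply sob_le_sob_of_norm_le
    intro x
    rw [_root_.sub_apply, compMul_apply (hG.base.1 ε hε.1), compMul_apply (hG.base.1 ε hε.1),
      ← sub_mul, norm_mul]
    gcongr
    refine (hC2 ε hε _ _ ((hB2 u₁ x).trans (by gcongr)) ((hB2 u₂ x).trans (by gcongr))).trans ?_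
    rw [mul_assoc]
    gcongr
    exact hB2 (u₁ - u₂) x
  | succ m ih =>
    obtain ⟨C₀, hC₀, H₀⟩ := ih (by lia) hG.of_succ
    obtain ⟨hb, G₁, G₂, h1, h2, h3⟩ := hG
    obtain ⟨C₁, hC₁, H₁⟩ := ih (by lia) h1
    obtain ⟨C₂, hC₂, H₂⟩ := ih (by lia) h2
    obtain ⟨B₁, hB₁, K₁⟩ := sob_compMul_le hk m (by lia) h1.of_succ M
    obtain ⟨B₂, hB₂, K₂⟩ := sob_compMul_le hk m (by lia) h2.of_succ M
    have hmk : (m : ℝ) + 1 ≤ k := by exact_mod_cast hm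
    obtain ⟨P, hP, HP⟩ := sob_mulS_le (d := d) (s := m) (p := k - 1) (q := m + 1) hk (by positivity)
      (by linarith) (by linarith) (by linarith)
    refine ⟨C₀ + d * (C₁ * (P * |M|) + C₂ * (P * |M|) + B₁ * P + B₂ * P + C₀), by positivity,
      fun ε hε u₁ u₂ v hu₁ hu₂ ↦ ?_⟩
    set D := sob k (u₁ - u₂) with hD
    have hD0 : 0 ≤ D := sob_nonneg _ _
    have hM : sob k u₁ ≤ |M| := hu₁.trans (le_abs_self M)
    have hv0 := sob_nonneg (m + 1 : ℝ) v
    have hpd' : ∀ (w : 𝓢(Space d, ℂ)) j, sob (k - 1) (pd j w) ≤ sob k w := fun w j ↦ by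
      have := sob_pd_le (k - 1 : ℝ) j w
      rwa [sub_add_cancel] at this
    have hpd : ∀ j, sob (k - 1) (pd j u₁) ≤ |M| := fun j ↦ (hpd' _ j).trans hM
    have hvm : sob m v ≤ sob (m + 1) v := sob_mono (by linarith) v
    have e1 : sob m (compMul (G ε) u₁ v - compMul (G ε) u₂ v) ≤ C₀ * D * sob (m + 1) v :=
      (H₀ ε hε u₁ u₂ v hu₁ hu₂).trans (by gcongr)
    have e2 : ∀ j, sob m (pd j (compMul (G ε) u₁ v - compMul (G ε) u₂ v)) ≤
        (C₁ * (P * |M|) + C₂ * (P * |M|) + B₁ * P + B₂ * P + C₀) * (D * sob (m + 1) v) := by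
      intro j
      rw [pd_sub, pd_compMul (hb.1 ε hε.1) (h1.base.1 ε hε.1) (h2.base.1 ε hε.1) (h3 ε hε.1),
        pd_compMul (hb.1 ε hε.1) (h1.base.1 ε hε.1) (h2.base.1 ε hε.1) (h3 ε hε.1)]
      have split : compMul (G₁ ε) u₁ (mulS (pd j u₁) v) + compMul (G₂ ε) u₁ (mulS (conjS (pd j u₁)) v)
          + compMul (G ε) u₁ (pd j v) - (compMul (G₁ ε) u₂ (mulS (pd j u₂) v) +
          compMul (G₂ ε) u₂ (mulS (conjS (pd j u₂)) v) + compMul (G ε) u₂ (pd j v)) =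
          (compMul (G₁ ε) u₁ (mulS (pd j u₁) v) - compMul (G₁ ε) u₂ (mulS (pd j u₁) v)) +
          (compMul (G₂ ε) u₁ (mulS (conjS (pd j u₁)) v) -
            compMul (G₂ ε) u₂ (mulS (conjS (pd j u₁)) v)) +
          compMul (G₁ ε) u₂ (mulS (pd j (u₁ - u₂)) v) +
          compMul (G₂ ε) u₂ (mulS (conjS (pd j (u₁ - u₂))) v) +
          (compMul (G ε) u₁ (pd j v) - compMul (G ε) u₂ (pd j v)) := by
        rw [pd_sub, conjS_sub, mulS_sub_left, mulS_sub_left, compMul_sub, compMul_sub]; abel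
      rw [split]
      have t1 : sob m (compMul (G₁ ε) u₁ (mulS (pd j u₁) v) - compMul (G₁ ε) u₂ (mulS (pd j u₁) v))
          ≤ C₁ * (P * |M|) * (D * sob (m + 1) v) := by
        calc _ ≤ C₁ * D * sob m (mulS (pd j u₁) v) := H₁ ε hε u₁ u₂ _ hu₁ hu₂
          _ ≤ C₁ * D * (P * |M| * sob (m + 1) v) := by
            gcongr
            refine (HP _ _).trans ?_
            gcongr
            exact hpd j
          _ = _ := by ring
      have t2 : sob m (compMul (G₂ ε) u₁ (mulS (conjS (pd j u₁)) v) -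
          compMul (G₂ ε) u₂ (mulS (conjS (pd j u₁)) v))
          ≤ C₂ * (P * |M|) * (D * sob (m + 1) v) := by
        calc _ ≤ C₂ * D * sob m (mulS (conjS (pd j u₁)) v) := H₂ ε hε u₁ u₂ _ hu₁ hu₂
          _ ≤ C₂ * D * (P * |M| * sob (m + 1) v) := by
            gcongr
            refine (HP _ _).trans ?_
            rw [sob_conjS]
            gcongr
            exact hpd j
          _ = _ := by ring
      have t3 : sob m (compMul (G₁ ε) u₂ (mulS (pd j (u₁ - u₂)) v)) ≤
          B₁ * P * (D * sob (m + 1) v) := by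
        calc _ ≤ B₁ * sob m (mulS (pd j (u₁ - u₂)) v) := K₁ ε hε u₂ _ hu₂
          _ ≤ B₁ * (P * D * sob (m + 1) v) := by
            gcongr
            refine (HP _ _).trans ?_
            gcongr
            exact hpd' _ j
          _ = _ := by ring
      have t4 : sob m (compMul (G₂ ε) u₂ (mulS (conjS (pd j (u₁ - u₂))) v)) ≤
          B₂ * P * (D * sob (m + 1) v) := by
        calc _ ≤ B₂ * sob m (mulS (conjS (pd j (u₁ - u₂))) v) := K₂ ε hε u₂ _ hu₂
          _ ≤ B₂ * (P * D * sob (m + 1) v) := by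
            gcongr
            refine (HP _ _).trans ?_
            rw [sob_conjS]
            gcongr
            exact hpd' _ j
          _ = _ := by ring
      have t5 : sob m (compMul (G ε) u₁ (pd j v) - compMul (G ε) u₂ (pd j v)) ≤
          C₀ * (D * sob (m + 1) v) := by
        refine (H₀ ε hε u₁ u₂ _ hu₁ hu₂).trans ?_
        rw [mul_assoc]
        gcongr
        exact sob_pd_le _ _ _
      refine (sob_add_le _ _ _).trans ?_
      refine (add_le_add_left ((sob_add_le _ _ _).trans (add_le_add_left ((sob_add_le _ _ _).trans
        (add_le_add_left (sob_add_le _ _ _) _)) _)) _).trans ?_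
      linarith
    push_cast
    calc sob (m + 1) (compMul (G ε) u₁ v - compMul (G ε) u₂ v)
        ≤ sob m (compMul (G ε) u₁ v - compMul (G ε) u₂ v) +
          ∑ j, sob m (pd j (compMul (G ε) u₁ v - compMul (G ε) u₂ v)) := sob_add_one_le _ _
      _ ≤ C₀ * D * sob (m + 1) v + ∑ j : Fin d,
          (C₁ * (P * |M|) + C₂ * (P * |M|) + B₁ * P + B₂ * P + C₀) * (D * sob (m + 1) v) := by
          gcongr with j; exact e2 j
      _ = _ := by
          rw [Finset.sum_const, Finset.card_univ, Fintype.card_fin, nsmul_eq_mul]; ring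

/-- Composition with a tame family is locally Lipschitz in `H^k`, uniformly in the parameter. -/
lemma sob_comp_sub_le {k : ℕ} (hk : (d : ℝ) / 2 < k) (m : ℕ) (hm : m ≤ k) {G : ℝ → ℂ → ℂ}
    (hG : Tame (m + 1) G) (M : ℝ) :
    ∃ C, 0 ≤ C ∧ ∀ ε ∈ Set.Ioc (0 : ℝ) 1, ∀ u₁ u₂ w₁ w₂ : 𝓢(Space d, ℂ),
      sob k u₁ ≤ M → sob k u₂ ≤ M → (∀ x, w₁ x = G ε (u₁ x)) → (∀ x, w₂ x = G ε (u₂ x)) →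
      sob m (w₁ - w₂) ≤ C * sob k (u₁ - u₂) := by
  induction m generalizing G with
  | zero =>
    obtain ⟨B, hB, hB2⟩ := norm_apply_le_sob hk
    obtain ⟨C, hC, hC2⟩ := hG.lipschitz (B * M)
    refine ⟨C, hC, fun ε hε u₁ u₂ w₁ w₂ hu₁ hu₂ hw₁ hw₂ ↦ ?_⟩
    simp only [Nat.cast_zero]
    refine le_trans (sob_le_sob_of_norm_le (g := u₁ - u₂) (C := C) ?_) ?_
    · intro x
      rw [_root_.sub_apply, _root_.sub_apply, hw₁, hw₂]
      exact hC2 ε hε _ _ ((hB2 u₁ x).trans (by gcongr)) ((hB2 u₂ x).trans (by gcongr))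
    · gcongr
      exact sob_mono (by positivity) _
  | succ m ih =>
    obtain ⟨C₀, hC₀, H₀⟩ := ih (by lia) hG.of_succ
    obtain ⟨hb, G₁, G₂, h1, h2, h3⟩ := hG
    obtain ⟨C₁, hC₁, H₁⟩ := sob_compMul_sub_le hk m (by lia) h1 M
    obtain ⟨C₂, hC₂, H₂⟩ := sob_compMul_sub_le hk m (by lia) h2 M
    obtain ⟨B₁, hB₁, K₁⟩ := sob_compMul_le hk m (by lia) h1.of_succ M
    obtain ⟨B₂, hB₂, K₂⟩ := sob_compMul_le hk m (by lia) h2.of_succ M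
    have hmk : (m : ℝ) + 1 ≤ k := by exact_mod_cast hm
    refine ⟨C₀ + d * (C₁ * |M| + C₂ * |M| + B₁ + B₂), by positivity,
      fun ε hε u₁ u₂ w₁ w₂ hu₁ hu₂ hw₁ hw₂ ↦ ?_⟩
    set D := sob k (u₁ - u₂) with hD
    have hD0 : 0 ≤ D := sob_nonneg _ _
    have hM : sob k u₁ ≤ |M| := hu₁.trans (le_abs_self M)
    have hpd' : ∀ (w : 𝓢(Space d, ℂ)) j, sob m (pd j w) ≤ sob k w := fun w j ↦
      (sob_pd_le _ j w).trans (sob_mono hmk w)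
    have e1 : sob m (w₁ - w₂) ≤ C₀ * D := H₀ ε hε u₁ u₂ w₁ w₂ hu₁ hu₂ hw₁ hw₂
    have pdw : ∀ (u w : 𝓢(Space d, ℂ)) (_ : ∀ x, w x = G ε (u x)) (j : Fin d),
        pd j w = compMul (G₁ ε) u (pd j u) + compMul (G₂ ε) u (conjS (pd j u)) := by
      intro u w hw j
      ext x
      have e : (⇑w : Space d → ℂ) = fun y ↦ G ε (u y) := funext hw
      rw [pd_apply, e, (fderiv_comp_apply u x j (h3 ε hε.1 (u x))).2, _root_.add_apply,
        compMul_apply (h1.base.1 ε hε.1), compMul_apply (h2.base.1 ε hε.1), conjS_apply]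
    have e2 : ∀ j, sob m (pd j (w₁ - w₂)) ≤ (C₁ * |M| + C₂ * |M| + B₁ + B₂) * D := by
      intro j
      have split : pd j (w₁ - w₂) =
          (compMul (G₁ ε) u₁ (pd j u₁) - compMul (G₁ ε) u₂ (pd j u₁)) +
          (compMul (G₂ ε) u₁ (conjS (pd j u₁)) - compMul (G₂ ε) u₂ (conjS (pd j u₁))) +
          compMul (G₁ ε) u₂ (pd j (u₁ - u₂)) + compMul (G₂ ε) u₂ (conjS (pd j (u₁ - u₂))) := by
        rw [pd_sub, pd_sub, pdw u₁ w₁ hw₁, pdw u₂ w₂ hw₂, conjS_sub, compMul_sub, compMul_sub]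
        abel
      rw [split]
      have t1 : sob m (compMul (G₁ ε) u₁ (pd j u₁) - compMul (G₁ ε) u₂ (pd j u₁)) ≤
          C₁ * |M| * D := by
        calc _ ≤ C₁ * D * sob m (pd j u₁) := H₁ ε hε u₁ u₂ _ hu₁ hu₂
          _ ≤ C₁ * D * |M| := by gcongr; exact (hpd' _ j).trans hM
          _ = _ := by ring
      have t2 : sob m (compMul (G₂ ε) u₁ (conjS (pd j u₁)) - compMul (G₂ ε) u₂ (conjS (pd j u₁))) ≤
          C₂ * |M| * D := by
        calc _ ≤ C₂ * D * sob m (conjS (pd j u₁)) := H₂ ε hε u₁ u₂ _ hu₁ hu₂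
          _ ≤ C₂ * D * |M| := by rw [sob_conjS]; gcongr; exact (hpd' _ j).trans hM
          _ = _ := by ring
      have t3 : sob m (compMul (G₁ ε) u₂ (pd j (u₁ - u₂))) ≤ B₁ * D :=
        (K₁ ε hε u₂ _ hu₂).trans (by gcongr; exact hpd' _ j)
      have t4 : sob m (compMul (G₂ ε) u₂ (conjS (pd j (u₁ - u₂)))) ≤ B₂ * D :=
        (K₂ ε hε u₂ _ hu₂).trans (by rw [sob_conjS]; gcongr; exact hpd' _ j)
      refine (sob_add_le _ _ _).trans ?_
      refine (add_le_add_left ((sob_add_le _ _ _).trans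
        (add_le_add_left (sob_add_le _ _ _) _)) _).trans ?_
      linarith
    push_cast
    calc sob (m + 1) (w₁ - w₂) ≤ sob m (w₁ - w₂) + ∑ j, sob m (pd j (w₁ - w₂)) :=
          sob_add_one_le _ _
      _ ≤ C₀ * D + ∑ j : Fin d, (C₁ * |M| + C₂ * |M| + B₁ + B₂) * D := by
          gcongr with j; exact e2 j
      _ = _ := by
          rw [Finset.sum_const, Finset.card_univ, Fintype.card_fin, nsmul_eq_mul]; ring

/-! ### The power nonlinearity on `H^k` -/

/-- The power nonlinearity `|z|^{ν-1} z`. -/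
def nl (ν : ℝ) (z : ℂ) : ℂ := ((‖z‖ ^ (ν - 1) : ℝ) : ℂ) * z

@[simp] lemma nl_zero (ν : ℝ) : nl ν 0 = 0 := by simp [nl]

lemma norm_nl {ν : ℝ} (hν : 1 < ν) (z : ℂ) : ‖nl ν z‖ = ‖z‖ ^ ν := by
  rw [nl, norm_mul, Complex.norm_real, Real.norm_of_nonneg (by positivity)]
  rcases eq_or_ne z 0 with rfl | hz
  · simp [Real.zero_rpow (by linarith : ν ≠ 0)]
  · have : 0 < ‖z‖ := norm_pos_iff.2 hz
    rw [Real.rpow_sub_one this.ne']; field_simp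

lemma continuous_nl {ν : ℝ} (hν : 1 < ν) : Continuous (nl ν) := by
  unfold nl
  have : Continuous fun z : ℂ ↦ ‖z‖ ^ (ν - 1) :=
    continuous_norm.rpow_const (fun z ↦ Or.inr (by linarith))
  fun_prop

lemma regPow_sub_nl {ν : ℝ} (R η : ℝ) (hη : 0 < η) (hν : 1 < ν) :
    ∃ ε₀ > 0, ∀ ε, 0 < ε → ε < ε₀ → ∀ z : ℂ, ‖z‖ ≤ R →
      ‖regPow 1 0 ((ν - 1) / 2) ε z - nl ν z‖ ≤ η * ‖z‖ := by
  set f : ℝ × ℝ → ℝ := fun q ↦ (q.1 ^ 2 + q.2 ^ 2) ^ ((ν - 1) / 2) with hf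
  have hfc : Continuous f := by
    apply Continuous.rpow_const (by fun_prop)
    intro q; right; linarith
  have hu := (isCompact_Icc.prod isCompact_Icc :
    IsCompact (Set.Icc (0 : ℝ) 1 ×ˢ Set.Icc (0 : ℝ) (max R 0))).uniformContinuousOn_of_continuous
      hfc.continuousOn
  rw [Metric.uniformContinuousOn_iff] at hu
  obtain ⟨δ, hδ, h⟩ := hu η hη
  refine ⟨min δ 1, by positivity, fun ε hε hε' z hz ↦ ?_⟩
  have h1 := h (ε, ‖z‖) ⟨⟨hε.le, hε'.le.trans (min_le_right _ _)⟩, norm_nonneg _,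
    hz.trans (le_max_left _ _)⟩ (0, ‖z‖) ⟨⟨le_rfl, by simp⟩, norm_nonneg _,
    hz.trans (le_max_left _ _)⟩ (by
      simp [Prod.dist_eq, hε.le, abs_of_pos hε]
      exact hε'.trans_le (min_le_left _ _))
  have e : ‖z‖ ^ (ν - 1) = f (0, ‖z‖) := by
    simp only [hf]
    rw [zero_pow (by norm_num), zero_add, ← Real.rpow_natCast, ← Real.rpow_mul (norm_nonneg _)]
    congr 1; push_cast; ring
  have e2 : regPow 1 0 ((ν - 1) / 2) ε z - nl ν z =
      ((f (ε, ‖z‖) - f (0, ‖z‖) : ℝ) : ℂ) * z := by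
    rw [nl, e, regPow]; simp only [hf]; push_cast; ring
  rw [e2, norm_mul, Complex.norm_real]
  gcongr
  rw [Real.dist_eq] at h1
  exact h1.le

lemma nl_smul {ν : ℝ} (hν : 1 < ν) {r : ℝ} (hr : 0 ≤ r) (z : ℂ) :
    nl ν (r * z) = ((r ^ ν : ℝ) : ℂ) * nl ν z := by
  rw [nl, nl, norm_mul, Complex.norm_real, Real.norm_of_nonneg hr,
    Real.mul_rpow hr (norm_nonneg _)]
  rcases hr.eq_or_lt with rfl | hr
  · simp [Real.zero_rpow (by linarith : ν ≠ 0)]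
  · rw [Real.rpow_sub_one hr.ne']
    push_cast
    have : (r : ℂ) ≠ 0 := by exact_mod_cast hr.ne'
    field_simp

lemma tame_regPow_of_odd_or_le {ν : ℝ} (m : ℕ)
    (h : (∃ n : ℕ, ν = 2 * (n : ℝ) + 1) ∨ (m : ℝ) ≤ ν) :
    Tame m (regPow 1 0 ((ν - 1) / 2)) := by
  apply tame_regPow
  rcases h with ⟨n, rfl⟩ | h
  · left; exact ⟨n, by ring⟩
  · right; push_cast; linarith

/-- The nonlinearity is locally Lipschitz, with a homogeneous bound. -/
lemma norm_nl_sub_le {ν : ℝ} (hν : 1 < ν) :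
    ∃ C, 0 ≤ C ∧ ∀ z w : ℂ, ‖nl ν z - nl ν w‖ ≤ C * max ‖z‖ ‖w‖ ^ (ν - 1) * ‖z - w‖ := by
  obtain ⟨C, hC, h⟩ := (tame_regPow_of_odd_or_le (ν := ν) 1 (Or.inr (by simpa using hν.le))).lipschitz 1
  have key : ∀ z w : ℂ, ‖z‖ ≤ 1 → ‖w‖ ≤ 1 → ‖nl ν z - nl ν w‖ ≤ C * ‖z - w‖ := by
    intro z w hz hw
    apply le_of_forall_pos_le_add
    intro η hη
    obtain ⟨ε₀, hε₀, h0⟩ := regPow_sub_nl (ν := ν) 1 (η / 2) (by positivity) hν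
    set ε := min (ε₀ / 2) 1
    have hε : 0 < ε := by positivity
    have hε' : ε < ε₀ := (min_le_left _ _).trans_lt (by linarith)
    have h1 := h0 ε hε hε' z hz
    have h2 := h0 ε hε hε' w hw
    have h3 := h ε ⟨hε, min_le_right _ _⟩ z w hz hw
    calc ‖nl ν z - nl ν w‖ = ‖(regPow 1 0 ((ν - 1) / 2) ε z - regPow 1 0 ((ν - 1) / 2) ε w) -
          (regPow 1 0 ((ν - 1) / 2) ε z - nl ν z) + (regPow 1 0 ((ν - 1) / 2) ε w - nl ν w)‖ := by
          congr 1; ring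
      _ ≤ C * ‖z - w‖ + η / 2 * ‖z‖ + η / 2 * ‖w‖ := by
          refine (norm_add_le _ _).trans (add_le_add ((norm_sub_le _ _).trans
            (add_le_add h3 h1)) h2)
      _ ≤ _ := by nlinarith
  refine ⟨C, hC, fun z w ↦ ?_⟩
  set ρ := max ‖z‖ ‖w‖
  have hρ0 : 0 ≤ ρ := le_max_of_le_left (norm_nonneg _)
  rcases hρ0.eq_or_lt with h0 | hρ
  · have hz : z = 0 := norm_le_zero_iff.1 (h0 ▸ le_max_left _ _)
    have hw : w = 0 := norm_le_zero_iff.1 (h0 ▸ le_max_right _ _)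
    simp [hz, hw]
  · have hb : ∀ x : ℂ, ‖x‖ ≤ ρ → ‖((ρ⁻¹ : ℝ) : ℂ) * x‖ ≤ 1 := by
      intro x hx
      rw [norm_mul, Complex.norm_real, Real.norm_of_nonneg (by positivity)]
      rw [inv_mul_le_one₀ hρ]; exact hx
    have hs : ∀ x : ℂ, x = ρ * (((ρ⁻¹ : ℝ) : ℂ) * x) := by
      intro x
      have : (ρ : ℂ) ≠ 0 := by exact_mod_cast hρ.ne'
      push_cast; field_simp
    have h1 := key _ _ (hb z (le_max_left _ _)) (hb w (le_max_right _ _))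
    calc ‖nl ν z - nl ν w‖ = ρ ^ ν * ‖nl ν (((ρ⁻¹ : ℝ) : ℂ) * z) - nl ν (((ρ⁻¹ : ℝ) : ℂ) * w)‖ := by
          conv_lhs => rw [hs z, hs w, nl_smul hν hρ.le, nl_smul hν hρ.le]
          rw [← mul_sub, norm_mul, Complex.norm_real, Real.norm_of_nonneg (by positivity)]
      _ ≤ ρ ^ ν * (C * ‖((ρ⁻¹ : ℝ) : ℂ) * z - ((ρ⁻¹ : ℝ) : ℂ) * w‖) := by gcongr
      _ = _ := by
          rw [← mul_sub, norm_mul, Complex.norm_real, Real.norm_of_nonneg (by positivity),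
            Real.rpow_sub_one hρ.ne']
          field_simp

lemma exists_subseq_ae {f : ℕ → L2 d} {g : L2 d} (h : Tendsto f atTop (𝓝 g)) :
    ∃ φ : ℕ → ℕ, StrictMono φ ∧ ∀ᵐ x, Tendsto (fun n ↦ f (φ n) x) atTop (𝓝 (g x)) :=
  (tendstoInMeasure_of_tendsto_Lp h).exists_seq_tendsto_ae

/-- Sobolev norms are lower semicontinuous in `L²`. -/
lemma sobolevNorm_le_of_tendsto (s : ℝ) {f : ℕ → L2 d} {g : L2 d} (h : Tendsto f atTop (𝓝 g))
    {C : ℕ → ℝ≥0∞} {C' : ℝ≥0∞} (hC : ∀ n, sobolevNorm s (f n) ≤ C n)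
    (hC' : Tendsto C atTop (𝓝 C')) : sobolevNorm s g ≤ C' := by
  have h1 : Tendsto (fun n ↦ (𝓕 (f n) : L2 d)) atTop (𝓝 (𝓕 g)) :=
    ((Lp.fourierTransformₗᵢ (Space d) ℂ).continuous.tendsto g).comp h
  obtain ⟨φ, hφ, hae⟩ := exists_subseq_ae h1
  have h2 := Lp.eLpNorm_lim_le_liminf_eLpNorm (p := 2) (μ := (volume : Measure (Space d)))
    (f := fun n ξ ↦ ((wt s ξ : ℝ) : ℂ) * (𝓕 (f (φ n)) : L2 d) ξ)
    (fun n ↦ (Complex.continuous_ofReal.comp (continuous_wt s)).aestronglyMeasurable.mul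
      (Lp.aestronglyMeasurable _))
    (fun ξ ↦ ((wt s ξ : ℝ) : ℂ) * (𝓕 g : L2 d) ξ) (by
      filter_upwards [hae] with ξ hξ
      exact hξ.const_mul _)
  refine h2.trans ?_
  rw [← (hC'.comp hφ.tendsto_atTop).liminf_eq]
  exact liminf_le_liminf (Eventually.of_forall fun n ↦ hC (φ n))

/-- The embedding `H^k ⊂ L^∞` for `k > d/2`. -/
lemma ae_norm_ofProfile_le {k : ℕ} (hk : (d : ℝ) / 2 < k) :
    ∃ B, 0 ≤ B ∧ ∀ h : L2 d, ∀ᵐ x, ‖ofProfile k h x‖ ≤ B * ‖h‖ := by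
  obtain ⟨B, hB, h1⟩ := norm_apply_le_sob hk
  refine ⟨B, hB, fun h ↦ ?_⟩
  obtain ⟨u, hu⟩ := exists_seq_profile k h
  have h2 := ((ofProfile k).continuous.tendsto h).comp hu
  obtain ⟨φ, hφ, hae⟩ := exists_subseq_ae h2
  have h3 : ∀ᵐ x, ∀ n, ofProfile k ((profile k (u (φ n))).toLp 2 volume) x = u (φ n) x := by
    rw [ae_all_iff]
    intro n
    rw [ofProfile_profile]
    exact (u (φ n)).coeFn_toLp 2 volume
  filter_upwards [hae, h3] with x hx hx3
  refine le_of_tendsto_of_tendsto hx.norm (((hu.comp hφ.tendsto_atTop).norm).const_mul B)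
    (Eventually.of_forall fun n ↦ ?_)
  simp only [Function.comp_apply]
  rw [hx3]
  exact h1 _ _

lemma memLp_nl {ν : ℝ} (hν : 1 < ν) {f : L2 d} {R : ℝ} (hf : ∀ᵐ x, ‖f x‖ ≤ R) :
    MemLp (fun x ↦ nl ν (f x)) 2 volume := by
  refine MemLp.of_le_mul (c := R ^ (ν - 1)) (Lp.memLp f)
    ((continuous_nl hν).comp_aestronglyMeasurable (Lp.aestronglyMeasurable f)) ?_
  filter_upwards [hf] with x hx
  rw [nl, norm_mul, Complex.norm_real, Real.norm_of_nonneg (by positivity)]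
  gcongr

/-- The nonlinearity in terms of `H^k` profiles. -/
def nlProfile (ν : ℝ) (k : ℕ) (h : L2 d) : L2 d :=
  open Classical in
  if hg : ∃ g : L2 d, ofProfile k g =ᵐ[volume] fun x ↦ nl ν (ofProfile k h x) then hg.choose else 0

lemma tendsto_regPow_comp {ν : ℝ} {k : ℕ} (hk : (d : ℝ) / 2 < k) (hν : 1 < ν)
    {u : ℕ → 𝓢(Space d, ℂ)} {h : L2 d}
    (hu : Tendsto (fun n ↦ (profile k (u n)).toLp 2 volume) atTop (𝓝 h))
    {w : ℕ → 𝓢(Space d, ℂ)} {ε : ℕ → ℝ} (hε : ∀ n, ε n ∈ Set.Ioc (0 : ℝ) 1)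
    (hε0 : Tendsto ε atTop (𝓝 0))
    (hw : ∀ n x, w n x = regPow 1 0 ((ν - 1) / 2) (ε n) (u n x))
    {F : L2 d} (hF : F =ᵐ[volume] fun x ↦ nl ν (ofProfile k h x)) :
    Tendsto (fun n ↦ (w n).toLp 2 volume) atTop (𝓝 F) := by
  obtain ⟨B, hB, hB2⟩ := ae_norm_ofProfile_le (d := d) hk
  obtain ⟨B', hB', hB2'⟩ := norm_apply_le_sob (d := d) hk
  obtain ⟨M, hM⟩ : ∃ M, ∀ n, sob k (u n) ≤ M := by
    obtain ⟨M, hM⟩ := hu.norm.bddAbove_range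
    exact ⟨M, fun n ↦ hM ⟨n, rfl⟩⟩
  set R := max (B * ‖h‖) (B' * M)
  obtain ⟨C, hC, hLip⟩ := (tame_regPow_of_odd_or_le (ν := ν) 1
    (Or.inr (by simpa using hν.le))).lipschitz R
  have hu' : Tendsto (fun n ↦ (u n).toLp 2 volume) atTop (𝓝 (ofProfile k h)) := by
    have := ((ofProfile k).continuous.tendsto h).comp hu
    refine this.congr fun n ↦ ?_
    simp [ofProfile_profile]
  rw [tendsto_iff_norm_sub_tendsto_zero] at hu' ⊢
  rw [Metric.tendsto_atTop]
  intro η hη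
  set η' := η / (2 * (‖ofProfile k h‖ + 1))
  obtain ⟨ε₀, hε₀, h0⟩ := regPow_sub_nl (ν := ν) R η' (by positivity) hν
  have e1 : ∀ᶠ n in atTop, ε n < ε₀ := hε0.eventually_lt_const hε₀
  have e2 : ∀ᶠ n in atTop, ‖(u n).toLp 2 volume - ofProfile k h‖ < η / (2 * (C + 1)) :=
    hu'.eventually_lt_const (by positivity)
  obtain ⟨n₀, hn₀⟩ := eventually_atTop.1 (e1.and e2)
  refine ⟨n₀, fun n hn ↦ ?_⟩
  obtain ⟨hn1, hn2⟩ := hn₀ n hn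
  have hpt : ∀ᵐ x, ‖((w n).toLp 2 volume - F : L2 d) x‖ ≤
      C * ‖((u n).toLp 2 volume - ofProfile k h : L2 d) x‖ + η' * ‖ofProfile k h x‖ := by
    filter_upwards [Lp.coeFn_sub ((w n).toLp 2 volume) F,
      Lp.coeFn_sub ((u n).toLp 2 volume) (ofProfile k h), (w n).coeFn_toLp 2 volume,
      (u n).coeFn_toLp 2 volume, hF, hB2 h] with x h1 h2 h3 h4 h5 h6
    rw [h1, h2, Pi.sub_apply, Pi.sub_apply, h3, h4, h5, hw]
    have a1 := hLip (ε n) (hε n) (u n x) (ofProfile k h x)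
      (((hB2' _ x).trans (by gcongr; exact hM n)).trans (le_max_right _ _))
      (h6.trans (le_max_left _ _))
    have a2 := h0 (ε n) (hε n).1 hn1 (ofProfile k h x) (h6.trans (le_max_left _ _))
    calc _ = ‖(regPow 1 0 ((ν - 1) / 2) (ε n) (u n x) -
            regPow 1 0 ((ν - 1) / 2) (ε n) (ofProfile k h x)) +
            (regPow 1 0 ((ν - 1) / 2) (ε n) (ofProfile k h x) - nl ν (ofProfile k h x))‖ := by
          congr 1; ring
      _ ≤ _ := (norm_add_le _ _).trans (add_le_add a1 a2)
  have hle : ‖(w n).toLp 2 volume - F‖ ≤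
      C * ‖(u n).toLp 2 volume - ofProfile k h‖ + η' * ‖ofProfile k h‖ := by
    have m1 : MemLp (fun x ↦ C * ‖((u n).toLp 2 volume - ofProfile k h : L2 d) x‖) 2 volume :=
      (Lp.memLp _).norm.const_mul C
    have m2 : MemLp (fun x ↦ η' * ‖ofProfile k h x‖) 2 volume := (Lp.memLp _).norm.const_mul η'
    have g1 : ‖(w n).toLp 2 volume - F‖ ≤ ‖m1.toLp _ + m2.toLp _‖ := by
      apply Lp.norm_le_norm_of_ae_le
      filter_upwards [hpt, Lp.coeFn_add (m1.toLp _) (m2.toLp _), m1.coeFn_toLp, m2.coeFn_toLp]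
        with x hx1 hx2 hx3 hx4
      rw [hx2, Pi.add_apply, hx3, hx4]
      exact hx1.trans (le_abs_self _)
    refine g1.trans ((norm_add_le _ _).trans (add_le_add ?_ ?_))
    · apply Lp.norm_le_mul_norm_of_ae_le_mul
      filter_upwards [m1.coeFn_toLp] with x hx
      rw [hx, norm_mul, norm_norm, Real.norm_of_nonneg hC]
    · apply Lp.norm_le_mul_norm_of_ae_le_mul
      filter_upwards [m2.coeFn_toLp] with x hx
      rw [hx, norm_mul, norm_norm, Real.norm_of_nonneg (by positivity)]
  rw [dist_zero_right, norm_norm]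
  calc _ ≤ C * ‖(u n).toLp 2 volume - ofProfile k h‖ + η' * ‖ofProfile k h‖ := hle
    _ < η / 2 + η / 2 := by
      apply add_lt_add_of_le_of_lt
      · calc C * ‖(u n).toLp 2 volume - ofProfile k h‖ ≤ (C + 1) * (η / (2 * (C + 1))) := by
              gcongr; linarith
          _ = η / 2 := by field_simp
      · calc η' * ‖ofProfile k h‖ < η' * (‖ofProfile k h‖ + 1) := by
              gcongr; linarith
          _ = η / 2 := by simp only [η']; field_simp
    _ = η := by ring

/-- The standing assumptions on the exponents: `H^k` is an algebra, and the nonlinearity is smooth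
enough to act on it. -/
structure Exponents (d : ℕ) (ν : ℝ) (k : ℕ) : Prop where
  one_lt : 1 < ν
  half_lt : (d : ℝ) / 2 < k
  odd_or_le : (∃ m : ℕ, ν = 2 * (m : ℝ) + 1) ∨ (k : ℝ) + 1 ≤ ν

lemma sobolevNorm_nl_sub_le {ν : ℝ} {k : ℕ} (E : Exponents d ν k) (M : ℝ) :
    ∃ C, 0 ≤ C ∧ ∀ (h₁ h₂ F₁ F₂ : L2 d), ‖h₁‖ ≤ M → ‖h₂‖ ≤ M →
      (F₁ =ᵐ[volume] fun x ↦ nl ν (ofProfile k h₁ x)) →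
      (F₂ =ᵐ[volume] fun x ↦ nl ν (ofProfile k h₂ x)) →
      sobolevNorm (k : ℝ) (F₁ - F₂) ≤ ENNReal.ofReal (C * ‖h₁ - h₂‖) := by
  obtain ⟨C, hC, H⟩ := sob_comp_sub_le E.half_lt k le_rfl
    (tame_regPow_of_odd_or_le (ν := ν) (k + 1) (by
      push_cast; exact E.odd_or_le)) (M + 1)
  refine ⟨C, hC, fun h₁ h₂ F₁ F₂ hM₁ hM₂ hF₁ hF₂ ↦ ?_⟩
  have shift : ∀ h : L2 d, ‖h‖ ≤ M → ∃ u : ℕ → 𝓢(Space d, ℂ),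
      Tendsto (fun n ↦ (profile k (u n)).toLp 2 volume) atTop (𝓝 h) ∧ ∀ n, sob k (u n) ≤ M + 1 := by
    intro h hh
    obtain ⟨u, hu⟩ := exists_seq_profile k h
    have : ∀ᶠ n in atTop, ‖(profile k (u n)).toLp 2 volume‖ < M + 1 :=
      hu.norm.eventually_lt_const (by linarith)
    obtain ⟨n₀, hn₀⟩ := eventually_atTop.1 this
    exact ⟨fun n ↦ u (n + n₀), (tendsto_add_atTop_iff_nat n₀).2 hu,
      fun n ↦ (hn₀ (n + n₀) (by lia)).le⟩
  obtain ⟨u₁, hu₁, b₁⟩ := shift h₁ hM₁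
  obtain ⟨u₂, hu₂, b₂⟩ := shift h₂ hM₂
  set ε : ℕ → ℝ := fun n ↦ 1 / ((n : ℝ) + 1)
  have hε : ∀ n, ε n ∈ Set.Ioc (0 : ℝ) 1 := fun n ↦
    ⟨by positivity, by simp only [ε]; rw [div_le_one (by positivity)]; linarith [n.cast_nonneg (α := ℝ)]⟩
  have hε0 : Tendsto ε atTop (𝓝 0) := tendsto_one_div_add_atTop_nhds_zero_nat
  have hreg : ∀ (n : ℕ) (u : 𝓢(Space d, ℂ)) x, compMul (regPow 0 0 ((ν - 1) / 2) (ε n)) u u x =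
      regPow 1 0 ((ν - 1) / 2) (ε n) (u x) := by
    intro n u x
    rw [compMul_apply (hasTemperateGrowth_regPow _ _ _ (hε n).1), regPow, regPow]
    ring
  have t₁ := tendsto_regPow_comp E.half_lt E.one_lt hu₁
    (w := fun n ↦ compMul (regPow 0 0 ((ν - 1) / 2) (ε n)) (u₁ n) (u₁ n)) hε hε0
    (fun n x ↦ hreg n _ x) hF₁
  have t₂ := tendsto_regPow_comp E.half_lt E.one_lt hu₂
    (w := fun n ↦ compMul (regPow 0 0 ((ν - 1) / 2) (ε n)) (u₂ n) (u₂ n)) hε hε0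
    (fun n x ↦ hreg n _ x) hF₂
  refine sobolevNorm_le_of_tendsto k (t₁.sub t₂)
    (C := fun n ↦ ENNReal.ofReal (C * sob k (u₁ n - u₂ n))) (fun n ↦ ?_) ?_
  · rw [← toLp_sub, sobolevNorm_toLp]
    exact ENNReal.ofReal_le_ofReal (H (ε n) (hε n) _ _ _ _ (b₁ n) (b₂ n)
      (fun x ↦ hreg n _ x) (fun x ↦ hreg n _ x))
  · apply ENNReal.tendsto_ofReal
    apply Tendsto.const_mul
    have := (hu₁.sub hu₂).norm
    refine this.congr fun n ↦ ?_
    rw [← toLp_sub, ← profile_sub]; rfl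

lemma ofProfile_nlProfile {ν : ℝ} {k : ℕ} (E : Exponents d ν k) (h : L2 d) :
    ofProfile k (nlProfile ν k h) =ᵐ[volume] fun x ↦ nl ν (ofProfile k h x) := by
  have hex : ∃ g : L2 d, ofProfile k g =ᵐ[volume] fun x ↦ nl ν (ofProfile k h x) := by
    obtain ⟨B, hB, hB2⟩ := ae_norm_ofProfile_le (d := d) E.half_lt
    have hm := memLp_nl E.one_lt (hB2 h)
    obtain ⟨C, hC, H⟩ := sobolevNorm_nl_sub_le E ‖h‖
    have h0 : (0 : L2 d) =ᵐ[volume] fun x ↦ nl ν (ofProfile k (0 : L2 d) x) := by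
      rw [map_zero]
      filter_upwards [Lp.coeFn_zero ℂ 2 (volume : Measure (Space d))] with x hx
      rw [hx]; simp
    have h1 := H h 0 (hm.toLp _) 0 le_rfl (by simp) hm.coeFn_toLp h0
    rw [sub_zero] at h1
    obtain ⟨g, hg⟩ := exists_ofProfile_eq (h1.trans_lt ENNReal.ofReal_lt_top)
    exact ⟨g, by rw [hg]; exact hm.coeFn_toLp⟩
  rw [nlProfile, dif_pos hex]
  exact hex.choose_spec

/-- The nonlinearity is Lipschitz on bounded sets of `H^k`. -/
lemma lipschitzOnWith_nlProfile {ν : ℝ} {k : ℕ} (E : Exponents d ν k) (M : ℝ) :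
    ∃ K : ℝ≥0, LipschitzOnWith K (nlProfile (d := d) ν k) (Metric.closedBall 0 M) := by
  obtain ⟨C, hC, H⟩ := sobolevNorm_nl_sub_le E M
  refine ⟨⟨C, hC⟩, LipschitzOnWith.of_dist_le_mul fun h₁ hh₁ h₂ hh₂ ↦ ?_⟩
  have h := H h₁ h₂ _ _ (by simpa using hh₁) (by simpa using hh₂) (ofProfile_nlProfile E h₁)
    (ofProfile_nlProfile E h₂)
  rw [← map_sub, sobolevNorm_ofProfile_self, ← ofReal_norm,
    ENNReal.ofReal_le_ofReal_iff (by positivity)] at h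
  rw [dist_eq_norm, dist_eq_norm]
  exact h

/-! ### Semilinear evolution equations with a unitary linear part -/

section Abstract

open Set Metric

variable {X : Type*} [NormedAddCommGroup X] [NormedSpace ℝ X]

/-- A strongly continuous one-parameter group of linear isometries. -/
structure IsometryGroup (U : ℝ → X →L[ℝ] X) : Prop where
  zero : ∀ x, U 0 x = x
  add : ∀ s t x, U (s + t) x = U s (U t x)
  norm : ∀ s x, ‖U s x‖ = ‖x‖
  cont : ∀ x, Continuous fun s ↦ U s x

/-- A map that is Lipschitz on every ball. -/
def LocLip (N : X → X) : Prop := ∀ M : ℝ, ∃ K : ℝ≥0, LipschitzOnWith K N (closedBall 0 M)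

/-- `h` solves `h' = κ A h + N(h)` on `[0,T]`, where `A` is the generator of `U`: the equation is
required for `U(-κ t) h(t)`, for which it is an ordinary differential equation. -/
def Mild (U : ℝ → X →L[ℝ] X) (N : X → X) (κ T : ℝ) (h : ℝ → X) : Prop :=
  ∀ t ∈ Icc 0 T, HasDerivWithinAt (fun s ↦ U (-(κ * s)) (h s)) (U (-(κ * t)) (N (h t))) (Icc 0 T) t

variable {U : ℝ → X →L[ℝ] X} {N : X → X}

lemma IsometryGroup.neg_apply (hU : IsometryGroup U) (s : ℝ) (x : X) : U (-s) (U s x) = x := by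
  rw [← hU.add, neg_add_cancel, hU.zero]

lemma IsometryGroup.apply_neg (hU : IsometryGroup U) (s : ℝ) (x : X) : U s (U (-s) x) = x := by
  rw [← hU.add, add_neg_cancel, hU.zero]

lemma IsometryGroup.norm_sub (hU : IsometryGroup U) (s : ℝ) (x y : X) :
    ‖U s x - U s y‖ = ‖x - y‖ := by rw [← map_sub, hU.norm]

lemma IsometryGroup.continuous_uncurry (hU : IsometryGroup U) :
    Continuous fun p : ℝ × X ↦ U p.1 p.2 := by
  rw [continuous_iff_continuousAt]
  rintro ⟨s, x⟩
  rw [ContinuousAt, tendsto_iff_norm_sub_tendsto_zero]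
  have h1 : Tendsto (fun p : ℝ × X ↦ ‖p.2 - x‖ + ‖U p.1 x - U s x‖) (𝓝 (s, x)) (𝓝 (0 + 0)) := by
    apply Tendsto.add
    · have : Continuous fun p : ℝ × X ↦ ‖p.2 - x‖ := by fun_prop
      simpa using this.tendsto (s, x)
    · have : Continuous fun p : ℝ × X ↦ ‖U p.1 x - U s x‖ :=
        (((hU.cont x).comp continuous_fst).sub continuous_const).norm
      simpa using this.tendsto (s, x)
  rw [add_zero] at h1
  refine squeeze_zero (fun p ↦ norm_nonneg _) (fun p ↦ ?_) h1
  calc ‖U p.1 p.2 - U s x‖ = ‖(U p.1 p.2 - U p.1 x) + (U p.1 x - U s x)‖ := by congr 1; abel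
    _ ≤ _ := (norm_add_le _ _).trans (by rw [hU.norm_sub])

lemma IsometryGroup.continuousOn_comp (hU : IsometryGroup U) {f : ℝ → ℝ} {h : ℝ → X} {s : Set ℝ}
    (hf : ContinuousOn f s) (hh : ContinuousOn h s) : ContinuousOn (fun t ↦ U (f t) (h t)) s :=
  hU.continuous_uncurry.comp_continuousOn (hf.prodMk hh)

/-- The group converges to the identity uniformly on compact sets. -/
lemma IsometryGroup.uniform_of_compact (hU : IsometryGroup U) {S : Set X} (hS : IsCompact S)
    {η : ℝ} (hη : 0 < η) : ∃ s₀ > 0, ∀ s, |s| < s₀ → ∀ x ∈ S, ‖U s x - x‖ < η := by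
  have hopen : IsOpen {p : ℝ × X | ‖U p.1 p.2 - p.2‖ < η} :=
    isOpen_lt (hU.continuous_uncurry.sub continuous_snd).norm continuous_const
  obtain ⟨u, v, hu, -, h0, hv, huv⟩ := generalized_tube_lemma (isCompact_singleton (x := (0 : ℝ)))
    hS hopen (by rintro ⟨s, x⟩ ⟨hs, -⟩; simp only [mem_singleton_iff] at hs; simp [hs, hU.zero, hη])
  obtain ⟨s₀, hs₀, hb⟩ := Metric.isOpen_iff.1 hu 0 (h0 rfl)
  exact ⟨s₀, hs₀, fun s hs x hx ↦ huv (a := (s, x)) ⟨hb (by simpa using hs), hv hx⟩⟩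

lemma LocLip.continuous (hN : LocLip N) : Continuous N := by
  rw [continuous_iff_continuousAt]
  intro x
  obtain ⟨K, hK⟩ := hN (‖x‖ + 1)
  exact hK.continuousOn.continuousAt
    (closedBall_mem_nhds_of_mem (by simp) |> fun h ↦ h)

lemma Mild.continuousOn (hU : IsometryGroup U) {κ T : ℝ} {h : ℝ → X} (hm : Mild U N κ T h) :
    ContinuousOn h (Icc 0 T) := by
  have h1 : ContinuousOn (fun s ↦ U (-(κ * s)) (h s)) (Icc 0 T) :=
    fun t ht ↦ (hm t ht).continuousWithinAt
  have h2 := hU.continuousOn_comp (f := fun t ↦ κ * t) (by fun_prop) h1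
  exact h2.congr fun t _ ↦ (hU.apply_neg _ _).symm

lemma hasDerivWithinAt_Ici_of_Icc {f : ℝ → X} {f' : X} {T t : ℝ} (ht : t ∈ Ico 0 T)
    (h : HasDerivWithinAt f f' (Icc 0 T) t) : HasDerivWithinAt f f' (Ici t) t :=
  h.mono_of_mem_nhdsWithin (mem_of_superset (Icc_mem_nhdsGE ht.2) (Icc_subset_Icc_left ht.1))

lemma lipschitzOnWith_field (hU : IsometryGroup U) {K : ℝ≥0} {M : ℝ}
    (hK : LipschitzOnWith K N (closedBall 0 M)) (s : ℝ) :
    LipschitzOnWith K (fun w ↦ U (-s) (N (U s w))) (closedBall 0 M) := by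
  refine LipschitzOnWith.of_dist_le_mul fun x hx y hy ↦ ?_
  rw [dist_eq_norm, hU.norm_sub]
  have := hK.dist_le_mul (U s x) (by simpa [hU.norm] using hx) (U s y) (by simpa [hU.norm] using hy)
  rwa [dist_eq_norm, dist_eq_norm, hU.norm_sub, ← dist_eq_norm x y] at this

/-- Solutions are determined by their initial value. -/
lemma Mild.unique (hU : IsometryGroup U) (hN : LocLip N) {κ T : ℝ} {h h' : ℝ → X}
    (hm : Mild U N κ T h) (hm' : Mild U N κ T h') (h0 : h 0 = h' 0) :
    ∀ t ∈ Icc 0 T, h t = h' t := by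
  have c1 : ContinuousOn (fun s ↦ U (-(κ * s)) (h s)) (Icc 0 T) :=
    fun t ht ↦ (hm t ht).continuousWithinAt
  have c2 : ContinuousOn (fun s ↦ U (-(κ * s)) (h' s)) (Icc 0 T) :=
    fun t ht ↦ (hm' t ht).continuousWithinAt
  obtain ⟨M₁, hM₁⟩ := isCompact_Icc.exists_bound_of_continuousOn c1
  obtain ⟨M₂, hM₂⟩ := isCompact_Icc.exists_bound_of_continuousOn c2
  obtain ⟨K, hK⟩ := hN (max M₁ M₂)
  have key := ODE_solution_unique_of_mem_Icc_right (a := 0) (b := T) (K := K)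
    (v := fun t w ↦ U (-(κ * t)) (N (U (κ * t) w))) (s := fun _ ↦ closedBall 0 (max M₁ M₂))
    (fun t _ ↦ lipschitzOnWith_field hU hK (κ * t)) c1
    (fun t ht ↦ by
      rw [hU.apply_neg]
      exact hasDerivWithinAt_Ici_of_Icc ht (hm t ⟨ht.1, ht.2.le⟩))
    (fun t ht ↦ by simpa using Or.inl (hM₁ t ⟨ht.1, ht.2.le⟩)) c2
    (fun t ht ↦ by
      rw [hU.apply_neg]
      exact hasDerivWithinAt_Ici_of_Icc ht (hm' t ⟨ht.1, ht.2.le⟩))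
    (fun t ht ↦ by simpa using Or.inr (hM₂ t ⟨ht.1, ht.2.le⟩)) (by simp [h0])
  intro t ht
  have := congrArg (U (κ * t)) (key ht)
  simpa only [hU.apply_neg] using this

/-- The radial retraction onto the ball of radius `M`. -/
def retract (M : ℝ) (x : X) : X := (M / max M ‖x‖) • x

lemma retract_of_le {M : ℝ} (hM : 0 < M) {x : X} (hx : ‖x‖ ≤ M) : retract M x = x := by
  rw [retract, max_eq_left hx, div_self hM.ne', one_smul]

lemma norm_retract_le {M : ℝ} (hM : 0 < M) (x : X) : ‖retract M x‖ ≤ M := by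
  have h : 0 < max M ‖x‖ := lt_max_of_lt_left hM
  rw [retract, norm_smul, Real.norm_of_nonneg (by positivity), div_mul_eq_mul_div,
    div_le_iff₀ h]
  gcongr
  exact le_max_right _ _

lemma norm_retract_sub_le {M : ℝ} (hM : 0 < M) (x y : X) :
    ‖retract M x - retract M y‖ ≤ 2 * ‖x - y‖ := by
  set a := max M ‖x‖
  set b := max M ‖y‖
  have ha : 0 < a := lt_max_of_lt_left hM
  have hb : 0 < b := lt_max_of_lt_left hM
  have e : retract M x - retract M y = (M / a) • (x - y) + (M / a - M / b) • y := by
    simp only [retract, a, b]; rw [smul_sub, sub_smul]; abel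
  have h1 : M / a ≤ 1 := by rw [div_le_one ha]; exact le_max_left _ _
  have h2 : |a - b| ≤ ‖x - y‖ :=
    (abs_max_sub_max_le_abs _ _ _).trans (by simpa using abs_norm_sub_norm_le x y) |> fun h ↦ by
      simpa [a, b, max_comm] using h
  have h3 : |M / a - M / b| * ‖y‖ ≤ ‖x - y‖ := by
    have : M / a - M / b = (M / a) * (b - a) / b := by field_simp
    rw [this, abs_div, abs_mul, abs_of_pos hb, abs_of_pos (by positivity : 0 < M / a),
      div_mul_eq_mul_div, div_le_iff₀ hb]
    calc M / a * |b - a| * ‖y‖ ≤ 1 * ‖x - y‖ * b := by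
          rw [abs_sub_comm]; gcongr; exact le_max_right _ _
      _ = _ := by ring
  rw [e]
  refine (norm_add_le _ _).trans ?_
  rw [norm_smul, norm_smul, Real.norm_of_nonneg (by positivity : 0 ≤ M / a), Real.norm_eq_abs]
  nlinarith [norm_nonneg (x - y)]

/-- An approximate solution is shadowed by a solution. -/
theorem exists_mild_of_approx [CompleteSpace X] (hU : IsometryGroup U) (hN : LocLip N) (M : ℝ) :
    ∃ K : ℝ≥0, ∀ (κ T δ e : ℝ) (z z' : ℝ → X) (x₀ : X), 0 ≤ T → 0 ≤ δ → 0 ≤ e →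
      (∀ t ∈ Icc 0 T, HasDerivWithinAt z (z' t) (Icc 0 T) t) → (∀ t ∈ Icc 0 T, ‖z t‖ ≤ M) →
      (∀ t ∈ Icc 0 T, ‖z' t - U (-(κ * t)) (N (U (κ * t) (z t)))‖ ≤ e) → ‖x₀ - z 0‖ ≤ δ →
      gronwallBound δ K e T ≤ 1 →
      ∃ h, Mild U N κ T h ∧ h 0 = x₀ ∧
        ∀ t ∈ Icc 0 T, ‖U (-(κ * t)) (h t) - z t‖ ≤ gronwallBound δ K e t := by
  set R := |M| + 1
  have hR : 0 < R := by positivity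
  obtain ⟨K, hK⟩ := hN R
  set N' : X → X := fun x ↦ N (retract R x)
  have hN' : ∀ x y, ‖N' x - N' y‖ ≤ (2 * K : ℝ≥0) * ‖x - y‖ := by
    intro x y
    have h1 := hK.dist_le_mul (retract R x) (by simpa using norm_retract_le hR x)
      (retract R y) (by simpa using norm_retract_le hR y)
    rw [dist_eq_norm, dist_eq_norm] at h1
    refine h1.trans ?_
    push_cast
    nlinarith [norm_retract_sub_le hR x y, K.2]
  obtain ⟨B, hB⟩ : ∃ B : ℝ≥0, ∀ x, ‖N' x‖ ≤ B := by
    refine ⟨⟨‖N 0‖ + K * R, by positivity⟩, fun x ↦ ?_⟩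
    have h1 := hK.dist_le_mul (retract R x) (by simpa using norm_retract_le hR x) 0
      (by simp [hR.le])
    rw [dist_eq_norm, dist_eq_norm, sub_zero] at h1
    have h2 : ‖N' x‖ ≤ ‖N 0‖ + ‖N (retract R x) - N 0‖ := by
      simpa [N', add_comm] using norm_le_norm_add_norm_sub' (N (retract R x)) (N 0)
    refine h2.trans (add_le_add_right (h1.trans ?_) _)
    gcongr
    exact norm_retract_le hR x
  refine ⟨2 * K, fun κ T δ e z z' x₀ hT hδ he hz hzM hz' hx₀ hg ↦ ?_⟩
  set v : ℝ → X → X := fun t w ↦ U (-(κ * t)) (N' (U (κ * t) w))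
  have hv : ∀ t, LipschitzWith (2 * K) (v t) := by
    intro t
    refine LipschitzWith.of_dist_le_mul fun x y ↦ ?_
    rw [dist_eq_norm, dist_eq_norm, hU.norm_sub]
    refine (hN' _ _).trans ?_
    rw [hU.norm_sub]
  have hN'c : Continuous N' := by
    have : LipschitzWith (2 * K) N' := LipschitzWith.of_dist_le_mul fun x y ↦ by
      rw [dist_eq_norm, dist_eq_norm]; exact hN' x y
    exact this.continuous
  have hpl : IsPicardLindelof v (tmin := 0) (tmax := T) ⟨0, le_rfl, hT⟩ x₀ (B * ⟨T, hT⟩) 0 B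
      (2 * K) := by
    refine ⟨fun t _ ↦ (hv t).lipschitzOnWith, fun x _ ↦ ?_, fun t _ x _ ↦ ?_, ?_⟩
    · apply Continuous.continuousOn
      have h1 : Continuous fun t : ℝ ↦ N' (U (κ * t) x) :=
        hN'c.comp ((hU.cont x).comp (by fun_prop))
      exact hU.continuous_uncurry.comp
        ((by fun_prop : Continuous fun t : ℝ ↦ -(κ * t)).prodMk h1)
    · rw [hU.norm]; exact hB _
    · simp [hT]
      exact le_rfl
  obtain ⟨w, hw0, hw⟩ := hpl.exists_eq_forall_mem_Icc_hasDerivWithinAt₀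
  have hw0' : w 0 = x₀ := hw0
  have hclose : ∀ t ∈ Icc 0 T, ‖w t - z t‖ ≤ gronwallBound δ (2 * K : ℝ≥0) e t := by
    intro t ht
    have := dist_le_of_approx_trajectories_ODE (v := v) (f := w) (g := z) (a := 0) (b := T)
      (f' := fun t ↦ v t (w t)) (g' := z') (εf := 0) (εg := e) (δ := δ) hv
      (fun t ht ↦ (hw t ht).continuousWithinAt)
      (fun t ht ↦ hasDerivWithinAt_Ici_of_Icc ht (hw t ⟨ht.1, ht.2.le⟩))
      (fun t _ ↦ by simp) (fun t ht ↦ (hz t ht).continuousWithinAt)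
      (fun t ht ↦ hasDerivWithinAt_Ici_of_Icc ht (hz t ⟨ht.1, ht.2.le⟩))
      (fun t ht ↦ by
        have h1 := hz' t ⟨ht.1, ht.2.le⟩
        rw [dist_eq_norm]
        simp only [v, N']
        rw [retract_of_le hR]
        · exact h1
        · rw [hU.norm]
          have := hzM t ⟨ht.1, ht.2.le⟩
          simp only [R]
          linarith [le_abs_self M])
      (by rw [hw0', dist_eq_norm]; exact hx₀) t ht
    simpa [dist_eq_norm] using this
  refine ⟨fun t ↦ U (κ * t) (w t), fun t ht ↦ ?_, by simp [hU.zero, hw0'], fun t ht ↦ ?_⟩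
  · have h1 := hw t ht
    have hwR : ‖w t‖ ≤ R := by
      have h2 := (hclose t ht).trans ((gronwallBound_mono hδ he (by positivity) ht.2).trans hg)
      have h3 := hzM t ht
      have h4 := norm_le_norm_add_norm_sub' (w t) (z t)
      simp only [R]
      linarith [le_abs_self M]
    have h5 : v t (w t) = U (-(κ * t)) (N (U (κ * t) (w t))) := by
      simp only [v, N']
      rw [retract_of_le hR]
      rwa [hU.norm]
    rw [h5] at h1
    exact h1.congr (fun s _ ↦ hU.neg_apply _ _) (hU.neg_apply _ _)
  · rw [hU.neg_apply]; exact hclose t ht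

/-- Existence and stability of solutions under perturbation of the initial value. -/
theorem Mild.stability [CompleteSpace X] (hU : IsometryGroup U) (hN : LocLip N) {κ T : ℝ} {h : ℝ → X}
    (hT : 0 ≤ T) (hm : Mild U N κ T h) {η : ℝ} (hη : 0 < η) :
    ∃ δ > 0, ∀ x₀, ‖x₀ - h 0‖ < δ → ∃ h', Mild U N κ T h' ∧ h' 0 = x₀ ∧ ‖h' T - h T‖ < η := by
  have c1 : ContinuousOn (fun s ↦ U (-(κ * s)) (h s)) (Icc 0 T) :=
    fun t ht ↦ (hm t ht).continuousWithinAt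
  obtain ⟨M, hM⟩ := isCompact_Icc.exists_bound_of_continuousOn c1
  obtain ⟨K, hK⟩ := exists_mild_of_approx hU hN M
  set E := Real.exp (K * T)
  have hE : 0 < E := Real.exp_pos _
  refine ⟨min 1 (η / 2) / E, by positivity, fun x₀ hx₀ ↦ ?_⟩
  obtain ⟨h', h1, h2, h3⟩ := hK κ T (min 1 (η / 2) / E) 0 (fun s ↦ U (-(κ * s)) (h s))
    (fun t ↦ U (-(κ * t)) (N (h t))) x₀ hT (by positivity) le_rfl hm hM
    (fun t _ ↦ by rw [hU.apply_neg, sub_self, norm_zero])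
    (by simpa [hU.zero] using hx₀.le)
    (by rw [gronwallBound_ε0]; change _ * E ≤ 1; rw [div_mul_cancel₀ _ hE.ne']; exact min_le_left _ _)
  refine ⟨h', h1, h2, ?_⟩
  have h4 := h3 T ⟨hT, le_rfl⟩
  rw [hU.norm_sub, gronwallBound_ε0] at h4
  change _ ≤ _ * E at h4
  rw [div_mul_cancel₀ _ hE.ne'] at h4
  exact (h4.trans (min_le_right _ _)).trans_lt (by linarith)

lemma tendsto_gronwallBound_error (K : ℝ≥0) (T η : ℝ) (hη : 0 < η) :
    ∃ e > 0, gronwallBound 0 K e T ≤ η := by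
  have h := (gronwallBound_continuous_ε 0 K T).tendsto 0
  rw [gronwallBound_ε0_δ0] at h
  have h2 : ∀ᶠ e in 𝓝[>] (0 : ℝ), gronwallBound 0 K e T < η :=
    (h.mono_left nhdsWithin_le_nhds).eventually_lt_const hη
  obtain ⟨e, he1, he2⟩ := (h2.and self_mem_nhdsWithin).exists
  exact ⟨e, he2, he1.le⟩

/-- In the limit of small dispersion, solutions exist as long as the solution without dispersion
does, and converge to it. -/
theorem exists_mild_small_dispersion [CompleteSpace X] (hU : IsometryGroup U) (hN : LocLip N) {T : ℝ}
    (hT : 0 ≤ T) {y : ℝ → X} (hy : ∀ t ∈ Icc 0 T, HasDerivWithinAt y (N (y t)) (Icc 0 T) t)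
    {η : ℝ} (hη : 0 < η) :
    ∃ κ₀ > 0, ∀ κ, 0 < κ → κ < κ₀ → ∃ h, Mild U N κ T h ∧ h 0 = y 0 ∧
      ∀ t ∈ Icc 0 T, ‖h t - y t‖ ≤ η := by
  have c1 : ContinuousOn y (Icc 0 T) := fun t ht ↦ (hy t ht).continuousWithinAt
  obtain ⟨M, hM⟩ := isCompact_Icc.exists_bound_of_continuousOn c1
  obtain ⟨K, hK⟩ := exists_mild_of_approx hU hN M
  obtain ⟨L, hL⟩ := hN M
  obtain ⟨e, he, heη⟩ := tendsto_gronwallBound_error K T (min 1 (η / 2)) (by positivity)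
  set e' := min (e / (2 * (L + 1))) (min (e / 2) (η / 2))
  have he' : 0 < e' := by positivity
  obtain ⟨s₁, hs₁, H₁⟩ := hU.uniform_of_compact (isCompact_Icc.image_of_continuousOn c1) he'
  obtain ⟨s₂, hs₂, H₂⟩ := hU.uniform_of_compact (isCompact_Icc.image_of_continuousOn
    (hN.continuous.comp_continuousOn c1)) he'
  refine ⟨min s₁ s₂ / (T + 1), by positivity, fun κ hκ hκ' ↦ ?_⟩
  have hs : ∀ t ∈ Icc 0 T, |κ * t| < min s₁ s₂ := by
    intro t ht
    rw [abs_of_nonneg (mul_nonneg hκ.le ht.1)]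
    rw [lt_div_iff₀ (by positivity)] at hκ'
    nlinarith [ht.2]
  have hy1 : ∀ t ∈ Icc 0 T, ‖U (κ * t) (y t) - y t‖ < e' := fun t ht ↦
    H₁ _ ((hs t ht).trans_le (min_le_left _ _)) _ ⟨t, ht, rfl⟩
  have hy2 : ∀ t ∈ Icc 0 T, ‖U (κ * t) (N (y t)) - N (y t)‖ < e' := fun t ht ↦
    H₂ _ ((hs t ht).trans_le (min_le_right _ _)) _ ⟨t, ht, rfl⟩
  obtain ⟨h, h1, h2, h3⟩ := hK κ T 0 e y (fun t ↦ N (y t)) (y 0) hT le_rfl he.le hy hM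
    (fun t ht ↦ by
      have a1 := hL.dist_le_mul (U (κ * t) (y t)) (by simpa [hU.norm] using hM t ht) (y t)
        (by simpa using hM t ht)
      rw [dist_eq_norm, dist_eq_norm] at a1
      calc ‖N (y t) - U (-(κ * t)) (N (U (κ * t) (y t)))‖
          = ‖U (κ * t) (N (y t)) - N (U (κ * t) (y t))‖ := by
            rw [← hU.norm_sub (κ * t), hU.apply_neg]
        _ = ‖(U (κ * t) (N (y t)) - N (y t)) - (N (U (κ * t) (y t)) - N (y t))‖ := by
            congr 1; abel
        _ ≤ e' + L * e' := (norm_sub_le _ _).trans (add_le_add (hy2 t ht).le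
            (a1.trans (by gcongr; exact (hy1 t ht).le)))
        _ ≤ e / 2 + (L + 1) * (e / (2 * (L + 1))) := by
            gcongr
            · exact (min_le_right _ _).trans (min_le_left _ _)
            · linarith
            · exact min_le_left _ _
        _ = e := by field_simp; ring)
    (by simp) (heη.trans (min_le_left _ _))
  refine ⟨h, h1, h2, fun t ht ↦ ?_⟩
  have a2 := (h3 t ht).trans ((gronwallBound_mono le_rfl he.le (by positivity) ht.2).trans
    (heη.trans (min_le_right _ _)))
  rw [← hU.norm_sub (κ * t), hU.apply_neg] at a2
  calc ‖h t - y t‖ = ‖(h t - U (κ * t) (y t)) + (U (κ * t) (y t) - y t)‖ := by congr 1; abel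
    _ ≤ η / 2 + η / 2 := (norm_add_le _ _).trans (add_le_add a2 ((hy1 t ht).le.trans
        ((min_le_right _ _).trans (min_le_right _ _))))
    _ = η := by ring

/-- Local existence, uniformly in the dispersion. -/
theorem exists_mild_local [CompleteSpace X] (hU : IsometryGroup U) (hN : LocLip N) (M : ℝ) {η : ℝ}
    (hη : 0 < η) : ∃ τ > 0, ∀ (κ : ℝ) (x₀ : X), ‖x₀‖ ≤ M → ∃ h, Mild U N κ τ h ∧ h 0 = x₀ ∧
      ∀ t ∈ Icc 0 τ, ‖U (-(κ * t)) (h t) - x₀‖ ≤ η := by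
  obtain ⟨K, hK⟩ := exists_mild_of_approx hU hN M
  obtain ⟨L, hL⟩ := hN |M|
  set B := ‖N 0‖ + L * |M|
  have hg := (hasDerivAt_gronwallBound 0 K B 0).continuousAt.tendsto
  rw [gronwallBound_x0] at hg
  have h2 : ∀ᶠ t in 𝓝[>] (0 : ℝ), gronwallBound 0 K B t < min 1 η :=
    (hg.mono_left nhdsWithin_le_nhds).eventually_lt_const (by positivity)
  obtain ⟨τ, hτ1, hτ2⟩ := (h2.and self_mem_nhdsWithin).exists
  have hτ : 0 < τ := hτ2
  refine ⟨τ, hτ, fun κ x₀ hx₀ ↦ ?_⟩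
  have hB : ∀ t, ‖(0 : X) - U (-(κ * t)) (N (U (κ * t) x₀))‖ ≤ B := by
    intro t
    rw [zero_sub, norm_neg, hU.norm]
    have hx : ‖U (κ * t) x₀‖ ≤ |M| := by rw [hU.norm]; exact hx₀.trans (le_abs_self M)
    have a1 := hL.dist_le_mul (U (κ * t) x₀) (by simpa using hx) 0 (by simp)
    rw [dist_eq_norm, dist_eq_norm, sub_zero] at a1
    have a2 := norm_le_norm_add_norm_sub' (N (U (κ * t) x₀)) (N 0)
    refine a2.trans (add_le_add_right (a1.trans (by gcongr)) _)
  obtain ⟨h, h1, h2, h3⟩ := hK κ τ 0 B (fun _ ↦ x₀) (fun _ ↦ 0) x₀ hτ.le le_rfl (by positivity)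
    (fun t _ ↦ hasDerivWithinAt_const _ _ _) (fun t _ ↦ hx₀) (fun t _ ↦ hB t) (by simp)
    (hτ1.le.trans (min_le_left _ _))
  exact ⟨h, h1, h2, fun t ht ↦ (h3 t ht).trans
    ((gronwallBound_mono le_rfl (by positivity) (by positivity) ht.2).trans
      (hτ1.le.trans (min_le_right _ _)))⟩

/-- Time reversal. -/
lemma Mild.reverse (hU : IsometryGroup U) {C : X →L[ℝ] X} (hCU : ∀ s x, C (U s x) = U (-s) (C x))
    (hCN : ∀ x, N (C x) = -C (N x)) {κ T : ℝ} {h : ℝ → X} (hm : Mild U N κ T h) :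
    Mild U N κ T (fun t ↦ C (h (T - t))) := by
  intro t ht
  have ht' : T - t ∈ Icc 0 T := ⟨by linarith [ht.2], by linarith [ht.1]⟩
  have h1 := (hm (T - t) ht').scomp (h := fun s ↦ T - s) (h' := -1) (s := Icc 0 T) t
    ((hasDerivWithinAt_id t (Icc 0 T)).const_sub T) (fun s hs ↦ ⟨by linarith [hs.2], by linarith [hs.1]⟩)
  have h2 := (C ∘L U (κ * T)).hasFDerivAt.comp_hasDerivWithinAt t h1
  have e : ∀ s x, C (U (κ * T) (U (-(κ * (T - s))) x)) = U (-(κ * s)) (C x) := by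
    intro s x
    rw [← hU.add, hCU]
    congr 2; ring
  refine HasDerivWithinAt.congr_deriv (h2.congr (fun s _ ↦ ?_) ?_) ?_
  · simp only [Function.comp_apply, ContinuousLinearMap.comp_apply]
    rw [e]
  · simp only [Function.comp_apply, ContinuousLinearMap.comp_apply]
    rw [e]
  · simp only [neg_smul, one_smul, map_neg, ContinuousLinearMap.comp_apply]
    rw [e, hCN, map_neg]

/-- Concatenation of solutions. -/
lemma Mild.concat (hU : IsometryGroup U) {κ T₁ T₂ : ℝ} (hT₁ : 0 ≤ T₁) (hT₂ : 0 ≤ T₂) {h₁ h₂ : ℝ → X}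
    (hm₁ : Mild U N κ T₁ h₁) (hm₂ : Mild U N κ T₂ h₂) (hh : h₁ T₁ = h₂ 0) :
    Mild U N κ (T₁ + T₂) (fun t ↦ if t ≤ T₁ then h₁ t else h₂ (t - T₁)) := by
  set h : ℝ → X := fun t ↦ if t ≤ T₁ then h₁ t else h₂ (t - T₁)
  have hl : ∀ t ≤ T₁, h t = h₁ t := fun t ht ↦ if_pos ht
  have hr : ∀ t, T₁ ≤ t → h t = h₂ (t - T₁) := by
    intro t ht
    rcases ht.eq_or_lt with rfl | ht
    · rw [hl _ le_rfl, hh, sub_self]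
    · exact if_neg (not_le.2 ht)
  have left : ∀ t ∈ Icc 0 T₁, HasDerivWithinAt (fun s ↦ U (-(κ * s)) (h s))
      (U (-(κ * t)) (N (h t))) (Icc 0 T₁) t := by
    intro t ht
    rw [hl t ht.2]
    exact (hm₁ t ht).congr (fun s hs ↦ by rw [hl s hs.2]) (by rw [hl t ht.2])
  have right : ∀ t ∈ Icc T₁ (T₁ + T₂), HasDerivWithinAt (fun s ↦ U (-(κ * s)) (h s))
      (U (-(κ * t)) (N (h t))) (Icc T₁ (T₁ + T₂)) t := by
    intro t ht
    have ht' : t - T₁ ∈ Icc 0 T₂ := ⟨by linarith [ht.1], by linarith [ht.2]⟩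
    have h1 := (hm₂ (t - T₁) ht').scomp (s := Icc T₁ (T₁ + T₂)) (h := fun s ↦ s - T₁) (h' := 1) t
      ((hasDerivWithinAt_id t (Icc T₁ (T₁ + T₂))).sub_const T₁)
      (fun s hs ↦ ⟨by linarith [hs.1], by linarith [hs.2]⟩)
    have h2 := (U (-(κ * T₁))).hasFDerivAt.comp_hasDerivWithinAt t h1
    have e : ∀ s x, U (-(κ * T₁)) (U (-(κ * (s - T₁))) x) = U (-(κ * s)) x := by
      intro s x; rw [← hU.add]; congr 2; ring
    refine HasDerivWithinAt.congr_deriv (h2.congr (fun s hs ↦ ?_) ?_) ?_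
    · simp only [Function.comp_apply]
      rw [e, hr s hs.1]
    · simp only [Function.comp_apply]
      rw [e, hr t ht.1]
    · rw [one_smul, e, hr t ht.1]
  have hunion : Icc 0 (T₁ + T₂) = Icc 0 T₁ ∪ Icc T₁ (T₁ + T₂) :=
    (Icc_union_Icc_eq_Icc hT₁ (by linarith)).symm
  intro t ht
  rcases lt_trichotomy t T₁ with h1 | rfl | h1
  · exact (left t ⟨ht.1, h1.le⟩).mono_of_mem_nhdsWithin
      (mem_nhdsWithin.2 ⟨Iio T₁, isOpen_Iio, h1, fun s hs ↦ ⟨hs.2.1, hs.1.le⟩⟩)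
  · rw [hunion]
    exact (left t ⟨hT₁, le_rfl⟩).union (right t ⟨le_rfl, by linarith⟩)
  · exact (right t ⟨h1.le, ht.2⟩).mono_of_mem_nhdsWithin
      (mem_nhdsWithin.2 ⟨Ioi T₁, isOpen_Ioi, h1, fun s hs ↦ ⟨hs.1.le, hs.2.2⟩⟩)

end Abstract

/-! ### The free evolution -/

/-- The symbol `|2πξ|⁴` of `Δ²`. -/
def symb (ξ : Space d) : ℝ := (2 * Real.pi * ‖ξ‖) ^ 4

lemma symb_nonneg (ξ : Space d) : 0 ≤ symb ξ := by unfold symb; positivity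

lemma hasTemperateGrowth_symb : Function.HasTemperateGrowth (symb : Space d → ℝ) := by
  have h := Function.hasTemperateGrowth_norm_sq (H := Space d)
  have : (symb : Space d → ℝ) = fun ξ ↦ (2 * Real.pi) ^ 4 * (‖ξ‖ ^ 2) ^ 2 := by
    ext ξ; simp only [symb]; ring
  rw [this]
  exact (Function.HasTemperateGrowth.const _).mul (h.pow 2)

lemma continuous_symb : Continuous (symb : Space d → ℝ) := hasTemperateGrowth_symb.1.continuous

lemma hasTemperateGrowth_symb_complex :
    Function.HasTemperateGrowth (fun ξ : Space d ↦ (symb ξ : ℂ)) :=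
  (by fun_prop : Function.HasTemperateGrowth Complex.ofReal).comp hasTemperateGrowth_symb

lemma hasTemperateGrowth_exp_I :
    Function.HasTemperateGrowth (fun x : ℝ ↦ Complex.exp (Complex.I * x)) := by
  have hd : ∀ x : ℝ, HasDerivAt (fun x : ℝ ↦ Complex.exp (Complex.I * x))
      (Complex.I * Complex.exp (Complex.I * x)) x := by
    intro x
    have h1 : HasDerivAt (fun x : ℝ ↦ Complex.I * (x : ℂ)) Complex.I x := by
      simpa using (Complex.ofRealCLM.hasDerivAt (x := x)).const_mul Complex.I
    simpa [mul_comm] using h1.cexp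
  have hi : ∀ n : ℕ, iteratedDeriv n (fun x : ℝ ↦ Complex.exp (Complex.I * x)) =
      fun x : ℝ ↦ Complex.I ^ n * Complex.exp (Complex.I * x) := by
    intro n
    induction n with
    | zero => simp
    | succ n ih =>
      rw [iteratedDeriv_succ, ih]
      ext x
      rw [((hd x).const_mul _).deriv]; ring
  refine ⟨(contDiff_const.mul Complex.ofRealCLM.contDiff).cexp, fun n ↦ ⟨0, 1, fun x ↦ ?_⟩⟩
  rw [norm_iteratedFDeriv_eq_norm_iteratedDeriv, hi]
  simp [mul_comm Complex.I, Complex.norm_exp_ofReal_mul_I]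

/-- The multiplier `e^{is|2πξ|⁴}` of the free evolution. -/
def phase (s : ℝ) : Space d →ᵇ ℂ :=
  BoundedContinuousFunction.ofNormedAddCommGroup
    (fun ξ ↦ Complex.exp (Complex.I * ((s * symb ξ : ℝ) : ℂ)))
    (by have := continuous_symb (d := d); fun_prop) 1
    (fun ξ ↦ by rw [mul_comm Complex.I, Complex.norm_exp_ofReal_mul_I])

lemma phase_apply (s : ℝ) (ξ : Space d) :
    phase s ξ = Complex.exp (Complex.I * ((s * symb ξ : ℝ) : ℂ)) := rfl

lemma norm_phase (s : ℝ) (ξ : Space d) : ‖phase s ξ‖ = 1 := by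
  rw [phase_apply, mul_comm Complex.I, Complex.norm_exp_ofReal_mul_I]

lemma phase_add (s t : ℝ) : (phase (s + t) : Space d →ᵇ ℂ) = phase s * phase t := by
  ext ξ
  rw [BoundedContinuousFunction.mul_apply, phase_apply, phase_apply, phase_apply, ← Complex.exp_add]
  congr 1; push_cast; ring

lemma phase_zero : (phase 0 : Space d →ᵇ ℂ) = 1 := by
  ext ξ; simp [phase_apply]

lemma conj_phase (s : ℝ) (ξ : Space d) : conj (phase s ξ) = phase (-s) ξ := by
  rw [phase_apply, phase_apply, ← Complex.exp_conj]
  congr 1; simp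

lemma hasTemperateGrowth_phase (s : ℝ) :
    Function.HasTemperateGrowth (fun ξ : Space d ↦ phase s ξ) := by
  have h := hasTemperateGrowth_symb (d := d)
  have h2 : Function.HasTemperateGrowth (fun ξ : Space d ↦ s * symb ξ) :=
    (Function.HasTemperateGrowth.const _).mul h
  exact hasTemperateGrowth_exp_I.comp h2

/-- Multiplication of a Schwartz function by `|2πξ|⁴`. -/
def symbS (ψ : 𝓢(Space d, ℂ)) : 𝓢(Space d, ℂ) :=
  SchwartzMap.smulLeftCLM ℂ (fun ξ ↦ (symb ξ : ℂ)) ψ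

lemma symbS_apply (ψ : 𝓢(Space d, ℂ)) (ξ : Space d) : symbS ψ ξ = symb ξ * ψ ξ := by
  rw [symbS, SchwartzMap.smulLeftCLM_apply_apply hasTemperateGrowth_symb_complex, smul_eq_mul]

/-- Multiplication of a Schwartz function by `e^{is|2πξ|⁴}`. -/
def phaseS (s : ℝ) (ψ : 𝓢(Space d, ℂ)) : 𝓢(Space d, ℂ) :=
  SchwartzMap.smulLeftCLM ℂ (fun ξ ↦ phase s ξ) ψ

lemma phaseS_apply (s : ℝ) (ψ : 𝓢(Space d, ℂ)) (ξ : Space d) :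
    phaseS s ψ ξ = phase s ξ * ψ ξ := by
  rw [phaseS, SchwartzMap.smulLeftCLM_apply_apply (hasTemperateGrowth_phase s), smul_eq_mul]

lemma norm_exp_I_sub_one_sub_le (a : ℝ) :
    ‖Complex.exp (Complex.I * a) - 1 - Complex.I * a‖ ≤ 3 * a ^ 2 := by
  rcases le_or_gt |a| 1 with h | h
  · have := Complex.norm_exp_sub_one_sub_id_le (x := Complex.I * a) (by simpa using h)
    refine this.trans ?_
    simp only [norm_mul, Complex.norm_I, Complex.norm_real, Real.norm_eq_abs, one_mul, sq_abs]
    nlinarith [sq_nonneg a]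
  · have h1 := Real.norm_exp_I_mul_ofReal_sub_one_le (x := a)
    refine (norm_sub_le _ _).trans ?_
    simp only [norm_mul, Complex.norm_I, Complex.norm_real, Real.norm_eq_abs, one_mul] at *
    rw [← sq_abs]
    nlinarith

/-- The free evolution in the Fourier picture. -/
def flow (s : ℝ) : L2 d →L[ℝ] L2 d := (mulL2 (phase s)).restrictScalars ℝ

lemma flow_apply (s : ℝ) (h : L2 d) : flow s h = mulL2 (phase s) h := rfl

lemma flow_toLp_coe (s : ℝ) (ψ : 𝓢(Space d, ℂ)) :
    flow s (ψ.toLp 2 volume) =ᵐ[volume] fun ξ ↦ phase s ξ * ψ ξ := by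
  rw [flow_apply]
  filter_upwards [mulL2_coe (phase s) (ψ.toLp 2 volume), ψ.coeFn_toLp 2 volume] with ξ h1 h2
  rw [h1, h2]

lemma flow_toLp (s : ℝ) (ψ : 𝓢(Space d, ℂ)) :
    flow s (ψ.toLp 2 volume) = (phaseS s ψ).toLp 2 volume := by
  apply Lp.ext
  filter_upwards [flow_toLp_coe s ψ, (phaseS s ψ).coeFn_toLp 2 volume] with ξ h1 h2
  rw [h1, h2, phaseS_apply]

lemma norm_flow (s : ℝ) (h : L2 d) : ‖flow s h‖ = ‖h‖ := norm_mulL2_eq _ (norm_phase s) h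

lemma flow_add (s t : ℝ) (h : L2 d) : flow (s + t) h = flow s (flow t h) := by
  simp only [flow_apply]; rw [mulL2_mul, phase_add]

lemma flow_smul (s : ℝ) (c : ℂ) (h : L2 d) : flow s (c • h) = c • flow s h :=
  (mulL2 (phase s)).map_smul c h

/-- The free evolution of a Schwartz function is differentiable in `L²`. -/
lemma hasDerivAt_flow_toLp (ψ : 𝓢(Space d, ℂ)) (t : ℝ) :
    HasDerivAt (fun s ↦ flow s (ψ.toLp 2 volume))
      (flow t (Complex.I • (symbS ψ).toLp 2 volume)) t := by
  rw [hasDerivAt_iff_isLittleO]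
  have key : ∀ s, ‖flow s (ψ.toLp 2 volume) - flow t (ψ.toLp 2 volume) -
      (s - t) • flow t (Complex.I • (symbS ψ).toLp 2 volume)‖ ≤
      3 * (s - t) ^ 2 * ‖(symbS (symbS ψ)).toLp 2 volume‖ := by
    intro s
    have e : flow s (ψ.toLp 2 volume) = flow t (flow (s - t) (ψ.toLp 2 volume)) := by
      rw [← flow_add]; congr 2; ring
    rw [e, ← map_smul, ← map_sub, ← map_sub, norm_flow]
    apply Lp.norm_le_mul_norm_of_ae_le_mul
    filter_upwards [Lp.coeFn_sub (flow (s - t) (ψ.toLp 2 volume) - ψ.toLp 2 volume)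
      ((s - t) • Complex.I • (symbS ψ).toLp 2 volume),
      Lp.coeFn_sub (flow (s - t) (ψ.toLp 2 volume)) (ψ.toLp 2 volume),
      Lp.coeFn_smul (s - t) (Complex.I • (symbS ψ).toLp 2 volume),
      Lp.coeFn_smul Complex.I ((symbS ψ).toLp 2 volume), flow_toLp_coe (s - t) ψ,
      ψ.coeFn_toLp 2 volume, (symbS ψ).coeFn_toLp 2 volume,
      (symbS (symbS ψ)).coeFn_toLp 2 volume] with ξ h1 h2 h3 h4 h5 h6 h7 h8
    rw [h1, Pi.sub_apply, h2, Pi.sub_apply, h3, Pi.smul_apply, h4, Pi.smul_apply, h5, h6, h7, h8,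
      symbS_apply, symbS_apply, symbS_apply]
    have := norm_exp_I_sub_one_sub_le ((s - t) * symb ξ)
    have e2 : phase (s - t) ξ * ψ ξ - ψ ξ - (s - t) • Complex.I • ((symb ξ : ℂ) * ψ ξ) =
        (Complex.exp (Complex.I * ((s - t) * symb ξ : ℝ)) - 1 -
          Complex.I * ((s - t) * symb ξ : ℝ)) * ψ ξ := by
      rw [phase_apply, Complex.real_smul, smul_eq_mul]; push_cast; ring
    rw [e2, norm_mul, norm_mul, norm_mul, Complex.norm_real, Real.norm_of_nonneg (symb_nonneg ξ)]
    calc _ ≤ 3 * ((s - t) * symb ξ) ^ 2 * ‖ψ ξ‖ := by gcongr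
      _ = _ := by ring
  refine Asymptotics.IsBigO.trans_isLittleO (g := fun s ↦ (s - t) ^ 2) ?_ ?_
  · refine Asymptotics.IsBigO.of_bound (3 * ‖(symbS (symbS ψ)).toLp 2 volume‖)
      (Eventually.of_forall fun s ↦ (key s).trans (le_of_eq ?_))
    rw [Real.norm_of_nonneg (sq_nonneg _)]; ring
  · have : (fun s : ℝ ↦ (s - t) ^ 2) =o[𝓝 t] fun s ↦ (s - t) ^ 1 := by
      have h := (Asymptotics.isLittleO_pow_pow (𝕜 := ℝ) (show 1 < 2 by norm_num))
      exact h.comp_tendsto (tendsto_sub_nhds_zero_iff.2 tendsto_id)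
    simpa using this

lemma isometryGroup_flow : IsometryGroup (flow (d := d)) where
  zero h := by rw [flow_apply, phase_zero, mulL2_one]
  add := flow_add
  norm := norm_flow
  cont h := by
    obtain ⟨u, hu⟩ := exists_seq_profile 0 h
    refine (continuous_iff_continuousAt.2 fun t ↦ ?_)
    refine (TendstoUniformly.continuous (F := fun n s ↦ flow s ((profile 0 (u n)).toLp 2 volume))
      (p := atTop) ?_ ?_).continuousAt
    · rw [Metric.tendstoUniformly_iff]
      intro ε hε
      filter_upwards [Metric.tendsto_nhds.1 hu ε hε] with n hn s
      rw [dist_comm, dist_eq_norm, ← map_sub, norm_flow, ← dist_eq_norm]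
      exact hn
    · refine Frequently.of_forall fun n ↦ ?_
      exact continuous_iff_continuousAt.2 fun s ↦ (hasDerivAt_flow_toLp _ s).continuousAt

/-- The nonlinearity `iμ|u|^{ν-1}u` in the Fourier picture. -/
def force (ν μ : ℝ) (k : ℕ) (h : L2 d) : L2 d := (Complex.I * μ) • nlProfile ν k h

lemma locLip_force {ν : ℝ} {k : ℕ} (E : Exponents d ν k) (μ : ℝ) :
    LocLip (force (d := d) ν μ k) := by
  intro M
  obtain ⟨K, hK⟩ := lipschitzOnWith_nlProfile E M
  refine ⟨‖Complex.I * μ‖₊ * K, LipschitzOnWith.of_dist_le_mul fun x hx y hy ↦ ?_⟩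
  have := hK.dist_le_mul x hx y hy
  rw [dist_eq_norm, force, force, ← smul_sub, norm_smul, ← dist_eq_norm]
  push_cast
  rw [mul_assoc]
  gcongr

/-! ### Tempered distributions -/

/-- The bilinear pairing with a Schwartz function. -/
def pair (ψ : 𝓢(Space d, ℂ)) : L2 d →L[ℂ] ℂ := innerSL ℂ ((conjS ψ).toLp 2 volume)

lemma pair_eq_inner (ψ : 𝓢(Space d, ℂ)) (h : L2 d) :
    pair ψ h = inner ℂ ((conjS ψ).toLp 2 volume) h := rfl

lemma pair_apply (ψ : 𝓢(Space d, ℂ)) (h : L2 d) : pair ψ h = ∫ x, h x * ψ x := by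
  rw [pair_eq_inner, L2.inner_def]
  apply integral_congr_ae
  filter_upwards [(conjS ψ).coeFn_toLp 2 volume] with x hx
  rw [hx]; simp

lemma eq_zero_of_pair {h : L2 d} (hh : ∀ ψ, pair ψ h = 0) : h = 0 := by
  obtain ⟨u, hu⟩ := exists_seq_profile 0 h
  have h1 : Tendsto (fun n ↦ inner ℂ ((profile 0 (u n)).toLp 2 volume) h) atTop
      (𝓝 (inner ℂ h h)) := hu.inner tendsto_const_nhds
  have h2 : ∀ n, inner ℂ ((profile 0 (u n)).toLp 2 volume) h = 0 := by
    intro n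
    have := hh (conjS (profile 0 (u n)))
    rw [pair_eq_inner] at this
    convert this using 4
    ext x; simp
  simp only [h2] at h1
  exact inner_self_eq_zero.1 (tendsto_nhds_unique h1 tendsto_const_nhds)

lemma pair_fourier (f : L2 d) (φ : 𝓢(Space d, ℂ)) :
    pair φ (𝓕 f) = pair (𝓕 φ) f := by
  have h := congrArg (fun D ↦ D φ) (Lp.fourier_toTemperedDistribution_eq f)
  simp only [TemperedDistribution.fourier_apply, Lp.toTemperedDistribution_apply, smul_eq_mul] at h
  rw [pair_apply, pair_apply]
  simp only [mul_comm _ (φ _), mul_comm _ ((𝓕 φ) _)]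
  exact h.symm

/-- The test function corresponding to `φ` in the Fourier picture. -/
def testProfile (k : ℕ) (φ : 𝓢(Space d, ℂ)) : 𝓢(Space d, ℂ) :=
  SchwartzMap.smulLeftCLM ℂ (fun ξ ↦ (wt (-k) ξ : ℂ)) (𝓕⁻ φ)

lemma testProfile_apply (k : ℕ) (φ : 𝓢(Space d, ℂ)) (ξ : Space d) :
    testProfile k φ ξ = wt (-k) ξ * 𝓕⁻ φ ξ := by
  rw [testProfile, SchwartzMap.smulLeftCLM_apply_apply (hasTemperateGrowth_wt_complex _),
    smul_eq_mul]

lemma testProfile_surjective (k : ℕ) : Function.Surjective (testProfile (d := d) k) := by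
  intro g
  refine ⟨𝓕 (SchwartzMap.smulLeftCLM ℂ (fun ξ ↦ (wt k ξ : ℂ)) g), ?_⟩
  ext ξ
  rw [testProfile_apply, FourierTransform.fourierInv_fourier_eq,
    SchwartzMap.smulLeftCLM_apply_apply (hasTemperateGrowth_wt_complex _), smul_eq_mul, ← mul_assoc,
    ← Complex.ofReal_mul, wt_neg_mul]
  simp

lemma pair_ofProfile (k : ℕ) (h : L2 d) (φ : 𝓢(Space d, ℂ)) :
    pair φ (ofProfile k h) = pair (testProfile k φ) h := by
  have e : 𝓕 (𝓕⁻ φ) = φ := FourierTransform.fourier_fourierInv_eq φ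
  conv_lhs => rw [← e]
  rw [← pair_fourier, pair_apply, pair_apply]
  apply integral_congr_ae
  filter_upwards [fourier_ofProfile_coe k h] with ξ hξ
  rw [hξ, testProfile_apply]; ring

lemma laplacian_fourierInv (φ : 𝓢(Space d, ℂ)) (ξ : Space d) :
    𝓕⁻ (Δ φ) ξ = -((2 * Real.pi * ‖ξ‖) ^ 2 : ℝ) * 𝓕⁻ φ ξ := by
  have h := fourier_eq_fourierInv_neg (Δ φ) (-ξ)
  have h2 := fourier_eq_fourierInv_neg φ (-ξ)
  rw [neg_neg] at h h2
  have e : 𝓕 (Δ φ) = (-(2 * Real.pi) ^ 2 : ℝ) • SchwartzMap.smulLeftCLM ℂ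
      (fun x : Space d ↦ ‖x‖ ^ 2) (𝓕 φ) := by
    rw [SchwartzMap.laplacian_eq_fourierMultiplierCLM, SchwartzMap.fourierMultiplierCLM_apply,
      FourierTransform.fourier_smul, FourierTransform.fourier_fourierInv_eq]
  rw [← h, ← h2, e, smul_apply, SchwartzMap.smulLeftCLM_apply_apply
    (Function.hasTemperateGrowth_norm_sq (H := Space d)), Complex.real_smul, Complex.real_smul,
    norm_neg]
  push_cast; ring

lemma testProfile_laplacian (k : ℕ) (φ : 𝓢(Space d, ℂ)) :
    testProfile k (Δ (Δ φ)) = symbS (testProfile k φ) := by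
  ext ξ
  rw [symbS_apply, testProfile_apply, testProfile_apply, laplacian_fourierInv,
    laplacian_fourierInv, symb]
  push_cast; ring

/-! ### Distributional and mild solutions -/

lemma inner_flow (s : ℝ) (f g : L2 d) : inner ℂ (flow s f) (flow s g) = inner ℂ f g :=
  LinearIsometry.inner_map_map ⟨(mulL2 (phase s)).toLinearMap, norm_flow s⟩ f g

lemma inner_flow_right (s : ℝ) (f g : L2 d) : inner ℂ f (flow s g) = inner ℂ (flow (-s) f) g := by
  rw [← inner_flow s (flow (-s) f) g, isometryGroup_flow.apply_neg]

lemma conjS_symbS (ψ : 𝓢(Space d, ℂ)) : conjS (symbS ψ) = symbS (conjS ψ) := by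
  ext ξ; simp [symbS_apply]

lemma conjS_phaseS (s : ℝ) (ψ : 𝓢(Space d, ℂ)) : conjS (phaseS s ψ) = phaseS (-s) (conjS ψ) := by
  ext ξ; simp [phaseS_apply, conj_phase]

lemma symbS_phaseS (s : ℝ) (ψ : 𝓢(Space d, ℂ)) : symbS (phaseS s ψ) = phaseS s (symbS ψ) := by
  ext ξ; simp only [symbS_apply, phaseS_apply]; ring

lemma pair_flow (s : ℝ) (ψ : 𝓢(Space d, ℂ)) (h : L2 d) :
    pair ψ (flow s h) = pair (phaseS s ψ) h := by
  rw [pair_eq_inner, pair_eq_inner, inner_flow_right, flow_toLp, conjS_phaseS]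

/-- The equation in the sense of distributions, in the Fourier picture. -/
def Weak (ν μ : ℝ) (k : ℕ) (T : ℝ) (h : ℝ → L2 d) : Prop :=
  ∀ ψ : 𝓢(Space d, ℂ), ∀ t ∈ Set.Icc 0 T, HasDerivWithinAt (fun s ↦ pair ψ (h s))
    (Complex.I * (pair (symbS ψ) (h t) + μ * pair ψ (nlProfile ν k (h t)))) (Set.Icc 0 T) t

lemma Mild.weak {ν μ : ℝ} {k : ℕ} {T : ℝ} {h : ℝ → L2 d} (hm : Mild flow (force ν μ k) 1 T h) :
    Weak ν μ k T h := by
  intro ψ t ht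
  have h1 := hm t ht
  simp only [one_mul] at h1
  have h2 : HasDerivAt (fun s ↦ flow (-s) ((conjS ψ).toLp 2 volume))
      (-flow (-t) (Complex.I • (symbS (conjS ψ)).toLp 2 volume)) t := by
    refine ((hasDerivAt_flow_toLp (conjS ψ) (-t)).scomp t (hasDerivAt_neg t)).congr_deriv ?_
    rw [neg_smul, one_smul]
  have h3 := h2.hasDerivWithinAt.inner ℂ h1
  refine HasDerivWithinAt.congr_deriv (h3.congr (fun s _ ↦ ?_) ?_) ?_
  · rw [inner_flow, pair_eq_inner]
  · rw [inner_flow, pair_eq_inner]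
  · rw [← map_neg, inner_flow, inner_flow, force, inner_smul_right, inner_neg_left, inner_smul_left,
      pair_eq_inner, pair_eq_inner, conjS_symbS, Complex.conj_I]
    ring

lemma Weak.mild {ν μ : ℝ} {k : ℕ} (E : Exponents d ν k) {T : ℝ} {h : ℝ → L2 d}
    (hT : 0 ≤ T) (hc : ContinuousOn h (Set.Icc 0 T)) (hw : Weak ν μ k T h) :
    Mild flow (force ν μ k) 1 T h := by
  have hU := isometryGroup_flow (d := d)
  set V : ℝ → L2 d := fun t ↦ flow (-t) (force ν μ k (h t)) with hV
  have hVc : ContinuousOn V (Set.Icc 0 T) :=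
    hU.continuousOn_comp (by fun_prop) ((locLip_force E μ).continuous.comp_continuousOn hc)
  have hwc : ContinuousOn (fun t ↦ flow (-t) (h t)) (Set.Icc 0 T) :=
    hU.continuousOn_comp (by fun_prop) hc
  have key : ∀ ψ : 𝓢(Space d, ℂ), ∀ t ∈ Set.Icc 0 T,
      HasDerivWithinAt (fun s ↦ pair ψ (flow (-s) (h s))) (pair ψ (V t)) (Set.Icc 0 T) t := by
    intro ψ t ht
    set a : ℝ → L2 d := fun s ↦ flow s ((conjS ψ).toLp 2 volume)
    have e : ∀ s, pair ψ (flow (-s) (h s)) =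
        inner ℂ (a s - a t) (h s) + pair (phaseS (-t) ψ) (h s) := by
      intro s
      rw [pair_eq_inner, inner_flow_right, neg_neg, pair_eq_inner, conjS_phaseS, neg_neg,
        ← flow_toLp, ← inner_add_left, sub_add_cancel]
    have ha := hasDerivAt_flow_toLp (conjS ψ) t
    have h1 : HasDerivWithinAt (fun s ↦ inner ℂ (a s - a t) (h s))
        (inner ℂ (flow t (Complex.I • (symbS (conjS ψ)).toLp 2 volume)) (h t)) (Set.Icc 0 T) t := by
      rw [hasDerivWithinAt_iff_tendsto_slope]
      have h2 := (hasDerivWithinAt_iff_tendsto_slope.1 (ha.hasDerivWithinAt (s := Set.Icc 0 T))).inner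
        (𝕜 := ℂ) ((hc t ht).mono_left (nhdsWithin_mono t Set.sdiff_subset))
      refine h2.congr fun s ↦ ?_
      simp only [slope, vsub_eq_sub, sub_self, inner_zero_left, sub_zero]
      rw [inner_smul_left_eq_smul]
    have h2 := hw (phaseS (-t) ψ) t ht
    refine HasDerivWithinAt.congr_deriv ((h1.add h2).congr (fun s _ ↦ e s) (e t)) ?_
    rw [hV]
    simp only
    rw [pair_flow, force, (pair _).map_smul, flow_smul, inner_smul_left, symbS_phaseS, flow_toLp]
    have : inner ℂ ((phaseS t (symbS (conjS ψ))).toLp 2 volume) (h t) =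
        pair (phaseS (-t) (symbS ψ)) (h t) := by
      rw [pair_eq_inner, conjS_phaseS, neg_neg, conjS_symbS]
    rw [this, Complex.conj_I, smul_eq_mul]; ring
  set V' : ℝ → L2 d := fun t ↦ V (Set.projIcc 0 T hT t)
  have hV'c : Continuous V' := by
    have := continuousOn_iff_continuous_domRestrict.1 hVc
    exact this.comp continuous_projIcc
  have hV'eq : ∀ t ∈ Set.Icc 0 T, V' t = V t := by
    intro t ht; simp only [V']; rw [Set.projIcc_of_mem hT ht]
  set I : ℝ → L2 d := fun t ↦ flow (-0) (h 0) + ∫ s in (0 : ℝ)..t, V' s with hI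
  have hId : ∀ t, HasDerivAt I (V' t) t := fun t ↦
    ((hV'c.integral_hasStrictDerivAt 0 t).hasDerivAt).const_add _
  have heq : ∀ t ∈ Set.Icc 0 T, flow (-t) (h t) = I t := by
    intro t ht
    rw [← sub_eq_zero]
    apply eq_zero_of_pair
    intro ψ
    have hder : ∀ s ∈ Set.Icc 0 T, HasDerivWithinAt (fun s ↦ pair ψ (flow (-s) (h s) - I s)) 0
        (Set.Icc 0 T) s := by
      intro s hs
      have h1 := (key ψ s hs).sub
        (((pair ψ).restrictScalars ℝ).hasFDerivAt.comp_hasDerivWithinAt s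
          (hId s).hasDerivWithinAt)
      rw [hV'eq s hs] at h1
      refine HasDerivWithinAt.congr_deriv (h1.congr (fun r _ ↦ ?_) ?_) ?_
      · simp [map_sub]
      · simp [map_sub]
      · simp
    have := constant_of_has_deriv_right_zero (fun s hs ↦ (hder s hs).continuousWithinAt)
      (fun s hs ↦ hasDerivWithinAt_Ici_of_Icc hs (hder s ⟨hs.1, hs.2.le⟩)) t ht
    rw [this]
    simp [hI]
  intro t ht
  simp only [one_mul]
  have := (hId t).hasDerivWithinAt (s := Set.Icc 0 T)
  rw [hV'eq t ht] at this
  exact this.congr heq (heq t ht)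

lemma integral_nl_ofProfile {ν : ℝ} {k : ℕ} (E : Exponents d ν k) (h : L2 d) (φ : 𝓢(Space d, ℂ)) :
    ∫ x, ((‖ofProfile k h x‖ ^ (ν - 1) : ℝ) : ℂ) * ofProfile k h x * φ x =
      pair (testProfile k φ) (nlProfile ν k h) := by
  rw [← pair_ofProfile, pair_apply]
  apply integral_congr_ae
  filter_upwards [ofProfile_nlProfile E h] with x hx
  rw [hx, nl]

/-- Mild solutions solve the equation in the sense of distributions. -/
theorem Mild.isSolution {ν μ : ℝ} {k : ℕ} (E : Exponents d ν k) {T : ℝ} {h : ℝ → L2 d}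
    (hm : Mild flow (force ν μ k) 1 T h) {u₀ : 𝓢(Space d, ℂ)}
    (h0 : h 0 = (profile k u₀).toLp 2 volume) :
    IsSolution ν μ k T u₀ (fun t ↦ ofProfile k (h t)) where
  mem_sobolev t _ := by rw [sobolevNorm_ofProfile_self]; exact enorm_lt_top
  continuous_sobolev t ht := by
    have hc := (hm.continuousOn isometryGroup_flow) t ht
    simp only [← map_sub, sobolevNorm_ofProfile_self]
    have := (hc.sub (continuousWithinAt_const (b := h t))).enorm
    simpa [ContinuousWithinAt] using this
  initial := by rw [h0, ofProfile_profile]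
  equation φ t ht := by
    simp only [← pair_apply, integral_nl_ofProfile E, pair_ofProfile, testProfile_laplacian]
    exact hm.weak (testProfile k φ) t ht

/-- Solutions in the sense of distributions are mild solutions. -/
theorem IsSolution.exists_mild {ν μ : ℝ} {k : ℕ} (E : Exponents d ν k) {T : ℝ} (hT : 0 ≤ T)
    {u₀ : 𝓢(Space d, ℂ)} {u : ℝ → L2 d} (hu : IsSolution ν μ k T u₀ u) :
    ∃ h : ℝ → L2 d, Mild flow (force ν μ k) 1 T h ∧ h 0 = (profile k u₀).toLp 2 volume ∧
      ∀ t ∈ Set.Icc 0 T, u t = ofProfile k (h t) := by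
  have hex : ∀ t, ∃ g, t ∈ Set.Icc 0 T → u t = ofProfile k g := by
    intro t
    by_cases ht : t ∈ Set.Icc 0 T
    · obtain ⟨g, hg⟩ := exists_ofProfile_eq (hu.mem_sobolev t ht)
      exact ⟨g, fun _ ↦ hg.symm⟩
    · exact ⟨0, fun h ↦ absurd h ht⟩
  choose h hh using hex
  refine ⟨h, Weak.mild E hT (fun t ht ↦ ?_) (fun ψ t ht ↦ ?_), ?_, hh⟩
  · have h1 := hu.continuous_sobolev t ht
    rw [ContinuousWithinAt, tendsto_iff_norm_sub_tendsto_zero]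
    have h2 : Tendsto (fun s ↦ ‖h s - h t‖ₑ) (𝓝[Set.Icc 0 T] t) (𝓝 0) := by
      refine h1.congr' ?_
      filter_upwards [self_mem_nhdsWithin] with s hs
      rw [hh s hs, hh t ht, ← map_sub, sobolevNorm_ofProfile_self]
    simpa [Function.comp_def] using (ENNReal.tendsto_toReal ENNReal.zero_ne_top).comp h2
  · obtain ⟨φ, rfl⟩ := testProfile_surjective k ψ
    have h1 := hu.equation φ t ht
    have h2 : HasDerivWithinAt (fun s ↦ ∫ x, ofProfile k (h s) x * φ x)
        (Complex.I * ((∫ x, ofProfile k (h t) x * (Δ (Δ φ)) x) +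
        (μ : ℂ) * ∫ x, ((‖ofProfile k (h t) x‖ ^ (ν - 1) : ℝ) : ℂ) * ofProfile k (h t) x * φ x))
        (Set.Icc 0 T) t := by
      rw [← hh t ht]
      exact h1.congr (fun s hs ↦ by rw [hh s hs]) (by rw [hh t ht])
    simp only [← pair_apply, integral_nl_ofProfile E, pair_ofProfile, testProfile_laplacian] at h2
    exact h2
  · apply ofProfile_injective k
    rw [← hh 0 ⟨le_rfl, hT⟩, hu.initial, ofProfile_profile]

/-! ### Dilations -/

lemma map_smul_volume {b : ℝ} (hb : 0 < b) :
    (volume : Measure (Space d)).map (b • ·) = ENNReal.ofReal ((b ^ d)⁻¹) • volume := by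
  have := Measure.map_addHaar_smul (volume : Measure (Space d)) hb.ne'
  simpa [abs_of_pos hb] using this

lemma quasiMeasurePreserving_smul_volume {b : ℝ} (hb : 0 < b) :
    Measure.QuasiMeasurePreserving (b • · : Space d → Space d) volume volume :=
  ⟨by fun_prop, by rw [map_smul_volume hb]; exact Measure.smul_absolutelyContinuous⟩

lemma lintegral_comp_smul {b : ℝ} (hb : 0 < b) (f : Space d → ℝ≥0∞) (hf : AEMeasurable f) :
    ∫⁻ x, f (b • x) = ENNReal.ofReal ((b ^ d)⁻¹) * ∫⁻ x, f x := by
  rw [← lintegral_map' (f := f) (g := (b • ·)), map_smul_volume hb, lintegral_smul_measure,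
    smul_eq_mul]
  · rw [map_smul_volume hb]; exact hf.smul_measure _
  · fun_prop

lemma eLpNorm_two_sq (f : Space d → ℂ) : eLpNorm f 2 volume ^ 2 = ∫⁻ x, ‖f x‖ₑ ^ 2 := by
  rw [eLpNorm_eq_lintegral_rpow_enorm_toReal (by norm_num) (by norm_num)]
  simp only [ENNReal.toReal_ofNat, ENNReal.rpow_ofNat, one_div]
  rw [← ENNReal.rpow_ofNat, ← ENNReal.rpow_mul]
  norm_num

lemma eLpNorm_comp_smul {b : ℝ} (hb : 0 < b) (f : L2 d) :
    eLpNorm (fun x ↦ f (b • x)) 2 volume ^ 2 = ENNReal.ofReal ((b ^ d)⁻¹) * ‖f‖ₑ ^ 2 := by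
  rw [eLpNorm_two_sq, Lp.enorm_def, eLpNorm_two_sq]
  exact lintegral_comp_smul hb (fun x ↦ ‖f x‖ₑ ^ 2) ((Lp.aestronglyMeasurable f).enorm.pow_const 2)

lemma memLp_comp_smul {b : ℝ} (hb : 0 < b) (f : L2 d) :
    MemLp (fun x ↦ f (b • x)) 2 volume := by
  refine ⟨(Lp.aestronglyMeasurable f).comp_quasiMeasurePreserving
    (quasiMeasurePreserving_smul_volume hb), ?_⟩
  have h := eLpNorm_comp_smul hb f
  by_contra hh
  rw [not_lt, top_le_iff] at hh
  rw [hh] at h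
  have : ENNReal.ofReal ((b ^ d)⁻¹) * ‖f‖ₑ ^ 2 < ∞ :=
    ENNReal.mul_lt_top ENNReal.ofReal_lt_top (ENNReal.pow_lt_top enorm_lt_top)
  rw [← h] at this
  simp at this

/-- Dilation of a square integrable function: `f ↦ f(b ·)`. -/
def dilL2 {b : ℝ} (hb : 0 < b) : L2 d →L[ℂ] L2 d :=
  LinearMap.mkContinuous
    { toFun := fun f ↦ (memLp_comp_smul hb f).toLp _
      map_add' := fun f g ↦ by
        apply Lp.ext
        filter_upwards [(memLp_comp_smul hb (f + g)).coeFn_toLp, (memLp_comp_smul hb f).coeFn_toLp,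
          (memLp_comp_smul hb g).coeFn_toLp, Lp.coeFn_add ((memLp_comp_smul hb f).toLp _)
          ((memLp_comp_smul hb g).toLp _),
          (quasiMeasurePreserving_smul_volume hb).ae (Lp.coeFn_add f g)] with x h1 h2 h3 h4 h5
        rw [h1, h4, Pi.add_apply, h2, h3, h5, Pi.add_apply]
      map_smul' := fun c f ↦ by
        apply Lp.ext
        filter_upwards [(memLp_comp_smul hb (c • f)).coeFn_toLp, (memLp_comp_smul hb f).coeFn_toLp,
          Lp.coeFn_smul c ((memLp_comp_smul hb f).toLp _),
          (quasiMeasurePreserving_smul_volume hb).ae (Lp.coeFn_smul c f)] with x h1 h2 h3 h4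
        rw [h1, RingHom.id_apply, h3, Pi.smul_apply, h2, h4, Pi.smul_apply] }
    (Real.sqrt ((b ^ d)⁻¹)) (fun f ↦ by
      change ‖(memLp_comp_smul hb f).toLp _‖ ≤ _
      have h := eLpNorm_comp_smul hb f
      rw [← Lp.enorm_toLp (memLp_comp_smul hb f), ← ofReal_norm, ← ofReal_norm,
        ← ENNReal.ofReal_pow (norm_nonneg _), ← ENNReal.ofReal_pow (norm_nonneg _),
        ← ENNReal.ofReal_mul (by positivity),
        ENNReal.ofReal_eq_ofReal_iff (by positivity) (by positivity)] at h
      rw [← Real.sqrt_sq (norm_nonneg f), ← Real.sqrt_mul (by positivity), ← h,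
        Real.sqrt_sq (norm_nonneg _)])

lemma dilL2_coe {b : ℝ} (hb : 0 < b) (f : L2 d) :
    dilL2 hb f =ᵐ[volume] fun x ↦ f (b • x) :=
  (memLp_comp_smul hb f).coeFn_toLp

lemma norm_dilL2_sq {b : ℝ} (hb : 0 < b) (f : L2 d) : ‖dilL2 hb f‖ ^ 2 = (b ^ d)⁻¹ * ‖f‖ ^ 2 := by
  have h := eLpNorm_comp_smul hb f
  rw [← Lp.enorm_toLp (memLp_comp_smul hb f), ← ofReal_norm, ← ofReal_norm,
    ← ENNReal.ofReal_pow (norm_nonneg _), ← ENNReal.ofReal_pow (norm_nonneg _),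
    ← ENNReal.ofReal_mul (by positivity),
    ENNReal.ofReal_eq_ofReal_iff (by positivity) (by positivity)] at h
  exact h

/-- Dilation of a Schwartz function: `f ↦ f(b ·)`. -/
def dilS {b : ℝ} (hb : 0 < b) (f : 𝓢(Space d, ℂ)) : 𝓢(Space d, ℂ) :=
  SchwartzMap.compCLMOfContinuousLinearEquiv ℂ
    (ContinuousLinearEquiv.smulLeft (R₁ := ℝ) (M₁ := Space d) (Units.mk0 b hb.ne')) f

lemma dilS_apply {b : ℝ} (hb : 0 < b) (f : 𝓢(Space d, ℂ)) (x : Space d) :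
    dilS hb f x = f (b • x) := rfl

lemma dilL2_toLp {b : ℝ} (hb : 0 < b) (f : 𝓢(Space d, ℂ)) :
    dilL2 hb (f.toLp 2 volume) = (dilS hb f).toLp 2 volume := by
  apply Lp.ext
  filter_upwards [dilL2_coe hb (f.toLp 2 volume), (dilS hb f).coeFn_toLp 2 volume,
    (quasiMeasurePreserving_smul_volume hb).ae (f.coeFn_toLp 2 volume)] with x h1 h2 h3
  rw [h1, h2, h3, dilS_apply]

lemma fourier_dilS {b : ℝ} (hb : 0 < b) (f : 𝓢(Space d, ℂ)) (ξ : Space d) :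
    𝓕 (dilS hb f) ξ = ((b ^ d)⁻¹ : ℝ) * 𝓕 f (b⁻¹ • ξ) := by
  rw [SchwartzMap.fourier_coe, SchwartzMap.fourier_coe, Real.fourier_eq, Real.fourier_eq]
  have := Measure.integral_comp_smul (volume : Measure (Space d))
    (fun v ↦ Real.fourierChar (-inner ℝ v (b⁻¹ • ξ)) • f v) b
  rw [finrank_euclideanSpace, Fintype.card_fin, abs_of_pos (by positivity), Complex.real_smul] at this
  rw [← this]
  congr 1
  ext v
  rw [dilS_apply]
  congr 3
  rw [inner_smul_left, inner_smul_right]; simp; field_simp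

lemma fourier_dilL2 {b : ℝ} (hb : 0 < b) (f : L2 d) :
    (𝓕 (dilL2 hb f) : L2 d) = ((b ^ d)⁻¹ : ℝ) • dilL2 (inv_pos.2 hb) (𝓕 f) := by
  obtain ⟨u, hu⟩ := exists_seq_profile 0 f
  have c1 : Continuous fun f : L2 d ↦ (𝓕 (dilL2 hb f) : L2 d) :=
    (Lp.fourierTransformₗᵢ (Space d) ℂ).continuous.comp (dilL2 hb).continuous
  have c2 : Continuous fun f : L2 d ↦ ((b ^ d)⁻¹ : ℝ) • dilL2 (inv_pos.2 hb) (𝓕 f : L2 d) :=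
    (continuous_const_smul ((b ^ d)⁻¹ : ℝ)).comp
      ((dilL2 _).continuous.comp (Lp.fourierTransformₗᵢ (Space d) ℂ).continuous)
  refine tendsto_nhds_unique ((c1.tendsto f).comp hu) (((c2.tendsto f).comp hu).congr fun n ↦ ?_)
  simp only [Function.comp_apply]
  rw [dilL2_toLp, SchwartzMap.toLp_fourier_eq, SchwartzMap.toLp_fourier_eq, dilL2_toLp]
  apply Lp.ext
  filter_upwards [(𝓕 (dilS hb (profile 0 (u n)))).coeFn_toLp 2 volume,
    Lp.coeFn_smul ((b ^ d)⁻¹ : ℝ) ((dilS (inv_pos.2 hb) (𝓕 (profile 0 (u n)))).toLp 2 volume),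
    (dilS (inv_pos.2 hb) (𝓕 (profile 0 (u n)))).coeFn_toLp 2 volume] with ξ h1 h2 h3
  rw [h1, h2, Pi.smul_apply, h3, fourier_dilS, dilS_apply, Complex.real_smul]

/-- Sobolev norms of a dilated function. -/
lemma sobolevNorm_dilL2_sq {b : ℝ} (hb : 0 < b) (s : ℝ) (f : L2 d) :
    sobolevNorm s (dilL2 hb f) ^ 2 = ENNReal.ofReal ((b ^ d)⁻¹) *
      ∫⁻ ξ, ENNReal.ofReal (wt s (b • ξ) ^ 2) * ‖(𝓕 f : L2 d) ξ‖ₑ ^ 2 := by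
  have hb' := inv_pos.2 hb
  have e : sobolevNorm s (dilL2 hb f) ^ 2 = ∫⁻ ξ, ENNReal.ofReal ((b ^ d)⁻¹ ^ 2) *
      ((fun η ↦ ENNReal.ofReal (wt s (b • η) ^ 2) * ‖(𝓕 f : L2 d) η‖ₑ ^ 2) (b⁻¹ • ξ)) := by
    rw [sobolevNorm, eLpNorm_two_sq, fourier_dilL2]
    apply lintegral_congr_ae
    filter_upwards [Lp.coeFn_smul ((b ^ d)⁻¹ : ℝ) (dilL2 hb' (𝓕 f : L2 d)),
      dilL2_coe hb' (𝓕 f : L2 d)] with ξ h1 h2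
    simp only [smul_smul, mul_inv_cancel₀ hb.ne', one_smul]
    change ‖((wt s ξ : ℝ) : ℂ) * _‖ₑ ^ 2 = _
    rw [h1, Pi.smul_apply, h2, enorm_mul, enorm_smul, mul_pow, mul_pow,
      ← ofReal_norm ((wt s ξ : ℝ) : ℂ), Complex.norm_real, ← ofReal_norm ((b ^ d)⁻¹ : ℝ),
      ← ENNReal.ofReal_pow (norm_nonneg _), ← ENNReal.ofReal_pow (norm_nonneg _),
      Real.norm_of_nonneg (wt_nonneg _ _), Real.norm_of_nonneg (by positivity)]
    ring
  rw [e, lintegral_const_mul' _ _ ENNReal.ofReal_ne_top, lintegral_comp_smul hb'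
    (fun η ↦ ENNReal.ofReal (wt s (b • η) ^ 2) * ‖(𝓕 f : L2 d) η‖ₑ ^ 2), ← mul_assoc,
    ← ENNReal.ofReal_mul (by positivity)]
  · congr 2
    rw [inv_pow, inv_pow, inv_inv]; field_simp
  · refine AEMeasurable.mul ?_ ((Lp.aestronglyMeasurable _).enorm.pow_const 2)
    have := continuous_wt (d := d) s
    exact (ENNReal.continuous_ofReal.comp ((this.comp (continuous_const_smul b)).pow 2)).aemeasurable

lemma wt_le_wt_smul {b : ℝ} (hb : 0 < b) (k : ℕ) (ξ : Space d) :
    wt k ξ ≤ (max 1 b) ^ k * wt k (b⁻¹ • ξ) := by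
  have h1 : (max 1 b) ^ k = ((max 1 b) ^ 2) ^ ((k : ℝ) / 2) := by
    rw [← Real.rpow_natCast, ← Real.rpow_natCast, ← Real.rpow_mul (by positivity)]
    congr 1; push_cast; ring
  have hm1 : 1 ≤ max 1 b := le_max_left _ _
  rw [h1, wt, wt, ← Real.mul_rpow (by positivity) (by positivity)]
  apply Real.rpow_le_rpow (by positivity) _ (by positivity)
  rw [norm_smul, Real.norm_of_nonneg (by positivity)]
  have h2 : (max 1 b * b⁻¹) ^ 2 ≥ 1 := by
    apply one_le_pow₀
    rw [← div_eq_mul_inv, le_div_iff₀ hb, one_mul]; exact le_max_right _ _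
  have h3 : 1 ≤ (max 1 b) ^ 2 := one_le_pow₀ hm1
  calc 1 + (2 * Real.pi * ‖ξ‖) ^ 2 ≤ (max 1 b) ^ 2 + (max 1 b * b⁻¹) ^ 2 * (2 * Real.pi * ‖ξ‖) ^ 2 := by
        nlinarith [sq_nonneg (2 * Real.pi * ‖ξ‖)]
    _ = _ := by ring

/-- The multiplier that appears in the dilation of a profile. -/
def dilWt (k : ℕ) {b : ℝ} (hb : 0 < b) : Space d →ᵇ ℂ :=
  BoundedContinuousFunction.ofNormedAddCommGroup
    (fun ξ ↦ (((b ^ d)⁻¹ * (wt k ξ * wt (-k) (b⁻¹ • ξ)) : ℝ) : ℂ))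
    (Complex.continuous_ofReal.comp (continuous_const.mul
      ((continuous_wt _).mul ((continuous_wt _).comp (continuous_const_smul _)))))
    ((b ^ d)⁻¹ * (max 1 b) ^ k) (fun ξ ↦ by
      rw [Complex.norm_real, Real.norm_of_nonneg (mul_nonneg (by positivity)
        (mul_nonneg (wt_nonneg _ _) (wt_nonneg _ _)))]
      gcongr
      calc _ ≤ (max 1 b) ^ k * wt k (b⁻¹ • ξ) * wt (-k) (b⁻¹ • ξ) :=
            mul_le_mul_of_nonneg_right (wt_le_wt_smul hb k ξ) (wt_nonneg _ _)
        _ = _ := by rw [mul_assoc, wt_mul_neg, mul_one])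

/-- Dilation in the Fourier picture. -/
def dilProfile (k : ℕ) {b : ℝ} (hb : 0 < b) : L2 d →L[ℂ] L2 d :=
  mulL2 (dilWt k hb) ∘L dilL2 (inv_pos.2 hb)

lemma dilProfile_coe (k : ℕ) {b : ℝ} (hb : 0 < b) (h : L2 d) :
    dilProfile k hb h =ᵐ[volume] fun ξ ↦
      (((b ^ d)⁻¹ * (wt k ξ * wt (-k) (b⁻¹ • ξ)) : ℝ) : ℂ) * h (b⁻¹ • ξ) := by
  filter_upwards [mulL2_coe (dilWt k hb) (dilL2 (inv_pos.2 hb) h), dilL2_coe (inv_pos.2 hb) h]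
    with ξ h1 h2
  rw [dilProfile, ContinuousLinearMap.comp_apply, h1, h2]; rfl

lemma ofProfile_dilProfile (k : ℕ) {b : ℝ} (hb : 0 < b) (h : L2 d) :
    ofProfile k (dilProfile k hb h) = dilL2 hb (ofProfile k h) := by
  apply (Lp.fourierTransformₗᵢ (Space d) ℂ).injective
  change (𝓕 (ofProfile k _) : L2 d) = 𝓕 (dilL2 hb _)
  rw [fourier_dilL2]
  apply Lp.ext
  filter_upwards [fourier_ofProfile_coe k (dilProfile k hb h), dilProfile_coe k hb h,
    Lp.coeFn_smul ((b ^ d)⁻¹ : ℝ) (dilL2 (inv_pos.2 hb) (𝓕 (ofProfile k h) : L2 d)),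
    dilL2_coe (inv_pos.2 hb) (𝓕 (ofProfile k h) : L2 d),
    (quasiMeasurePreserving_smul_volume (inv_pos.2 hb)).ae (fourier_ofProfile_coe k h)]
    with ξ h1 h2 h3 h4 h5
  rw [h1, h2, h3, Pi.smul_apply, h4, h5, Complex.real_smul]
  have : ((wt (-k) ξ : ℝ) : ℂ) * (wt k ξ : ℝ) = 1 := by
    rw [← Complex.ofReal_mul, wt_neg_mul]; simp
  push_cast
  linear_combination (((b : ℂ) ^ d)⁻¹ * (wt (-k) (b⁻¹ • ξ) : ℝ) * h (b⁻¹ • ξ)) * this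

lemma symb_smul (b : ℝ) (ξ : Space d) : symb (b • ξ) = b ^ 4 * symb ξ := by
  rw [symb, symb, norm_smul, Real.norm_eq_abs]
  have : |b| ^ 4 = b ^ 4 := by rw [pow_abs, abs_of_nonneg (by positivity)]
  rw [← this]; ring

lemma flow_dilProfile (k : ℕ) {b : ℝ} (hb : 0 < b) (s : ℝ) (h : L2 d) :
    flow s (dilProfile k hb h) = dilProfile k hb (flow (b ^ 4 * s) h) := by
  apply Lp.ext
  rw [flow_apply, flow_apply]
  filter_upwards [mulL2_coe (phase s) (dilProfile k hb h), dilProfile_coe k hb h,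
    dilProfile_coe k hb (mulL2 (phase (b ^ 4 * s)) h),
    (quasiMeasurePreserving_smul_volume (inv_pos.2 hb)).ae (mulL2_coe (phase (b ^ 4 * s)) h)]
    with ξ h1 h2 h3 h4
  rw [h1, h2, h3, h4, phase_apply, phase_apply, symb_smul]
  have : b ^ 4 * s * (b⁻¹ ^ 4 * symb ξ) = s * symb ξ := by field_simp
  rw [this]; ring

lemma nlProfile_smul_dilProfile {ν : ℝ} {k : ℕ} (E : Exponents d ν k) {A b : ℝ} (hA : 0 ≤ A)
    (hb : 0 < b) (h : L2 d) :
    nlProfile ν k (A • dilProfile k hb h) = (A ^ ν) • dilProfile k hb (nlProfile ν k h) := by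
  apply ofProfile_injective k
  have sm : ∀ (r : ℝ) (x : L2 d), ofProfile k (r • x) = r • ofProfile k x :=
    fun r x ↦ ((ofProfile k).restrictScalars ℝ).map_smul r x
  apply Lp.ext
  refine (ofProfile_nlProfile E _).trans ?_
  rw [sm, sm, ofProfile_dilProfile, ofProfile_dilProfile]
  filter_upwards [Lp.coeFn_smul A (dilL2 hb (ofProfile k h)), dilL2_coe hb (ofProfile k h),
    Lp.coeFn_smul (A ^ ν) (dilL2 hb (ofProfile k (nlProfile ν k h))),
    dilL2_coe hb (ofProfile k (nlProfile ν k h)),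
    (quasiMeasurePreserving_smul_volume hb).ae (ofProfile_nlProfile E h)] with x h1 h2 h3 h4 h5
  rw [h1, Pi.smul_apply, h2, h3, Pi.smul_apply, h4, h5, Complex.real_smul, Complex.real_smul,
    nl_smul E.one_lt hA]

/-- The scaling symmetry: if `φ` solves the equation with dispersion `κ = b⁴ / A^{ν-1}`, then
`A φ(A^{ν-1}t, b x)` solves the equation. -/
theorem Mild.scale {ν μ : ℝ} {k : ℕ} (E : Exponents d ν k) {A b κ T : ℝ} (hA : 0 < A) (hb : 0 < b)
    (hκ : κ * A ^ (ν - 1) = b ^ 4) {h : ℝ → L2 d} (hm : Mild flow (force ν μ k) κ T h) :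
    Mild flow (force ν μ k) 1 (T / A ^ (ν - 1))
      (fun t ↦ A • dilProfile k hb (h (A ^ (ν - 1) * t))) := by
  set B := A ^ (ν - 1)
  have hB : 0 < B := Real.rpow_pos_of_pos hA _
  intro t ht
  have hmaps : Set.MapsTo (fun s ↦ B * s) (Set.Icc 0 (T / B)) (Set.Icc 0 T) := by
    intro s hs
    refine ⟨mul_nonneg hB.le hs.1, ?_⟩
    have := hs.2
    rw [le_div_iff₀ hB] at this
    linarith
  have h1 := (hm (B * t) (hmaps ht)).scomp (h := fun s ↦ B * s) (h' := B)
    (s := Set.Icc 0 (T / B)) t (by simpa using (hasDerivWithinAt_id t (Set.Icc 0 (T / B))).const_mul B)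
    hmaps
  have h2 := ((dilProfile k hb).restrictScalars ℝ).hasFDerivAt.comp_hasDerivWithinAt t h1
  have h3 := h2.const_smul A
  have e : ∀ (s : ℝ) (x : L2 d), flow (-(1 * s)) (A • dilProfile k hb x) =
      A • dilProfile k hb (flow (-(κ * (B * s))) x) := by
    intro s x
    rw [map_smul, flow_dilProfile]
    congr 3
    rw [← mul_assoc, hκ]; ring_nf
  have sm : ∀ (r : ℝ) (x : L2 d), dilProfile k hb (r • x) = r • dilProfile k hb x :=
    fun r x ↦ ((dilProfile k hb).restrictScalars ℝ).map_smul r x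
  refine HasDerivWithinAt.congr_deriv (h3.congr (fun s _ ↦ ?_) ?_) ?_
  · rw [e]; rfl
  · rw [e]; rfl
  · have hAν : A ^ ν = A * B := by
      rw [show ν = 1 + (ν - 1) by ring, Real.rpow_add hA, Real.rpow_one]
    have e2 : force ν μ k (A • dilProfile k hb (h (B * t))) =
        A • dilProfile k hb (B • force ν μ k (h (B * t))) := by
      rw [force, nlProfile_smul_dilProfile E hA.le hb, sm, force, (dilProfile k hb).map_smul, hAν,
        smul_comm (Complex.I * (μ : ℂ)) (A * B), mul_smul A B]
    change A • dilProfile k hb (B • _) = flow _ (force ν μ k (A • dilProfile k hb (h (B * t))))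
    rw [e2, e, map_smul (flow _)]

/-! ### Complex conjugation -/

/-- Complex conjugation in the Fourier picture. -/
def conjProfile : L2 d →L[ℝ] L2 d :=
  ((Complex.conjCLE : ℂ →L[ℝ] ℂ).compLpL 2 volume) ∘L
    (Lp.compMeasurePreservingₗᵢ ℝ Neg.neg
      (Measure.measurePreserving_neg (volume : Measure (Space d)))).toContinuousLinearMap

lemma conjProfile_coe (h : L2 d) : conjProfile h =ᵐ[volume] fun ξ ↦ conj (h (-ξ)) := by
  filter_upwards [(Complex.conjCLE : ℂ →L[ℝ] ℂ).coeFn_compLpL (p := 2) (μ := volume)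
    (Lp.compMeasurePreserving Neg.neg (Measure.measurePreserving_neg (volume : Measure (Space d))) h),
    Lp.coeFn_compMeasurePreserving h (Measure.measurePreserving_neg (volume : Measure (Space d)))]
    with ξ h1 h2
  exact h1.trans (by rw [h2]; rfl)

lemma conjProfile_profile (k : ℕ) (f : 𝓢(Space d, ℂ)) :
    conjProfile ((profile k f).toLp 2 volume) = (profile k (conjS f)).toLp 2 volume := by
  apply Lp.ext
  filter_upwards [conjProfile_coe ((profile k f).toLp 2 volume),
    (profile k (conjS f)).coeFn_toLp 2 volume,
    (Measure.measurePreserving_neg (volume : Measure (Space d))).quasiMeasurePreserving.ae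
      ((profile k f).coeFn_toLp 2 volume)] with ξ h1 h2 h3
  rw [h1, h2, h3, profile_apply, profile_apply, fourier_conjS]
  simp

lemma conjProfile_conjProfile (h : L2 d) : conjProfile (conjProfile h) = h := by
  apply Lp.ext
  filter_upwards [conjProfile_coe (conjProfile h),
    (Measure.measurePreserving_neg (volume : Measure (Space d))).quasiMeasurePreserving.ae
      (conjProfile_coe h)] with ξ h1 h2
  rw [h1, h2]; simp

lemma ofProfile_conjProfile (k : ℕ) (h : L2 d) :
    ofProfile k (conjProfile h) =ᵐ[volume] fun x ↦ conj (ofProfile k h x) := by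
  have e : ofProfile k (conjProfile h) =
      (Complex.conjCLE : ℂ →L[ℝ] ℂ).compLpL 2 volume (ofProfile k h) := by
    obtain ⟨u, hu⟩ := exists_seq_profile k h
    have c1 := ((ofProfile (d := d) k).continuous.comp conjProfile.continuous).tendsto h
    have c2 := (((Complex.conjCLE : ℂ →L[ℝ] ℂ).compLpL 2 (volume : Measure (Space d))).continuous.comp
      (ofProfile k).continuous).tendsto h
    refine tendsto_nhds_unique (c1.comp hu) ((c2.comp hu).congr fun n ↦ ?_)
    simp only [Function.comp_apply]
    rw [conjProfile_profile, ofProfile_profile, ofProfile_profile]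
    apply Lp.ext
    filter_upwards [(Complex.conjCLE : ℂ →L[ℝ] ℂ).coeFn_compLpL (p := 2) (μ := volume)
      ((u n).toLp 2 volume), (u n).coeFn_toLp 2 volume, (conjS (u n)).coeFn_toLp 2 volume]
      with x h1 h2 h3
    rw [h1, h2, h3]; rfl
  rw [e]
  exact (Complex.conjCLE : ℂ →L[ℝ] ℂ).coeFn_compLpL _

lemma conjProfile_flow (s : ℝ) (h : L2 d) : conjProfile (flow s h) = flow (-s) (conjProfile h) := by
  apply Lp.ext
  rw [flow_apply, flow_apply]
  filter_upwards [conjProfile_coe (mulL2 (phase s) h), conjProfile_coe h,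
    mulL2_coe (phase (-s)) (conjProfile h),
    (Measure.measurePreserving_neg (volume : Measure (Space d))).quasiMeasurePreserving.ae
      (mulL2_coe (phase s) h)] with ξ h1 h2 h3 h4
  rw [h1, h4, h3, h2, map_mul, conj_phase]
  simp [phase_apply, symb]

lemma nl_conj (ν : ℝ) (z : ℂ) : nl ν (conj z) = conj (nl ν z) := by simp [nl]

lemma force_conjProfile {ν : ℝ} {k : ℕ} (E : Exponents d ν k) (μ : ℝ) (h : L2 d) :
    force ν μ k (conjProfile h) = -conjProfile (force ν μ k h) := by
  have e : nlProfile ν k (conjProfile h) = conjProfile (nlProfile ν k h) := by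
    apply ofProfile_injective k
    apply Lp.ext
    filter_upwards [ofProfile_nlProfile E (conjProfile h), ofProfile_conjProfile k h,
      ofProfile_nlProfile E h, ofProfile_conjProfile k (nlProfile ν k h)] with x h1 h2 h3 h4
    rw [h1, h2, h4, h3, nl_conj]
  have e2 : ∀ (c : ℂ) (x : L2 d), conjProfile (c • x) = conj c • conjProfile x := by
    intro c x
    apply Lp.ext
    filter_upwards [conjProfile_coe (c • x), conjProfile_coe x, Lp.coeFn_smul (conj c) (conjProfile x),
      (Measure.measurePreserving_neg (volume : Measure (Space d))).quasiMeasurePreserving.ae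
      (Lp.coeFn_smul c x)] with ξ h1 h2 h3 h4
    rw [h1, h4, h3, Pi.smul_apply, Pi.smul_apply, h2]; simp
  rw [force, force, e2, e, ← neg_smul]
  simp

lemma sobolevNorm_ofProfile_conjProfile (k : ℕ) (s : ℝ) (h : L2 d) :
    sobolevNorm s (ofProfile k (conjProfile h)) = sobolevNorm s (ofProfile k h) := by
  have key : sobolevNorm s (ofProfile k (conjProfile h)) ^ 2 = sobolevNorm s (ofProfile k h) ^ 2 := by
    rw [sobolevNorm, sobolevNorm, eLpNorm_two_sq, eLpNorm_two_sq]
    conv_rhs => rw [← lintegral_neg_eq_self]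
    apply lintegral_congr_ae
    filter_upwards [fourier_ofProfile_coe k (conjProfile h), conjProfile_coe h,
      (Measure.measurePreserving_neg (volume : Measure (Space d))).quasiMeasurePreserving.ae
        (fourier_ofProfile_coe k h)] with ξ h1 h2 h3
    rw [h1, h2, h3, norm_neg, wt_apply_neg, enorm_mul, enorm_mul, enorm_mul, enorm_mul]
    congr 3
    rw [← ofReal_norm, ← ofReal_norm]; simp
  exact le_antisymm ((ENNReal.pow_le_pow_left_iff (by norm_num)).1 key.le)
    ((ENNReal.pow_le_pow_left_iff (by norm_num)).1 key.ge)

/-! ### Gaussians -/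

lemma one_add_pow_mul_exp_le {c : ℝ} (hc : 0 < c) (N : ℕ) :
    ∃ C, ∀ r : ℝ, 0 ≤ r → (1 + r) ^ N * Real.exp (-c * r ^ 2) ≤ C := by
  refine ⟨2 ^ N * (N.factorial * (c ^ N)⁻¹ * Real.exp c), fun r hr ↦ ?_⟩
  have h1 : (1 + r) ^ N ≤ 2 ^ N * (1 + r ^ 2) ^ N := by
    rw [← mul_pow]
    gcongr
    nlinarith [sq_nonneg (r - 1)]
  have h2 := Real.pow_div_factorial_le_exp (c * (1 + r ^ 2)) (by positivity) N
  have h3 : (1 + r ^ 2) ^ N ≤ N.factorial * (c ^ N)⁻¹ * (Real.exp c * Real.exp (c * r ^ 2)) := by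
    rw [← Real.exp_add]
    rw [div_le_iff₀ (by positivity), mul_pow] at h2
    rw [show c + c * r ^ 2 = c * (1 + r ^ 2) by ring, mul_assoc, mul_left_comm, ← div_eq_inv_mul,
      le_div_iff₀ (by positivity)]
    linarith
  have h4 : Real.exp (c * r ^ 2) * Real.exp (-c * r ^ 2) = 1 := by
    rw [← Real.exp_add]; simp
  calc (1 + r) ^ N * Real.exp (-c * r ^ 2)
      ≤ 2 ^ N * (N.factorial * (c ^ N)⁻¹ * (Real.exp c * Real.exp (c * r ^ 2))) *
        Real.exp (-c * r ^ 2) := by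
        gcongr
        exact h1.trans (by gcongr)
    _ = 2 ^ N * (N.factorial * (c ^ N)⁻¹ * Real.exp c) *
        (Real.exp (c * r ^ 2) * Real.exp (-c * r ^ 2)) := by ring
    _ = _ := by rw [h4, mul_one]

lemma iteratedDeriv_exp_neg_mul (c : ℝ) (n : ℕ) :
    iteratedDeriv n (fun r : ℝ ↦ Real.exp (-c * r)) = fun r ↦ (-c) ^ n * Real.exp (-c * r) := by
  induction n with
  | zero => simp
  | succ n ih =>
    rw [iteratedDeriv_succ, ih]
    ext r
    have : HasDerivAt (fun r : ℝ ↦ Real.exp (-c * r)) (Real.exp (-c * r) * (-c)) r := by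
      simpa using ((hasDerivAt_id r).const_mul (-c)).exp
    rw [(this.const_mul _).deriv]; ring

/-- The real Gaussian `e^{-c|x|²}`. -/
def gaussR {c : ℝ} (hc : 0 < c) : 𝓢(Space d, ℝ) where
  toFun x := Real.exp (-c * ‖x‖ ^ 2)
  smooth' := (contDiff_const.mul (contDiff_norm_sq ℝ)).exp
  decay' := by
    intro m n
    have hf := Function.hasTemperateGrowth_norm_sq (H := Space d)
    obtain ⟨p, C₁, hC₁, h₁⟩ := hf.norm_iteratedFDeriv_le_uniform n
    obtain ⟨C₂, hC₂⟩ := one_add_pow_mul_exp_le hc (m + p * n)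
    refine ⟨n.factorial * (max 1 c) ^ n * (1 + C₁) ^ n * C₂, fun x ↦ ?_⟩
    have hg : ContDiff ℝ ((⊤ : ℕ∞) : WithTop ℕ∞) (fun r : ℝ ↦ Real.exp (-c * r)) :=
      (contDiff_const.mul contDiff_id).exp
    have key := norm_iteratedFDeriv_comp_le (n := n) hg hf.1 (mod_cast le_top) x
      (C := (max 1 c) ^ n * Real.exp (-c * ‖x‖ ^ 2)) (D := (1 + C₁) * (1 + ‖x‖) ^ p)
      (fun i hi ↦ by
        rw [norm_iteratedFDeriv_eq_norm_iteratedDeriv, iteratedDeriv_exp_neg_mul, norm_mul, norm_pow,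
          norm_neg, Real.norm_of_nonneg hc.le, Real.norm_of_nonneg (Real.exp_pos _).le]
        gcongr
        calc c ^ i ≤ (max 1 c) ^ i := by gcongr; exact le_max_right _ _
          _ ≤ _ := pow_le_pow_right₀ (le_max_left _ _) hi)
      (fun i hi hi' ↦ by
        have h1 : 1 ≤ (1 + C₁) * (1 + ‖x‖) ^ p :=
          one_le_mul_of_one_le_of_one_le (by linarith) (one_le_pow₀ (by simp))
        calc _ ≤ C₁ * (1 + ‖x‖) ^ p := h₁ i hi' x
          _ ≤ (1 + C₁) * (1 + ‖x‖) ^ p := by gcongr; simp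
          _ ≤ _ := le_self_pow₀ h1 (by omega))
    have hx : ‖x‖ ^ m ≤ (1 + ‖x‖) ^ m := by gcongr; simp
    calc _ ≤ (1 + ‖x‖) ^ m * (n.factorial * ((max 1 c) ^ n * Real.exp (-c * ‖x‖ ^ 2)) *
          ((1 + C₁) * (1 + ‖x‖) ^ p) ^ n) := by
          exact mul_le_mul hx key (norm_nonneg _) (by positivity)
      _ = n.factorial * (max 1 c) ^ n * (1 + C₁) ^ n *
          ((1 + ‖x‖) ^ (m + p * n) * Real.exp (-c * ‖x‖ ^ 2)) := by
          rw [mul_pow, ← pow_mul, pow_add]; ring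
      _ ≤ _ := by gcongr; exact hC₂ _ (norm_nonneg _)

/-- The Gaussian `e^{-c|x|²}`. -/
def gauss {c : ℝ} (hc : 0 < c) : 𝓢(Space d, ℂ) :=
  SchwartzMap.postcompCLM (𝕜 := ℝ) Complex.ofRealCLM (gaussR hc)

lemma gauss_apply {c : ℝ} (hc : 0 < c) (x : Space d) :
    gauss hc x = ((Real.exp (-c * ‖x‖ ^ 2) : ℝ) : ℂ) := rfl

/-! ### Multiplication operators on Sobolev spaces -/

/-- A Schwartz function as a multiplier. -/
def toB (g : 𝓢(Space d, ℂ)) : Space d →ᵇ ℂ := g.toBoundedContinuousFunction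

lemma toB_apply (g : 𝓢(Space d, ℂ)) (x : Space d) : toB g x = g x := rfl

lemma mulL2_toB_toLp (g f : 𝓢(Space d, ℂ)) :
    mulL2 (toB g) (f.toLp 2 volume) = (mulS g f).toLp 2 volume := by
  apply Lp.ext
  filter_upwards [mulL2_coe (toB g) (f.toLp 2 volume), f.coeFn_toLp 2 volume,
    (mulS g f).coeFn_toLp 2 volume] with x h1 h2 h3
  rw [h1, h2, h3, mulS_apply, toB_apply]

lemma exists_mulProfile {k : ℕ} (hk : (d : ℝ) / 2 < k) (g : 𝓢(Space d, ℂ)) :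
    ∃ M : L2 d →L[ℂ] L2 d, ∀ h, ofProfile k (M h) = mulL2 (toB g) (ofProfile k h) := by
  obtain ⟨C, hC, hmul⟩ := sob_mulS_le (d := d) (s := k) (p := k) (q := k) hk (by positivity) le_rfl
    le_rfl (by simp)
  set B := C * sob k g
  have hB : 0 ≤ B := mul_nonneg hC (sob_nonneg _ _)
  have key : ∀ h : L2 d, sobolevNorm k (mulL2 (toB g) (ofProfile k h)) ≤ ENNReal.ofReal (B * ‖h‖) := by
    intro h
    obtain ⟨u, hu⟩ := exists_seq_profile k h
    have h1 : Tendsto (fun n ↦ mulL2 (toB g) (ofProfile k ((profile k (u n)).toLp 2 volume))) atTop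
        (𝓝 (mulL2 (toB g) (ofProfile k h))) :=
      (((mulL2 (toB g)).continuous.comp (ofProfile k).continuous).tendsto h).comp hu
    refine sobolevNorm_le_of_tendsto k h1 (C := fun n ↦
      ENNReal.ofReal (B * ‖(profile k (u n)).toLp 2 volume‖)) (fun n ↦ ?_) ?_
    · rw [ofProfile_profile, mulL2_toB_toLp, sobolevNorm_toLp]
      exact ENNReal.ofReal_le_ofReal (hmul g (u n))
    · exact (ENNReal.continuous_ofReal.tendsto _).comp (hu.norm.const_mul B)
  have hex : ∀ h : L2 d, ∃ h', ofProfile k h' = mulL2 (toB g) (ofProfile k h) := fun h ↦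
    exists_ofProfile_eq ((key h).trans_lt ENNReal.ofReal_lt_top)
  choose M hM using hex
  refine ⟨LinearMap.mkContinuous { toFun := M, map_add' := fun x y ↦ ?_, map_smul' := fun c x ↦ ?_ }
    B (fun h ↦ ?_), hM⟩
  · apply ofProfile_injective k
    rw [hM, map_add, map_add, map_add, hM, hM]
  · apply ofProfile_injective k
    simp only [hM, map_smul, RingHom.id_apply]
  · have := key h
    rw [← hM, sobolevNorm_ofProfile_self, ← ofReal_norm,
      ENNReal.ofReal_le_ofReal_iff (by positivity)] at this
    exact this

/-- `m ↦ mulL2 m` as a homomorphism of algebras. -/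
def mulL2Hom : (Space d →ᵇ ℂ) →+* (L2 d →L[ℂ] L2 d) where
  toFun := mulL2
  map_one' := by ext1 f; exact mulL2_one f
  map_mul' m n := by ext1 f; exact (mulL2_mul m n f).symm
  map_zero' := by
    ext1 f
    apply Lp.ext
    filter_upwards [mulL2_coe 0 f] with x h1
    rw [h1]
    simp
  map_add' m n := by
    ext1 f
    apply Lp.ext
    filter_upwards [mulL2_coe (m + n) f, mulL2_coe m f, mulL2_coe n f,
      Lp.coeFn_add (mulL2 m f) (mulL2 n f)] with x h1 h2 h3 h4
    rw [h1]
    refine Eq.trans ?_ h4.symm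
    rw [Pi.add_apply, h2, h3, BoundedContinuousFunction.add_apply]; ring

lemma continuous_mulL2Hom : Continuous (mulL2Hom (d := d)) := by
  refine AddMonoidHomClass.continuous_of_bound mulL2Hom 1 fun m ↦ ?_
  rw [one_mul]
  exact ContinuousLinearMap.opNorm_le_bound _ (norm_nonneg _) fun f ↦
    norm_mulL2_le m m.norm_coe_le_norm f

lemma exp_mulL2 (m : Space d →ᵇ ℂ) (f : L2 d) :
    NormedSpace.exp (mulL2 m) f =ᵐ[volume] fun x ↦ Complex.exp (m x) * f x := by
  have h1 : NormedSpace.exp (mulL2 m) = mulL2 (NormedSpace.exp m) :=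
    (NormedSpace.map_exp (mulL2Hom (d := d)) continuous_mulL2Hom m).symm
  have h2 : ∀ x, (NormedSpace.exp m : Space d →ᵇ ℂ) x = Complex.exp (m x) := by
    intro x
    let ev : (Space d →ᵇ ℂ) →+* ℂ :=
      { toFun := fun m ↦ m x, map_one' := rfl, map_mul' := fun _ _ ↦ rfl, map_zero' := rfl,
        map_add' := fun _ _ ↦ rfl }
    have := NormedSpace.map_exp ev (BoundedContinuousFunction.evalCLM ℂ x).continuous m
    rw [Complex.exp_eq_exp_ℂ]
    exact this
  rw [h1]
  filter_upwards [mulL2_coe (NormedSpace.exp m) f] with x hx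
  rw [hx, h2]

/-! ### The equation without dispersion -/

/-- Multiplication of a Schwartz function by `e^{iτg}`, where `g` is a Gaussian. -/
def twist {c : ℝ} (hc : 0 < c) (τ : ℝ) (f : 𝓢(Space d, ℂ)) : 𝓢(Space d, ℂ) :=
  SchwartzMap.smulLeftCLM ℂ (fun x ↦ Complex.exp (Complex.I * ((τ * gaussR hc x : ℝ) : ℂ))) f

lemma twist_apply {c : ℝ} (hc : 0 < c) (τ : ℝ) (f : 𝓢(Space d, ℂ)) (x : Space d) :
    twist hc τ f x = Complex.exp (Complex.I * ((τ * Real.exp (-c * ‖x‖ ^ 2) : ℝ) : ℂ)) * f x := by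
  rw [twist, SchwartzMap.smulLeftCLM_apply_apply, smul_eq_mul]
  · rfl
  · have h2 : Function.HasTemperateGrowth (fun x : Space d ↦ τ * gaussR hc x) :=
      (Function.HasTemperateGrowth.const _).mul (gaussR hc).hasTemperateGrowth
    exact hasTemperateGrowth_exp_I.comp h2

lemma norm_twist_apply {c : ℝ} (hc : 0 < c) (τ : ℝ) (f : 𝓢(Space d, ℂ)) (x : Space d) :
    ‖twist hc τ f x‖ = ‖f x‖ := by
  rw [twist_apply, norm_mul, mul_comm Complex.I, Complex.norm_exp_ofReal_mul_I, one_mul]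

/-- The solution of `∂ₜ u = iμ|u|^{ν-1}u` with data `a e^{-|x|²}` is
`exp(iμ t a^{ν-1} e^{-(ν-1)|x|²}) a e^{-|x|²}`. -/
theorem hasDerivAt_twist {ν : ℝ} {k : ℕ} (E : Exponents d ν k) (hν : 0 < ν - 1) (μ : ℝ) {a : ℝ}
    (ha : 0 ≤ a) (t : ℝ) :
    HasDerivAt (fun t : ℝ ↦ (profile k (twist hν (μ * t * a ^ (ν - 1))
        ((a : ℂ) • gauss one_pos : 𝓢(Space d, ℂ)))).toLp 2 volume)
      (force ν μ k ((profile k (twist hν (μ * t * a ^ (ν - 1))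
        ((a : ℂ) • gauss one_pos))).toLp 2 volume)) t := by
  set φ : 𝓢(Space d, ℂ) := (a : ℂ) • gauss one_pos with hφ
  set y : ℝ → L2 d := fun t ↦ (profile k (twist hν (μ * t * a ^ (ν - 1)) φ)).toLp 2 volume with hy
  set g : 𝓢(Space d, ℂ) := (Complex.I * ((μ * a ^ (ν - 1) : ℝ) : ℂ)) • gauss hν with hg
  have hgx : ∀ x, g x = Complex.I * ((μ * a ^ (ν - 1) * Real.exp (-(ν - 1) * ‖x‖ ^ 2) : ℝ) : ℂ) := by
    intro x
    rw [hg, smul_apply, gauss_apply, smul_eq_mul]; push_cast; ring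
  have hyx : ∀ t, ofProfile k (y t) =ᵐ[volume] fun x ↦ Complex.exp ((t : ℂ) * g x) * φ x := by
    intro t
    rw [hy]
    simp only
    rw [ofProfile_profile]
    filter_upwards [(twist hν (μ * t * a ^ (ν - 1)) φ).coeFn_toLp 2 volume] with x hx
    rw [hx, twist_apply, hgx]
    congr 2; push_cast; ring
  obtain ⟨M, hM⟩ := exists_mulProfile (k := k) E.half_lt g
  have hsemi : ∀ t : ℝ, SemiconjBy (ofProfile (d := d) k) (t • M) (t • mulL2 (toB g)) := by
    intro t
    ext1 h
    change ofProfile k (t • M h) = t • mulL2 (toB g) (ofProfile k h)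
    rw [← hM]
    exact ((ofProfile k).restrictScalars ℝ).map_smul t (M h)
  have hsm : ∀ t : ℝ, t • mulL2 (toB g) = mulL2 (toB ((t : ℂ) • g)) := by
    intro t
    ext1 f
    apply Lp.ext
    filter_upwards [Lp.coeFn_smul t (mulL2 (toB g) f), mulL2_coe (toB g) f,
      mulL2_coe (toB ((t : ℂ) • g)) f] with x h1 h2 h3
    refine h1.trans ?_
    rw [h3, Pi.smul_apply, h2, toB_apply, toB_apply, Complex.real_smul, ← mul_assoc]
    rfl
  have hexp : ∀ t : ℝ, y t = NormedSpace.exp (t • M) ((profile k φ).toLp 2 volume) := by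
    intro t
    apply ofProfile_injective k
    let _ : NormedAlgebra ℚ (L2 d →L[ℂ] L2 d) := NormedAlgebra.restrictScalars ℚ ℝ _
    have h1 := congrArg (fun L : L2 d →L[ℂ] L2 d ↦ L ((profile k φ).toLp 2 volume))
      (hsemi t).exp_right.eq
    have h2 : ofProfile k (NormedSpace.exp (t • M) ((profile k φ).toLp 2 volume)) =
        NormedSpace.exp (t • mulL2 (toB g)) (φ.toLp 2 volume) := by
      rw [← ofProfile_profile k φ]; exact h1
    rw [h2, hsm]
    apply Lp.ext
    filter_upwards [hyx t, exp_mulL2 (toB ((t : ℂ) • g)) (φ.toLp 2 volume), φ.coeFn_toLp 2 volume]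
      with x h3 h4 h5
    rw [h3, h4, h5, toB_apply]
    rfl
  have hder : HasDerivAt y (M (y t)) t := by
    have h1 := hasDerivAt_exp_smul_const' (𝕂 := ℝ) M t
    have h2 := ((ContinuousLinearMap.apply ℂ (L2 d)
      ((profile k φ).toLp 2 volume)).restrictScalars ℝ).hasFDerivAt.comp_hasDerivAt t h1
    refine HasDerivAt.congr_deriv (h2.congr_of_eventuallyEq (Eventually.of_forall fun s ↦ ?_)) ?_
    · rw [hexp s]; rfl
    · rw [hexp t]; rfl
  convert hder using 1
  apply ofProfile_injective k
  rw [hM, force, map_smul]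
  apply Lp.ext
  filter_upwards [Lp.coeFn_smul (Complex.I * (μ : ℂ)) (ofProfile k (nlProfile ν k (y t))),
    ofProfile_nlProfile E (y t), mulL2_coe (toB g) (ofProfile k (y t)), hyx t] with x h1 h2 h3 h4
  refine h1.trans ?_
  rw [Pi.smul_apply, h2, h3, toB_apply, h4, nl, smul_eq_mul]
  have e1 : ‖Complex.exp ((t : ℂ) * g x) * φ x‖ = a * Real.exp (-1 * ‖x‖ ^ 2) := by
    rw [norm_mul, hgx, hφ, smul_apply, gauss_apply, smul_eq_mul, norm_mul, Complex.norm_real,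
      Complex.norm_real, Real.norm_of_nonneg ha, Real.norm_of_nonneg (Real.exp_pos _).le,
      mul_left_comm (t : ℂ), ← Complex.ofReal_mul, mul_comm Complex.I,
      Complex.norm_exp_ofReal_mul_I, one_mul]
  rw [e1, hgx, Real.mul_rpow ha (Real.exp_pos _).le, ← Real.exp_mul]
  have e2 : -1 * ‖x‖ ^ 2 * (ν - 1) = -(ν - 1) * ‖x‖ ^ 2 := by ring
  rw [e2]; push_cast; ring

/-! ### Rescaled solutions -/

lemma ofProfile_real_smul (k : ℕ) (r : ℝ) (x : L2 d) : ofProfile k (r • x) = r • ofProfile k x :=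
  ((ofProfile k).restrictScalars ℝ).map_smul r x

lemma toLp_real_smul (r : ℝ) (f : 𝓢(Space d, ℂ)) :
    ((r : ℂ) • f).toLp 2 volume = r • f.toLp 2 volume := by
  rw [toLp_smul]
  apply Lp.ext
  filter_upwards [Lp.coeFn_smul (r : ℂ) (f.toLp 2 volume), Lp.coeFn_smul r (f.toLp 2 volume)]
    with x h1 h2
  rw [h1, h2, Pi.smul_apply, Pi.smul_apply, Complex.real_smul, smul_eq_mul]

lemma sobolevNorm_real_smul (s : ℝ) {A : ℝ} (hA : 0 ≤ A) (f : L2 d) :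
    sobolevNorm s (A • f) = ENNReal.ofReal A * sobolevNorm s f := by
  have e : (𝓕 (A • f) : L2 d) = A • (𝓕 f : L2 d) :=
    ((Lp.fourierTransformₗᵢ (Space d) ℂ).toContinuousLinearEquiv.toContinuousLinearMap.restrictScalars
      ℝ).map_smul A f
  have hA' : ENNReal.ofReal A = ‖(A : ℂ)‖ₑ := by
    rw [← ofReal_norm, Complex.norm_real, Real.norm_of_nonneg hA]
  rw [sobolevNorm, sobolevNorm, e, hA', ← eLpNorm_const_smul]
  apply eLpNorm_congr_ae
  filter_upwards [Lp.coeFn_smul A (𝓕 f : L2 d)] with ξ h1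
  rw [h1, Pi.smul_apply, Pi.smul_apply, Complex.real_smul, smul_eq_mul]
  ring

/-- A solution with small dispersion gives a solution of the original equation. -/
lemma Mild.isSolution_scale {ν μ : ℝ} {k : ℕ} (E : Exponents d ν k) {A b κ T : ℝ} (hA : 0 < A)
    (hb : 0 < b) (hκ : κ * A ^ (ν - 1) = b ^ 4) {h : ℝ → L2 d}
    (hm : Mild flow (force ν μ k) κ T h) {φ : 𝓢(Space d, ℂ)}
    (h0 : h 0 = (profile k φ).toLp 2 volume) :
    IsSolution ν μ k (T / A ^ (ν - 1)) ((A : ℂ) • dilS hb φ)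
      (fun t ↦ A • dilL2 hb (ofProfile k (h (A ^ (ν - 1) * t)))) := by
  have h1 := (hm.scale E hA hb hκ).isSolution E (u₀ := (A : ℂ) • dilS hb φ) (by
    apply ofProfile_injective k
    rw [mul_zero, h0, ofProfile_real_smul, ofProfile_dilProfile, ofProfile_profile, ofProfile_profile,
      dilL2_toLp, toLp_real_smul])
  convert h1 using 2 with t
  rw [ofProfile_real_smul, ofProfile_dilProfile]

/-- The choice of the scaling parameters. -/
lemma eventually_scale {ν γ : ℝ} (hν : 1 < ν) (hγ : γ < criticalExponent d ν) {ε κ₀ τ : ℝ} (T : ℝ)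
    (hε : 0 < ε) (hκ₀ : 0 < κ₀) (hτ : 0 < τ) :
    ∀ᶠ b : ℝ in atTop, b ^ 4 / (ε * b ^ ((d : ℝ) / 2 - γ)) ^ (ν - 1) < κ₀ ∧
      T / (ε * b ^ ((d : ℝ) / 2 - γ)) ^ (ν - 1) < τ := by
  set p := ((d : ℝ) / 2 - γ) * (ν - 1) with hp
  have hν' : 0 < ν - 1 := by linarith
  have hp4 : 4 < p := by
    rw [criticalExponent] at hγ
    have : 4 / (ν - 1) < (d : ℝ) / 2 - γ := by linarith
    rwa [div_lt_iff₀ hν'] at this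
  have e : ∀ b : ℝ, 0 < b → (ε * b ^ ((d : ℝ) / 2 - γ)) ^ (ν - 1) = ε ^ (ν - 1) * b ^ p := by
    intro b hb
    rw [Real.mul_rpow hε.le (by positivity), ← Real.rpow_mul hb.le]
  have h1 : Tendsto (fun b : ℝ ↦ (ε ^ (ν - 1))⁻¹ * b ^ (-(p - 4))) atTop (𝓝 0) := by
    simpa using (tendsto_rpow_neg_atTop (by linarith : 0 < p - 4)).const_mul ((ε ^ (ν - 1))⁻¹)
  have h2 : Tendsto (fun b : ℝ ↦ (T * (ε ^ (ν - 1))⁻¹) * b ^ (-p)) atTop (𝓝 0) := by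
    simpa using (tendsto_rpow_neg_atTop (by linarith : 0 < p)).const_mul (T * (ε ^ (ν - 1))⁻¹)
  filter_upwards [h1.eventually_lt_const hκ₀, h2.eventually_lt_const hτ, eventually_gt_atTop 0]
    with b hb1 hb2 hb
  rw [e b hb]
  have hεp : 0 < ε ^ (ν - 1) := by positivity
  have hbp : 0 < b ^ p := by positivity
  constructor
  · refine lt_of_eq_of_lt ?_ hb1
    rw [neg_sub, Real.rpow_sub hb, show (4 : ℝ) = ((4 : ℕ) : ℝ) by norm_num, Real.rpow_natCast]
    field_simp
  · refine lt_of_eq_of_lt ?_ hb2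
    rw [Real.rpow_neg hb.le]
    field_simp

/-! ### Oscillation of the dispersionless solution -/

lemma pd_gauss {c : ℝ} (hc : 0 < c) (j : Fin d) (x : Space d) :
    pd j (gauss hc) x = ((-2 * c * x j * Real.exp (-c * ‖x‖ ^ 2) : ℝ) : ℂ) := by
  have h1 : HasFDerivAt (fun x : Space d ↦ Real.exp (-c * ‖x‖ ^ 2))
      (Real.exp (-c * ‖x‖ ^ 2) • (-c) • (2 • innerSL ℝ x)) x :=
    ((hasStrictFDerivAt_norm_sq x).hasFDerivAt.const_mul (-c)).exp
  have h2 := Complex.ofRealCLM.hasFDerivAt.comp x h1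
  rw [pd_apply]
  have h3 : fderiv ℝ (gauss hc : 𝓢(Space d, ℂ)) x = _ := h2.fderiv
  rw [h3]
  simp [EuclideanSpace.inner_single_right]
  ring

lemma pd_twist {c : ℝ} (hc : 0 < c) (τ : ℝ) (j : Fin d) (f : 𝓢(Space d, ℂ)) :
    pd j (twist hc τ f) =
      twist hc τ (pd j f + (Complex.I * τ) • mulS (pd j (gauss hc)) f) := by
  ext x
  have hG : HasFDerivAt (gauss hc : 𝓢(Space d, ℂ)) (fderiv ℝ (gauss hc : 𝓢(Space d, ℂ)) x) x :=
    (gauss hc).differentiableAt.hasFDerivAt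
  have hf : HasFDerivAt f (fderiv ℝ f x) x := f.differentiableAt.hasFDerivAt
  have h1 := (hG.const_mul (Complex.I * τ)).cexp.mul hf
  have e : (twist hc τ f : Space d → ℂ) = fun x ↦ Complex.exp (Complex.I * τ * gauss hc x) * f x := by
    ext y
    rw [twist_apply, gauss_apply]; congr 2; push_cast; ring
  rw [pd_apply, e]
  have h2 := h1.fderiv
  refine (congrArg (fun L : Space d →L[ℝ] ℂ ↦ L (EuclideanSpace.single j 1)) h2).trans ?_
  rw [twist_apply]
  simp only [_root_.add_apply, _root_.smul_apply, mulS_apply, pd_apply, smul_eq_mul, gauss_apply]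
  push_cast
  ring_nf

lemma norm_toLp_twist {c : ℝ} (hc : 0 < c) (τ : ℝ) (f : 𝓢(Space d, ℂ)) :
    ‖(twist hc τ f).toLp 2 volume‖ = ‖f.toLp 2 volume‖ :=
  le_antisymm (norm_toLp_le_of_le fun x ↦ (norm_twist_apply hc τ f x).le)
    (norm_toLp_le_of_le fun x ↦ (norm_twist_apply hc τ f x).ge)

lemma norm_pd_twist_gauss_ge {c : ℝ} (hc : 0 < c) {τ : ℝ} (j : Fin d) :
    |τ| * ‖(mulS (pd j (gauss hc)) (gauss one_pos)).toLp 2 volume‖ ≤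
      ‖(pd j (twist hc τ (gauss one_pos))).toLp 2 volume‖ := by
  rw [pd_twist, norm_toLp_twist]
  have : |τ| * ‖(mulS (pd j (gauss hc)) (gauss one_pos)).toLp 2 volume‖ =
      ‖((τ : ℂ) • mulS (pd j (gauss hc)) (gauss one_pos)).toLp 2 volume‖ := by
    rw [toLp_smul, norm_smul, Complex.norm_real, Real.norm_eq_abs]
  rw [this]
  apply norm_toLp_le_of_le
  intro x
  simp only [_root_.add_apply, _root_.smul_apply, mulS_apply, pd_gauss, gauss_apply, smul_eq_mul]
  set p : ℝ := -2 * 1 * x j * Real.exp (-1 * ‖x‖ ^ 2)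
  set q : ℝ := -2 * c * x j * Real.exp (-c * ‖x‖ ^ 2)
  set r : ℝ := Real.exp (-1 * ‖x‖ ^ 2)
  have e1 : (τ : ℂ) * ((q : ℂ) * r) = ((τ * q * r : ℝ) : ℂ) := by push_cast; ring
  have e2 : (p : ℂ) + Complex.I * τ * ((q : ℂ) * r) = (p : ℂ) + ((τ * q * r : ℝ) : ℂ) * Complex.I := by
    push_cast; ring
  rw [e1, e2, Complex.norm_real, Real.norm_eq_abs]
  simpa using Complex.abs_im_le_norm ((p : ℂ) + ((τ * q * r : ℝ) : ℂ) * Complex.I)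

lemma pd_add (j : Fin d) (f g : 𝓢(Space d, ℂ)) : pd j (f + g) = pd j f + pd j g := by
  rw [pd, LineDeriv.lineDerivOp_add]; rfl

lemma pd_smul (j : Fin d) (c : ℂ) (f : 𝓢(Space d, ℂ)) : pd j (c • f) = c • pd j f := by
  ext x
  have : (⇑(c • f) : Space d → ℂ) = fun y ↦ c • f y := rfl
  rw [pd_apply, this, fderiv_fun_const_smul f.differentiableAt, _root_.smul_apply, _root_.smul_apply,
    pd_apply]

lemma norm_pd_pd_twist_le {c : ℝ} (hc : 0 < c) (j : Fin d) (f : 𝓢(Space d, ℂ)) :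
    ∃ C, 0 ≤ C ∧ ∀ τ : ℝ, 1 ≤ |τ| → ‖(pd j (pd j (twist hc τ f))).toLp 2 volume‖ ≤ C * |τ| ^ 2 := by
  set g := mulS (pd j (gauss hc)) with hg
  refine ⟨‖(pd j (pd j f)).toLp 2 volume‖ + ‖(pd j (g f)).toLp 2 volume‖ +
    (‖(g (pd j f)).toLp 2 volume‖ + ‖(g (g f)).toLp 2 volume‖), by positivity, fun τ hτ ↦ ?_⟩
  rw [pd_twist, pd_twist, norm_toLp_twist, pd_add, pd_smul]
  have e : mulS (pd j (gauss hc)) (pd j f + (Complex.I * τ) • mulS (pd j (gauss hc)) f) =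
      g (pd j f) + (Complex.I * τ) • g (g f) := by
    ext x; simp [hg]; ring
  rw [e, smul_add, smul_smul, toLp_add, toLp_add, toLp_add, toLp_smul, toLp_smul, toLp_smul]
  have h1 : ‖Complex.I * (τ : ℂ)‖ = |τ| := by simp
  have h2 : ‖Complex.I * (τ : ℂ) * (Complex.I * τ)‖ = |τ| ^ 2 := by rw [norm_mul, h1, sq]
  have h3 : 1 ≤ |τ| ^ 2 := one_le_pow₀ hτ
  have h4 : |τ| ≤ |τ| ^ 2 := le_self_pow₀ hτ (by norm_num)
  refine (norm_add_le _ _).trans ?_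
  rw [add_mul, add_mul, add_mul]
  refine add_le_add ((norm_add_le _ _).trans (add_le_add ?_ ?_))
    ((norm_add_le _ _).trans (add_le_add ?_ ?_))
  · exact le_mul_of_one_le_right (norm_nonneg _) h3
  · rw [norm_smul, h1, mul_comm]; gcongr
  · rw [norm_smul, h1, mul_comm]; gcongr
  · rw [norm_smul, h2, mul_comm]

/-! ### Homogeneous Sobolev norms -/

lemma rpow_mul_wt_le {γ : ℝ} {k : ℕ} (hγ : 0 ≤ γ) (hγk : γ ≤ k) (ξ : Space d) :
    (2 * Real.pi * ‖ξ‖) ^ γ * wt (-k) ξ ≤ 1 := by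
  have h1 : (2 * Real.pi * ‖ξ‖) ^ γ ≤ wt γ ξ := by
    have : (2 * Real.pi * ‖ξ‖) ^ γ = ((2 * Real.pi * ‖ξ‖) ^ 2) ^ (γ / 2) := by
      rw [← Real.rpow_natCast, ← Real.rpow_mul (by positivity)]; congr 1; push_cast; ring
    rw [this, wt]
    exact Real.rpow_le_rpow (by positivity) (by linarith) (by positivity)
  calc _ ≤ wt k ξ * wt (-k) ξ := by
        gcongr
        · exact wt_nonneg _ _
        · exact h1.trans (wt_mono hγk ξ)
    _ = 1 := wt_mul_neg _ _

/-- The multiplier `|2πξ|^γ ⟨ξ⟩^{-k}`. -/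
def homB {γ : ℝ} {k : ℕ} (hγ : 0 ≤ γ) (hγk : γ ≤ k) : Space d →ᵇ ℂ :=
  BoundedContinuousFunction.ofNormedAddCommGroup
    (fun ξ ↦ (((2 * Real.pi * ‖ξ‖) ^ γ * wt (-k) ξ : ℝ) : ℂ))
    (Complex.continuous_ofReal.comp
      (((continuous_const.mul continuous_norm).rpow_const fun _ ↦ Or.inr hγ).mul (continuous_wt _)))
    1 (fun ξ ↦ by
      rw [Complex.norm_real, Real.norm_of_nonneg (mul_nonneg (by positivity) (wt_nonneg _ _))]
      exact rpow_mul_wt_le hγ hγk ξ)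

lemma homB_apply {γ : ℝ} {k : ℕ} (hγ : 0 ≤ γ) (hγk : γ ≤ k) (ξ : Space d) :
    homB hγ hγk ξ = (((2 * Real.pi * ‖ξ‖) ^ γ * wt (-k) ξ : ℝ) : ℂ) := rfl

lemma norm_homB_le {γ : ℝ} {k : ℕ} (hγ : 0 ≤ γ) (hγk : γ ≤ k) (h : L2 d) :
    ‖mulL2 (homB hγ hγk) h‖ ≤ ‖h‖ := by
  simpa using norm_mulL2_le (homB hγ hγk) (C := 1) (fun ξ ↦ by
    rw [homB_apply, Complex.norm_real,
      Real.norm_of_nonneg (mul_nonneg (by positivity) (wt_nonneg _ _))]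
    exact rpow_mul_wt_le hγ hγk ξ) h

lemma ofReal_norm_sq_eq_lintegral (f : L2 d) : ENNReal.ofReal (‖f‖ ^ 2) = ∫⁻ x, ‖f x‖ₑ ^ 2 := by
  rw [ENNReal.ofReal_pow (norm_nonneg _), ofReal_norm, Lp.enorm_def, eLpNorm_two_sq]

/-- An interpolation inequality between homogeneous Sobolev norms. -/
lemma norm_pd_sq_le {γ : ℝ} {k : ℕ} (hγ : 0 ≤ γ) (hγk : γ ≤ k) (j : Fin d) (f : 𝓢(Space d, ℂ))
    {N : ℝ} (hN : 0 < N) :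
    ‖(pd j f).toLp 2 volume‖ ^ 2 ≤ N ^ 2 * ‖f.toLp 2 volume‖ ^ 2 +
      (N ^ γ)⁻¹ * (‖mulL2 (homB hγ hγk) ((profile k f).toLp 2 volume)‖ *
        ‖(pd j (pd j f)).toLp 2 volume‖) := by
  set H := mulL2 (homB hγ hγk) ((profile k f).toLp 2 volume)
  set F : Space d → ℝ := fun ξ ↦ ‖𝓕 f ξ‖ with hF
  set s : Space d → ℝ := fun ξ ↦ 2 * Real.pi * |ξ j|
  set r : Space d → ℝ := fun ξ ↦ 2 * Real.pi * ‖ξ‖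
  have hs : ∀ ξ, 0 ≤ s ξ := fun ξ ↦ by positivity
  have hr : ∀ ξ, 0 ≤ r ξ := fun ξ ↦ by positivity
  have hsr : ∀ ξ, s ξ ≤ r ξ := fun ξ ↦ by
    have := EuclideanSpace.norm_eq ξ
    have : |ξ j| ≤ ‖ξ‖ := by simpa using PiLp.norm_apply_le ξ j
    simp only [s, r]; gcongr
  have hFc : Continuous F := (𝓕 f).continuous.norm
  have hsc : Continuous s := by
    have : Continuous fun ξ : Space d ↦ ξ j := by fun_prop
    fun_prop
  have hrc : Continuous r := by fun_prop
  have planch : ∀ g : 𝓢(Space d, ℂ), ENNReal.ofReal (‖g.toLp 2 volume‖ ^ 2) =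
      ∫⁻ ξ, ENNReal.ofReal (‖𝓕 g ξ‖ ^ 2) := by
    intro g
    rw [← SchwartzMap.norm_fourier_toL2_eq g, ofReal_norm_sq_eq_lintegral]
    apply lintegral_congr_ae
    filter_upwards [(𝓕 g).coeFn_toLp 2 volume] with ξ hξ
    rw [hξ, ← ofReal_norm, ENNReal.ofReal_pow (norm_nonneg _)]
  have hfp : ∀ (g : 𝓢(Space d, ℂ)) ξ, ‖𝓕 (pd j g) ξ‖ = s ξ * ‖𝓕 g ξ‖ := by
    intro g ξ
    rw [fourier_pd]; simp [s, abs_of_pos Real.pi_pos]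
  have hH : ENNReal.ofReal (‖H‖ ^ 2) = ∫⁻ ξ, ENNReal.ofReal (r ξ ^ γ * F ξ) ^ 2 := by
    rw [ofReal_norm_sq_eq_lintegral]
    apply lintegral_congr_ae
    filter_upwards [mulL2_coe (homB hγ hγk) ((profile k f).toLp 2 volume),
      (profile k f).coeFn_toLp 2 volume] with ξ h1 h2
    rw [h1, h2, homB_apply, profile_apply, ← ofReal_norm]
    congr 2
    rw [norm_mul, norm_mul, Complex.norm_real, Complex.norm_real, Real.norm_of_nonneg (wt_nonneg _ _),
      Real.norm_of_nonneg (mul_nonneg (by positivity) (wt_nonneg _ _))]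
    have := wt_neg_mul (d := d) k ξ
    simp only [r, hF]
    linear_combination ((2 * Real.pi * ‖ξ‖) ^ γ * ‖𝓕 f ξ‖) * this
  have hQ : ENNReal.ofReal (‖(pd j (pd j f)).toLp 2 volume‖ ^ 2) =
      ∫⁻ ξ, ENNReal.ofReal (s ξ ^ 2 * F ξ) ^ 2 := by
    rw [planch]
    congr 1; ext ξ
    rw [hfp, hfp, ENNReal.ofReal_pow (norm_nonneg _ |> fun h ↦ by positivity)]
    congr 2; simp only [hF]; ring
  have cs : ∫⁻ ξ, ENNReal.ofReal (r ξ ^ γ * F ξ) * ENNReal.ofReal (s ξ ^ 2 * F ξ) ≤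
      ENNReal.ofReal (‖H‖ * ‖(pd j (pd j f)).toLp 2 volume‖) := by
    have := lintegral_mul_sq_le (A := fun ξ ↦ ENNReal.ofReal (r ξ ^ γ * F ξ))
      (B := fun ξ ↦ ENNReal.ofReal (s ξ ^ 2 * F ξ)) (by
        have : Continuous fun ξ ↦ r ξ ^ γ := hrc.rpow_const fun _ ↦ Or.inr hγ
        exact (ENNReal.continuous_ofReal.comp (this.mul hFc)).measurable)
        (by
          have : Continuous fun ξ ↦ s ξ ^ 2 * F ξ := by fun_prop
          exact (ENNReal.continuous_ofReal.comp this).measurable)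
    rw [← hH, ← hQ, ← ENNReal.ofReal_mul (by positivity), ← mul_pow,
      ENNReal.ofReal_pow (by positivity)] at this
    exact (ENNReal.pow_le_pow_left_iff (by norm_num)).1 this
  rw [← ENNReal.ofReal_le_ofReal_iff (by positivity), ENNReal.ofReal_add (by positivity)
    (by positivity), ENNReal.ofReal_mul (by positivity), ENNReal.ofReal_mul (p := (N ^ γ)⁻¹)
    (by positivity), planch, planch]
  refine le_trans ?_ (add_le_add le_rfl (mul_le_mul_right cs _))
  rw [← lintegral_const_mul' _ _ ENNReal.ofReal_ne_top, ← lintegral_const_mul' _ _ ENNReal.ofReal_ne_top,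
    ← lintegral_add_left (by fun_prop)]
  refine lintegral_mono fun ξ ↦ ?_
  rw [hfp, ← ENNReal.ofReal_mul (by positivity), ← ENNReal.ofReal_mul (by positivity),
    ← ENNReal.ofReal_mul (by positivity), ← ENNReal.ofReal_add (by positivity) (by positivity)]
  apply ENNReal.ofReal_le_ofReal
  change (s ξ * F ξ) ^ 2 ≤ N ^ 2 * F ξ ^ 2 + (N ^ γ)⁻¹ * (r ξ ^ γ * F ξ * (s ξ ^ 2 * F ξ))
  have hF0 : 0 ≤ F ξ ^ 2 := by positivity
  rcases le_or_gt (s ξ) N with h | h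
  · have h1 : (s ξ) ^ 2 ≤ N ^ 2 := by gcongr
    have h2 : 0 ≤ (N ^ γ)⁻¹ * (r ξ ^ γ * F ξ * (s ξ ^ 2 * F ξ)) := by
      have := hr ξ; have := hs ξ; positivity
    nlinarith
  · have h1 : N ^ γ ≤ r ξ ^ γ := Real.rpow_le_rpow hN.le (h.le.trans (hsr ξ)) hγ
    have h2 : 1 ≤ (N ^ γ)⁻¹ * r ξ ^ γ := by
      rw [← div_eq_inv_mul, le_div_iff₀ (by positivity)]; linarith
    have h3 : 0 ≤ s ξ ^ 2 * F ξ ^ 2 := by positivity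
    have h4 : 0 ≤ N ^ 2 * F ξ ^ 2 := by positivity
    nlinarith

/-- The dispersionless solution grows in homogeneous Sobolev spaces of positive order. -/
lemma exists_le_norm_homB_twist {c γ : ℝ} {k : ℕ} (hd : 1 ≤ d) (hc : 0 < c) (hγ : 0 < γ)
    (hγk : γ ≤ k) (B : ℝ) :
    ∃ τ₀, ∀ τ : ℝ, τ₀ ≤ |τ| → B ≤ ‖mulL2 (homB hγ.le hγk)
      ((profile k (twist hc τ (gauss one_pos : 𝓢(Space d, ℂ)))).toLp 2 volume)‖ := by
  set φ : 𝓢(Space d, ℂ) := gauss one_pos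
  let j : Fin d := ⟨0, hd⟩
  have hpos : ∀ f : 𝓢(Space d, ℂ), (∃ x, f x ≠ 0) → 0 < ‖f.toLp 2 volume‖ := by
    rintro f ⟨x, hx⟩
    rw [norm_pos_iff]
    intro h0
    have : f = 0 := SchwartzMap.injective_toLp 2 volume (h0.trans rfl)
    exact hx (by rw [this]; rfl)
  set θ := ‖(mulS (pd j (gauss hc)) φ).toLp 2 volume‖ with hθ
  have hθ0 : 0 < θ := by
    refine hpos _ ⟨EuclideanSpace.single j 1, ?_⟩
    rw [mulS_apply, pd_gauss, gauss_apply]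
    simp [hc.ne', Complex.exp_ne_zero]
  set P := ‖φ.toLp 2 volume‖ with hP
  have hP0 : 0 < P := hpos _ ⟨0, by simp [φ, gauss_apply]⟩
  obtain ⟨C, hC, hC2⟩ := norm_pd_pd_twist_le hc j φ
  set δ := θ / (2 * P)
  have hδ : 0 < δ := by positivity
  set B' := |B| * (C + 1) * 2 / θ ^ 2
  have hB' : 0 ≤ B' := by positivity
  refine ⟨max 1 ((B' + 1) ^ (1 / γ) / δ), fun τ hτ ↦ ?_⟩
  have hτ1 : 1 ≤ |τ| := (le_max_left _ _).trans hτ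
  have hτ0 : 0 < |τ| := by linarith
  set H := ‖mulL2 (homB hγ.le hγk) ((profile k (twist hc τ φ)).toLp 2 volume)‖
  have h1 := norm_pd_sq_le hγ.le hγk j (twist hc τ φ) (N := δ * |τ|) (by positivity)
  have h2 := norm_pd_twist_gauss_ge hc (τ := τ) j
  have h3 : (|τ| * θ) ^ 2 ≤ ‖(pd j (twist hc τ φ)).toLp 2 volume‖ ^ 2 := by gcongr
  have h4 := hC2 τ hτ1
  rw [norm_toLp_twist] at h1
  have hN : B' ≤ (δ * |τ|) ^ γ := by
    have : (B' + 1) ^ (1 / γ) ≤ δ * |τ| := by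
      have := (le_max_right _ _).trans hτ
      rw [div_le_iff₀ hδ] at this; linarith
    have h5 := Real.rpow_le_rpow (by positivity) this hγ.le
    rw [← Real.rpow_mul (by positivity), one_div_mul_cancel hγ.ne', Real.rpow_one] at h5
    linarith
  set M := (δ * |τ|) ^ γ
  have hM : 0 < M := by positivity
  have h6 : (δ * |τ|) ^ 2 * P ^ 2 = (|τ| * θ) ^ 2 / 4 := by
    simp only [δ]; field_simp; ring
  have h7 : (|τ| * θ) ^ 2 * (3 / 4) ≤ M⁻¹ * (H * (C * |τ| ^ 2)) := by
    have : M⁻¹ * (H * ‖(pd j (pd j (twist hc τ φ))).toLp 2 volume‖) ≤ M⁻¹ * (H * (C * |τ| ^ 2)) := by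
      gcongr
    have h8 := h3.trans h1
    rw [h6] at h8
    linarith
  have h8 : M * θ ^ 2 / 2 ≤ H * (C + 1) := by
    have e : M⁻¹ * (H * (C * |τ| ^ 2)) = |τ| ^ 2 * (M⁻¹ * (H * C)) := by ring
    rw [e, mul_pow, mul_assoc] at h7
    have h9 := le_of_mul_le_mul_left h7 (by positivity)
    rw [← div_eq_inv_mul, le_div_iff₀ hM] at h9
    have : 0 ≤ H := norm_nonneg _
    nlinarith [mul_nonneg hM.le (sq_nonneg θ)]
  have h9 : |B| * (C + 1) ≤ M * θ ^ 2 / 2 := by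
    have : B' * θ ^ 2 = |B| * (C + 1) * 2 := by simp only [B']; field_simp
    nlinarith [mul_le_mul_of_nonneg_right hN (sq_nonneg θ)]
  exact (le_abs_self B).trans (le_of_mul_le_mul_right (h9.trans h8) (by positivity))

/-! ### Norm inflation for positive regularity -/

lemma wt_smul_le {b γ : ℝ} (hb : 1 ≤ b) (hγ : 0 ≤ γ) (ξ : Space d) :
    wt γ (b • ξ) ≤ b ^ γ * wt γ ξ := by
  have e : b ^ γ = (b ^ 2) ^ (γ / 2) := by
    rw [← Real.rpow_natCast, ← Real.rpow_mul (by positivity)]; congr 1; push_cast; ring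
  rw [wt, wt, e, ← Real.mul_rpow (by positivity) (by positivity)]
  apply Real.rpow_le_rpow (by positivity) _ (by positivity)
  rw [norm_smul, Real.norm_of_nonneg (by positivity)]
  nlinarith [one_le_pow₀ (n := 2) hb]

lemma rpow_mul_le_wt_smul {b γ : ℝ} (hb : 0 ≤ b) (hγ : 0 ≤ γ) (ξ : Space d) :
    b ^ γ * (2 * Real.pi * ‖ξ‖) ^ γ ≤ wt γ (b • ξ) := by
  have e : b ^ γ * (2 * Real.pi * ‖ξ‖) ^ γ = ((2 * Real.pi * ‖b • ξ‖) ^ 2) ^ (γ / 2) := by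
    rw [← Real.rpow_natCast, ← Real.rpow_mul (by positivity), ← Real.mul_rpow hb (by positivity),
      norm_smul, Real.norm_of_nonneg hb]
    congr 1
    · ring
    · push_cast; ring
  rw [e, wt]
  exact Real.rpow_le_rpow (by positivity) (by linarith) (by positivity)

lemma rpow_half_sub_sq {b : ℝ} (hb : 0 < b) (γ : ℝ) :
    (b ^ ((d : ℝ) / 2 - γ)) ^ 2 * (b ^ d)⁻¹ * (b ^ γ) ^ 2 = 1 := by
  rw [← Real.rpow_natCast, ← Real.rpow_natCast, ← Real.rpow_natCast, ← Real.rpow_mul hb.le,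
    ← Real.rpow_mul hb.le, ← Real.rpow_neg hb.le, ← Real.rpow_add hb, ← Real.rpow_add hb]
  convert Real.rpow_zero b using 2
  push_cast; ring

/-- The Sobolev norm of a rescaled function, squared. -/
lemma sobolevNorm_scale_sq {b ε : ℝ} (hb : 0 < b) (hε : 0 < ε) (γ : ℝ) (f : L2 d) :
    sobolevNorm γ ((ε * b ^ ((d : ℝ) / 2 - γ)) • dilL2 hb f) ^ 2 =
      ∫⁻ ξ, ENNReal.ofReal (ε * (b ^ γ)⁻¹ * wt γ (b • ξ)) ^ 2 * ‖(𝓕 f : L2 d) ξ‖ₑ ^ 2 := by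
  rw [sobolevNorm_real_smul _ (by positivity), mul_pow, sobolevNorm_dilL2_sq, ← mul_assoc,
    ← ENNReal.ofReal_pow (by positivity), ← ENNReal.ofReal_mul (by positivity),
    ← lintegral_const_mul' _ _ ENNReal.ofReal_ne_top]
  congr 1
  ext ξ
  have hw := wt_nonneg γ (b • ξ)
  rw [← mul_assoc, ← ENNReal.ofReal_mul (by positivity), ← ENNReal.ofReal_pow (by positivity)]
  congr 2
  have h := rpow_half_sub_sq (d := d) hb γ
  have hbγ : b ^ γ ≠ 0 := (Real.rpow_pos_of_pos hb γ).ne'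
  field_simp
  field_simp at h
  linear_combination (wt γ (b • ξ) ^ 2) * h

theorem normInflation_of_pos {ν μ γ : ℝ} {k : ℕ} (E : Exponents d ν k) (hd : 1 ≤ d)
    (hμ : μ = 1 ∨ μ = -1) (hγ : 0 < γ) (hγc : γ < criticalExponent d ν) :
    NormInflation d ν μ k γ := by
  intro ε hε
  have hν := E.one_lt
  have hν' : 0 < ν - 1 := by linarith
  have hγk : γ ≤ k := by
    have h1 := E.half_lt
    have : 0 < 4 / (ν - 1) := by positivity
    rw [criticalExponent] at hγc
    linarith
  set φ : 𝓢(Space d, ℂ) := gauss one_pos with hφ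
  set ε₀ := ε / (sob γ φ + 1) with hε₀
  have hsob := sob_nonneg γ φ
  have hε₀0 : 0 < ε₀ := by positivity
  obtain ⟨τ₀, hτ₀⟩ := exists_le_norm_homB_twist hd hν' hγ hγk (ε₀⁻¹ * ε⁻¹ + 2)
  set T := max 1 τ₀
  have hT : 0 < T := by positivity
  have hμT : |μ * T * 1 ^ (ν - 1)| = T := by
    rcases hμ with rfl | rfl <;> simp [abs_of_pos hT]
  have hlow := hτ₀ (μ * T * 1 ^ (ν - 1)) (by rw [hμT]; exact le_max_right _ _)
  set y : ℝ → L2 d := fun t ↦ (profile k (twist hν' (μ * t * 1 ^ (ν - 1))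
    (((1 : ℝ) : ℂ) • gauss one_pos : 𝓢(Space d, ℂ)))).toLp 2 volume with hy
  have hone : (((1 : ℝ) : ℂ) • gauss one_pos : 𝓢(Space d, ℂ)) = φ := by
    rw [Complex.ofReal_one, one_smul]
  obtain ⟨κ₀, hκ₀, hmild⟩ := exists_mild_small_dispersion isometryGroup_flow (locLip_force E μ) hT.le
    (y := y) (fun t _ ↦ (hasDerivAt_twist E hν' μ zero_le_one t).hasDerivWithinAt) one_pos
  obtain ⟨b, ⟨hb1, hb2⟩, hb⟩ := ((eventually_scale hν hγc T hε₀0 hκ₀ hε).and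
    (eventually_ge_atTop 1)).exists
  have hb0 : 0 < b := by linarith
  set A := ε₀ * b ^ ((d : ℝ) / 2 - γ) with hA
  have hA0 : 0 < A := by positivity
  have hAp : 0 < A ^ (ν - 1) := by positivity
  obtain ⟨h, hm, h0, hclose⟩ := hmild (b ^ 4 / A ^ (ν - 1)) (by positivity) hb1
  have h0' : h 0 = (profile k φ).toLp 2 volume := by
    rw [h0, hy]; simp only; rw [hone]
    congr 2
    ext x; rw [twist_apply]; simp
  refine ⟨_, T / A ^ (ν - 1), _, by positivity, hb2,
    hm.isSolution_scale E hA0 hb0 (by field_simp) h0', ?_, ?_⟩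
  · have hle : sobolevNorm γ ((((A : ℝ) : ℂ) • dilS hb0 φ).toLp 2 volume) ^ 2 ≤
        ENNReal.ofReal ((ε₀ * sob γ φ) ^ 2) := by
      rw [toLp_real_smul, ← dilL2_toLp, hA, sobolevNorm_scale_sq hb0 hε₀0, mul_pow,
        ENNReal.ofReal_mul (by positivity), ENNReal.ofReal_pow hsob, ← sobolevNorm_toLp, sobolevNorm,
        eLpNorm_two_sq, ← lintegral_const_mul' _ _ ENNReal.ofReal_ne_top]
      refine lintegral_mono fun ξ ↦ ?_
      rw [enorm_mul, mul_pow, ← mul_assoc]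
      gcongr
      change _ ≤ _ * ‖((wt γ ξ : ℝ) : ℂ)‖ₑ ^ 2
      have hw := wt_nonneg γ (b • ξ)
      rw [← ofReal_norm, Complex.norm_real, Real.norm_of_nonneg (wt_nonneg _ _),
        ← ENNReal.ofReal_pow (wt_nonneg _ _), ← ENNReal.ofReal_mul (by positivity), ← mul_pow,
        ← ENNReal.ofReal_pow (by positivity)]
      refine ENNReal.ofReal_le_ofReal (pow_le_pow_left₀ (by positivity) ?_ 2)
      rw [mul_assoc]
      refine mul_le_mul_of_nonneg_left ?_ hε₀0.le
      rw [← div_eq_inv_mul, div_le_iff₀ (by positivity), mul_comm]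
      exact wt_smul_le hb hγ.le ξ
    rw [ENNReal.ofReal_pow (by positivity)] at hle
    refine ((ENNReal.pow_le_pow_left_iff (by norm_num)).1 hle).trans_lt ?_
    rw [ENNReal.ofReal_lt_ofReal_iff hε, hε₀, div_mul_eq_mul_div, div_lt_iff₀ (by positivity)]
    nlinarith
  · have e : A ^ (ν - 1) * (T / A ^ (ν - 1)) = T := by field_simp
    simp only [e]
    have hyT := hclose T ⟨hT.le, le_rfl⟩
    set m := homB (d := d) hγ.le hγk
    have hnorm : ε₀⁻¹ * ε⁻¹ + 1 ≤ ‖mulL2 m (h T)‖ := by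
      have h1 := norm_homB_le hγ.le hγk (h T - y T)
      have h2 : ‖mulL2 m (y T)‖ ≤ ‖mulL2 m (h T)‖ + ‖mulL2 m (h T - y T)‖ := by
        rw [map_sub]
        have := norm_sub_norm_le (mulL2 m (y T)) (mulL2 m (h T))
        rw [norm_sub_rev] at this; linarith
      have h3 : ε₀⁻¹ * ε⁻¹ + 2 ≤ ‖mulL2 m (y T)‖ := by
        rw [hy]; simp only; rw [hone]; exact hlow
      linarith
    have hge : ENNReal.ofReal ((ε₀ * ‖mulL2 m (h T)‖) ^ 2) ≤
        sobolevNorm γ (A • dilL2 hb0 (ofProfile k (h T))) ^ 2 := by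
      rw [hA, sobolevNorm_scale_sq hb0 hε₀0, mul_pow, ENNReal.ofReal_mul (by positivity),
        ofReal_norm_sq_eq_lintegral, ← lintegral_const_mul' _ _ ENNReal.ofReal_ne_top]
      refine lintegral_mono_ae ?_
      filter_upwards [mulL2_coe m (h T), fourier_ofProfile_coe k (h T)] with ξ h1 h2
      rw [h1, h2, enorm_mul, enorm_mul, mul_pow, mul_pow, ← mul_assoc, ← mul_assoc]
      refine mul_le_mul' ?_ le_rfl
      rw [homB_apply, ← ofReal_norm, ← ofReal_norm, Complex.norm_real, Complex.norm_real,
        Real.norm_of_nonneg (wt_nonneg _ _),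
        Real.norm_of_nonneg (mul_nonneg (by positivity) (wt_nonneg _ _)),
        ENNReal.ofReal_pow hε₀0.le, ← mul_pow, ← mul_pow, ← ENNReal.ofReal_mul hε₀0.le,
        ← ENNReal.ofReal_mul (mul_nonneg (by positivity) (wt_nonneg _ _))]
      refine pow_le_pow_left' (ENNReal.ofReal_le_ofReal ?_) 2
      rw [← mul_assoc]
      refine mul_le_mul_of_nonneg_right ?_ (wt_nonneg _ _)
      rw [mul_assoc ε₀]
      refine mul_le_mul_of_nonneg_left ?_ hε₀0.le
      rw [← div_eq_inv_mul, le_div_iff₀ (by positivity), mul_comm]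
      exact rpow_mul_le_wt_smul hb0.le hγ.le ξ
    rw [ENNReal.ofReal_pow (by positivity)] at hge
    refine lt_of_lt_of_le ?_ ((ENNReal.pow_le_pow_left_iff (by norm_num)).1 hge)
    rw [ENNReal.ofReal_lt_ofReal_iff (mul_pos hε₀0 (lt_of_lt_of_le (by positivity) hnorm))]
    calc ε⁻¹ = ε₀ * (ε₀⁻¹ * ε⁻¹) := by field_simp
      _ < ε₀ * ‖mulL2 m (h T)‖ := by gcongr; linarith

/-! ### Decoherence -/

lemma norm_scale {b ε : ℝ} (hb : 0 < b) (hε : 0 < ε) (f : L2 d) :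
    ‖(ε * b ^ ((d : ℝ) / 2 - 0)) • dilL2 hb f‖ = ε * ‖f‖ := by
  have h1 := norm_dilL2_sq hb f
  have h2 := rpow_half_sub_sq (d := d) hb 0
  rw [norm_smul, Real.norm_of_nonneg (by positivity), ← sq_eq_sq₀ (by positivity) (by positivity),
    mul_pow, mul_pow, mul_pow, h1]
  simp only [Real.rpow_zero, one_pow, mul_one] at h2
  linear_combination (ε ^ 2 * ‖f‖ ^ 2) * h2

lemma norm_toLp_twist_sub {c : ℝ} (hc : 0 < c) (τ₁ τ₂ : ℝ) (f : 𝓢(Space d, ℂ)) :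
    ‖(twist hc τ₁ f - twist hc τ₂ f).toLp 2 volume‖ = ‖(twist hc (τ₁ - τ₂) f - f).toLp 2 volume‖ := by
  have key : ∀ x, ‖(twist hc τ₁ f - twist hc τ₂ f) x‖ = ‖(twist hc (τ₁ - τ₂) f - f) x‖ := by
    intro x
    rw [_root_.sub_apply, _root_.sub_apply, twist_apply, twist_apply, twist_apply]
    set g := Real.exp (-c * ‖x‖ ^ 2)
    have e : Complex.exp (Complex.I * (τ₁ * g : ℝ)) * f x - Complex.exp (Complex.I * (τ₂ * g : ℝ)) * f x =
        Complex.exp (((τ₂ * g : ℝ) : ℂ) * Complex.I) *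
          (Complex.exp (Complex.I * ((τ₁ - τ₂) * g : ℝ)) * f x - f x) := by
      have : Complex.exp (Complex.I * (τ₁ * g : ℝ)) = Complex.exp (((τ₂ * g : ℝ) : ℂ) * Complex.I) *
          Complex.exp (Complex.I * ((τ₁ - τ₂) * g : ℝ)) := by
        rw [← Complex.exp_add]; congr 1; push_cast; ring
      rw [this, mul_comm Complex.I ((τ₂ * g : ℝ) : ℂ)]; ring
    rw [e, norm_mul, Complex.norm_exp_ofReal_mul_I, one_mul]
  exact le_antisymm (norm_toLp_le_of_le fun x ↦ (key x).le) (norm_toLp_le_of_le fun x ↦ (key x).ge)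

lemma norm_toLp_pos {f : 𝓢(Space d, ℂ)} {x : Space d} (hx : f x ≠ 0) : 0 < ‖f.toLp 2 volume‖ := by
  rw [norm_pos_iff]
  intro h0
  have : f = 0 := SchwartzMap.injective_toLp 2 volume (h0.trans rfl)
  exact hx (by rw [this]; rfl)

theorem decoherence {ν μ : ℝ} {k : ℕ} (E : Exponents d ν k) (hμ : μ = 1 ∨ μ = -1)
    (hγc : 0 < criticalExponent d ν) : Decoherence d ν μ k := by
  have hν := E.one_lt
  have hν' : 0 < ν - 1 := by linarith
  set φ : 𝓢(Space d, ℂ) := gauss one_pos with hφ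
  set P := ‖φ.toLp 2 volume‖ with hP
  have hP0 : 0 < P := norm_toLp_pos (x := 0) (by simp [hφ, gauss_apply])
  set c₁ := ‖(twist hν' μ φ - φ).toLp 2 volume‖ with hc₁
  have hc₁0 : 0 < c₁ := by
    refine norm_toLp_pos (x := 0) ?_
    rw [_root_.sub_apply, twist_apply, hφ, gauss_apply]
    simp only [norm_zero, ne_eq, OfNat.ofNat_ne_zero, not_false_eq_true, zero_pow, mul_zero,
      Real.exp_zero, mul_one, Complex.ofReal_one, sub_eq_zero]
    intro h
    have him := congrArg Complex.im h
    rw [mul_comm, Complex.exp_ofReal_mul_I_im, Complex.one_im] at him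
    have hs := Real.sin_pos_of_pos_of_le_one one_pos le_rfl
    rcases hμ with rfl | rfl
    · linarith
    · rw [Real.sin_neg] at him; linarith
  refine ⟨c₁ / (2 * P), by positivity, fun R σ τ hR hσ hτ ↦ ?_⟩
  set δ := min (1 / 2) (min (c₁ / (4 * P)) (σ / (2 * R)))
  have hδ0 : 0 < δ := by positivity
  have hδ1 : δ ≤ 1 / 2 := min_le_left _ _
  have hδ2 : δ * P ≤ c₁ / 4 := by
    have : δ ≤ c₁ / (4 * P) := (min_le_right _ _).trans (min_le_left _ _)
    rw [le_div_iff₀ (by positivity)] at this; linarith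
  have hδ3 : δ * R < σ := by
    have : δ ≤ σ / (2 * R) := (min_le_right _ _).trans (min_le_right _ _)
    rw [le_div_iff₀ (by positivity)] at this; linarith
  set a := 1 - δ with ha
  have ha0 : 0 < a := by linarith
  have hap : a ^ (ν - 1) < 1 := Real.rpow_lt_one ha0.le (by linarith) hν'
  set T := 1 / (1 - a ^ (ν - 1)) with hT
  have hT0 : 0 < T := div_pos one_pos (by linarith)
  set R₀ := R / P with hR₀
  have hR₀0 : 0 < R₀ := by positivity
  have hex := fun (a : ℝ) (ha : 0 ≤ a) ↦ exists_mild_small_dispersion isometryGroup_flow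
    (locLip_force E μ) hT0.le
    (y := fun t ↦ (profile k (twist hν' (μ * t * a ^ (ν - 1))
      ((a : ℂ) • φ : 𝓢(Space d, ℂ)))).toLp 2 volume)
    (fun t _ ↦ (hasDerivAt_twist E hν' μ ha t).hasDerivWithinAt) (η := c₁ / 8) (by positivity)
  obtain ⟨κ₁, hκ₁, hm₁⟩ := hex 1 zero_le_one
  obtain ⟨κ₂, hκ₂, hm₂⟩ := hex a ha0.le
  obtain ⟨b, ⟨hb1, hb2⟩, hb⟩ := ((eventually_scale hν hγc T hR₀0 (lt_min hκ₁ hκ₂) hτ).and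
    (eventually_ge_atTop 1)).exists
  have hb0 : 0 < b := by linarith
  set A := R₀ * b ^ ((d : ℝ) / 2 - 0) with hA
  have hA0 : 0 < A := by positivity
  have hAp : 0 < A ^ (ν - 1) := by positivity
  obtain ⟨h₁, hmild₁, h₁0, hcl₁⟩ := hm₁ (b ^ 4 / A ^ (ν - 1)) (by positivity)
    (hb1.trans_le (min_le_left _ _))
  obtain ⟨h₂, hmild₂, h₂0, hcl₂⟩ := hm₂ (b ^ 4 / A ^ (ν - 1)) (by positivity)
    (hb1.trans_le (min_le_right _ _))
  have htw : ∀ f : 𝓢(Space d, ℂ), twist hν' 0 f = f := by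
    intro f; ext x; rw [twist_apply]; simp
  simp only [mul_zero, zero_mul, htw] at h₁0 h₂0
  have hnorm : ∀ f : 𝓢(Space d, ℂ), ‖((A : ℂ) • dilS hb0 f).toLp 2 volume‖ =
      R₀ * ‖f.toLp 2 volume‖ := by
    intro f
    rw [toLp_real_smul, ← dilL2_toLp, hA, norm_scale hb0 hR₀0]
  have hsm : ∀ a : ℝ, 0 ≤ a → ‖((a : ℂ) • φ).toLp 2 volume‖ = a * P := by
    intro a ha
    rw [toLp_smul, norm_smul, Complex.norm_real, Real.norm_of_nonneg ha]
  have hRP : R₀ * P = R := by rw [hR₀]; field_simp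
  refine ⟨_, _, T / A ^ (ν - 1), _, _, by positivity, hb2,
    hmild₁.isSolution_scale E hA0 hb0 (by field_simp) h₁0,
    hmild₂.isSolution_scale E hA0 hb0 (by field_simp) h₂0, ?_, ?_, ?_, ?_⟩
  · rw [hnorm, hsm 1 zero_le_one, one_mul, hRP]
  · rw [hnorm, hsm a ha0.le, mul_left_comm, hRP]
    nlinarith
  · rw [← toLp_sub, ← smul_sub]
    have e : dilS hb0 (((1 : ℝ) : ℂ) • φ) - dilS hb0 ((a : ℂ) • φ) = dilS hb0 ((δ : ℂ) • φ) := by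
      ext x
      simp only [_root_.sub_apply, dilS_apply, _root_.smul_apply, smul_eq_mul]
      rw [ha]; push_cast; ring
    rw [e, hnorm, hsm δ hδ0.le, mul_left_comm, hRP]
    exact hδ3
  · have e : A ^ (ν - 1) * (T / A ^ (ν - 1)) = T := by field_simp
    simp only [e]
    rw [← smul_sub, ← map_sub, hA, norm_scale hb0 hR₀0, ← map_sub]
    set y₁ := twist hν' (μ * T * 1 ^ (ν - 1)) (((1 : ℝ) : ℂ) • φ : 𝓢(Space d, ℂ))
    set y₂ := twist hν' (μ * T * a ^ (ν - 1)) ((a : ℂ) • φ : 𝓢(Space d, ℂ))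
    have hT1 := hcl₁ T ⟨hT0.le, le_rfl⟩
    have hT2 := hcl₂ T ⟨hT0.le, le_rfl⟩
    have hdiff : c₁ - δ * P ≤ ‖(y₁ - y₂).toLp 2 volume‖ := by
      have e2 : y₁ - y₂ = (twist hν' (μ * T) φ - twist hν' (μ * T * a ^ (ν - 1)) φ) +
          twist hν' (μ * T * a ^ (ν - 1)) ((δ : ℂ) • φ) := by
        ext x
        simp only [y₁, y₂, _root_.sub_apply, _root_.add_apply, twist_apply, _root_.smul_apply,
          smul_eq_mul, Real.one_rpow, mul_one]
        rw [ha]; push_cast; ring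
      rw [e2, toLp_add]
      have e3 : ‖(twist hν' (μ * T) φ - twist hν' (μ * T * a ^ (ν - 1)) φ).toLp 2 volume‖ = c₁ := by
        rw [norm_toLp_twist_sub, hc₁]
        congr 4
        have : T * (1 - a ^ (ν - 1)) = 1 := by rw [hT]; exact one_div_mul_cancel (by linarith)
        linear_combination μ * this
      have e4 : ‖(twist hν' (μ * T * a ^ (ν - 1)) ((δ : ℂ) • φ)).toLp 2 volume‖ = δ * P := by
        rw [norm_toLp_twist, hsm δ hδ0.le]
      have := norm_sub_norm_le ((twist hν' (μ * T) φ - twist hν' (μ * T * a ^ (ν - 1)) φ).toLp 2 volume)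
        (-(twist hν' (μ * T * a ^ (ν - 1)) ((δ : ℂ) • φ)).toLp 2 volume)
      rw [norm_neg, e3, e4, sub_neg_eq_add] at this
      exact this
    have hJ : (y₁ - y₂).toLp 2 volume = ofProfile k ((profile k y₁).toLp 2 volume -
        (profile k y₂).toLp 2 volume) := by
      rw [map_sub, ofProfile_profile, ofProfile_profile, toLp_sub]
    have hfin : ‖(y₁ - y₂).toLp 2 volume‖ ≤ ‖ofProfile k (h₁ T - h₂ T)‖ + (c₁ / 8 + c₁ / 8) := by
      rw [hJ]
      have e5 : (profile k y₁).toLp 2 volume - (profile k y₂).toLp 2 volume =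
          (h₁ T - h₂ T) + (-(h₁ T - (profile k y₁).toLp 2 volume) +
            (h₂ T - (profile k y₂).toLp 2 volume)) := by abel
      rw [e5, map_add]
      refine (norm_add_le _ _).trans (add_le_add le_rfl ((norm_ofProfile_le k _).trans
        ((norm_add_le _ _).trans (add_le_add ?_ hT2))))
      rw [norm_neg]; exact hT1
    have hR1 : R = R₀ * P := hRP.symm
    rw [hR1]
    have : c₁ / (2 * P) * (R₀ * P) = R₀ * (c₁ / 2) := by field_simp
    rw [this]
    gcongr
    linarith

/-! ### The nonlinearity in `L¹` -/

lemma Exponents.two_le {ν : ℝ} {k : ℕ} (E : Exponents d ν k) : 2 ≤ ν := by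
  have hν := E.one_lt
  rcases E.odd_or_le with ⟨m, hm⟩ | h
  · have : (1 : ℝ) ≤ m := by
      rw [Nat.one_le_cast, Nat.one_le_iff_ne_zero]
      rintro rfl
      simp at hm; linarith
    linarith
  · have hk : 0 < (k : ℝ) := lt_of_le_of_lt (by positivity) E.half_lt
    have : (1 : ℝ) ≤ k := by exact_mod_cast Nat.cast_pos.1 hk
    linarith

lemma lintegral_enorm_mul_enorm_le (f g : L2 d) : ∫⁻ x, ‖f x‖ₑ * ‖g x‖ₑ ≤ ‖f‖ₑ * ‖g‖ₑ := by
  have h := lintegral_mul_sq_le (A := fun x ↦ ‖f x‖ₑ) (B := fun x ↦ ‖g x‖ₑ)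
    (Lp.stronglyMeasurable f).measurable.enorm (Lp.stronglyMeasurable g).measurable.enorm
  rw [← eLpNorm_two_sq, ← eLpNorm_two_sq, ← Lp.enorm_def, ← Lp.enorm_def, ← mul_pow] at h
  exact (ENNReal.pow_le_pow_left_iff (by norm_num)).1 h

lemma lintegral_nl_sub_le {ν : ℝ} {k : ℕ} (E : Exponents d ν k) (M : ℝ) :
    ∃ C, 0 ≤ C ∧ ∀ h h₀ : L2 d, ‖h‖ ≤ M → ‖h₀‖ ≤ M →
      ∫⁻ x, ‖nl ν (ofProfile k h x) - nl ν (ofProfile k h₀ x)‖ₑ ≤ ENNReal.ofReal (C * ‖h - h₀‖) := by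
  obtain ⟨C₀, hC₀, hnl⟩ := norm_nl_sub_le E.one_lt
  obtain ⟨B, hB, hbd⟩ := ae_norm_ofProfile_le (d := d) E.half_lt
  have h2 := E.two_le
  set R := B * |M|
  refine ⟨C₀ * R ^ (ν - 2) * (|M| + |M|), by positivity, fun h h₀ hM hM₀ ↦ ?_⟩
  have hM' := hM.trans (le_abs_self M)
  have hM₀' := hM₀.trans (le_abs_self M)
  set D := ofProfile k (h - h₀)
  set K := C₀ * R ^ (ν - 2)
  calc ∫⁻ x, ‖nl ν (ofProfile k h x) - nl ν (ofProfile k h₀ x)‖ₑ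
      ≤ ∫⁻ x, ENNReal.ofReal K * (‖ofProfile k h x‖ₑ * ‖D x‖ₑ + ‖ofProfile k h₀ x‖ₑ * ‖D x‖ₑ) := by
        refine lintegral_mono_ae ?_
        filter_upwards [hbd h, hbd h₀, Lp.coeFn_sub (ofProfile k h) (ofProfile k h₀)] with x h1 h1' h3
        have hD : D x = ofProfile k h x - ofProfile k h₀ x := by
          simp only [D, map_sub]; rw [h3]; rfl
        rw [hD]
        set z := ofProfile k h x
        set w := ofProfile k h₀ x
        have hz : ‖z‖ ≤ R := h1.trans (mul_le_mul_of_nonneg_left hM' hB)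
        have hw : ‖w‖ ≤ R := h1'.trans (mul_le_mul_of_nonneg_left hM₀' hB)
        rw [← add_mul, ← ofReal_norm, ← ofReal_norm z, ← ofReal_norm w, ← ofReal_norm (z - w),
          ← ENNReal.ofReal_add (by positivity) (by positivity), ← ENNReal.ofReal_mul (by positivity),
          ← ENNReal.ofReal_mul (by positivity)]
        refine ENNReal.ofReal_le_ofReal ((hnl z w).trans ?_)
        rw [← mul_assoc]
        refine mul_le_mul_of_nonneg_right ?_ (norm_nonneg _)
        have hm0 : 0 ≤ max ‖z‖ ‖w‖ := le_max_of_le_left (norm_nonneg _)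
        have e : max ‖z‖ ‖w‖ ^ (ν - 1) = max ‖z‖ ‖w‖ ^ (ν - 2) * max ‖z‖ ‖w‖ := by
          rw [← Real.rpow_add_one' hm0 (by linarith)]; congr 1; ring
        rw [e, ← mul_assoc]
        refine mul_le_mul ?_ (max_le_add_of_nonneg (norm_nonneg _) (norm_nonneg _)) hm0 (by positivity)
        exact mul_le_mul_of_nonneg_left (Real.rpow_le_rpow hm0 (max_le hz hw) (by linarith)) hC₀
    _ = ENNReal.ofReal K * ((∫⁻ x, ‖ofProfile k h x‖ₑ * ‖D x‖ₑ) +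
          ∫⁻ x, ‖ofProfile k h₀ x‖ₑ * ‖D x‖ₑ) := by
        rw [lintegral_const_mul' _ _ ENNReal.ofReal_ne_top, lintegral_add_left]
        exact (Lp.stronglyMeasurable _).measurable.enorm.mul (Lp.stronglyMeasurable _).measurable.enorm
    _ ≤ ENNReal.ofReal K * (ENNReal.ofReal |M| * ENNReal.ofReal ‖h - h₀‖ +
          ENNReal.ofReal |M| * ENNReal.ofReal ‖h - h₀‖) := by
        have key : ∀ g : L2 d, ‖g‖ ≤ |M| → ∫⁻ x, ‖ofProfile k g x‖ₑ * ‖D x‖ₑ ≤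
            ENNReal.ofReal |M| * ENNReal.ofReal ‖h - h₀‖ := fun g hg ↦ by
          refine (lintegral_enorm_mul_enorm_le _ _).trans ?_
          rw [← ofReal_norm, ← ofReal_norm]
          exact mul_le_mul' (ENNReal.ofReal_le_ofReal ((norm_ofProfile_le k g).trans hg))
            (ENNReal.ofReal_le_ofReal (norm_ofProfile_le k _))
        gcongr
        · exact key h hM'
        · exact key h₀ hM₀'
    _ = _ := by
        rw [← ENNReal.ofReal_mul (by positivity), ← ENNReal.ofReal_add (by positivity) (by positivity),
          ← ENNReal.ofReal_mul (by positivity)]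
        congr 1; ring

lemma integrable_nl_ofProfile {ν : ℝ} {k : ℕ} (E : Exponents d ν k) (h : L2 d) :
    Integrable (fun x ↦ nl ν (ofProfile k h x)) := by
  obtain ⟨C, -, hC⟩ := lintegral_nl_sub_le E ‖h‖
  refine ⟨(continuous_nl E.one_lt).comp_aestronglyMeasurable (Lp.aestronglyMeasurable _), ?_⟩
  refine lt_of_le_of_lt ?_ ((hC h 0 le_rfl (by simp)).trans_lt ENNReal.ofReal_lt_top)
  refine lintegral_mono_ae ?_
  filter_upwards [Lp.coeFn_zero ℂ 2 (volume : Measure (Space d))] with x hx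
  rw [map_zero, hx]; simp

lemma integral_norm_nl_sub_le {ν : ℝ} {k : ℕ} (E : Exponents d ν k) (M : ℝ) :
    ∃ C, 0 ≤ C ∧ ∀ h h₀ : L2 d, ‖h‖ ≤ M → ‖h₀‖ ≤ M →
      ∫ x, ‖nl ν (ofProfile k h x) - nl ν (ofProfile k h₀ x)‖ ≤ C * ‖h - h₀‖ := by
  obtain ⟨C, hC0, hC⟩ := lintegral_nl_sub_le E M
  refine ⟨C, hC0, fun h h₀ hM hM₀ ↦ ?_⟩
  have hm := ((integrable_nl_ofProfile E h).sub (integrable_nl_ofProfile E h₀)).aestronglyMeasurable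
  refine (integral_norm_eq_lintegral_enorm hm).trans_le ?_
  exact ENNReal.toReal_le_of_le_ofReal (by positivity) (hC h h₀ hM hM₀)

/-! ### Data without low frequencies -/

lemma exists_bump {r : ℝ} (hr : 0 < r) :
    ∃ χ : ContDiffBump (0 : Space d), χ.rIn = r / 2 ∧ χ.rOut = r :=
  ⟨⟨r / 2, r, by positivity, by linarith⟩, rfl, rfl⟩

lemma integral_nl_gauss_ne_zero {ν : ℝ} (hν : 1 < ν) :
    ∫ x, nl ν ((gauss one_pos : 𝓢(Space d, ℂ)) x) ≠ 0 := by
  have hν0 : 0 < ν := by linarith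
  have e : ∀ x : Space d, nl ν (gauss one_pos x) = ((Real.exp (-ν * ‖x‖ ^ 2) : ℝ) : ℂ) := by
    intro x
    rw [nl, gauss_apply, Complex.norm_real, Real.norm_of_nonneg (Real.exp_pos _).le, ← Real.exp_mul,
      ← Complex.ofReal_mul, ← Real.exp_add]
    congr 2; ring
  simp only [e]
  rw [integral_complex_ofReal, Ne, Complex.ofReal_eq_zero]
  exact (integral_exp_pos (gaussR hν0 : 𝓢(Space d, ℝ)).integrable).ne'

lemma nl_ofProfile_profile_ae (ν : ℝ) (k : ℕ) (f : 𝓢(Space d, ℂ)) :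
    (fun x ↦ nl ν (ofProfile k ((profile k f).toLp 2 volume) x)) =ᵐ[volume] fun x ↦ nl ν (f x) := by
  rw [ofProfile_profile]
  filter_upwards [f.coeFn_toLp 2 volume] with x hx
  rw [hx]

lemma exists_datum {ν : ℝ} {k : ℕ} (E : Exponents d ν k) (hd : 1 ≤ d) :
    ∃ (φ : 𝓢(Space d, ℂ)) (r : ℝ), 0 < r ∧ (∀ ξ, ‖ξ‖ ≤ r → 𝓕 φ ξ = 0) ∧ ∫ x, nl ν (φ x) ≠ 0 := by
  set g : 𝓢(Space d, ℂ) := gauss one_pos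
  obtain ⟨χ, hin, hout⟩ := exists_bump (d := d) (r := 2) two_pos
  have hcs : HasCompactSupport (fun x ↦ (χ x : ℂ)) := χ.hasCompactSupport.comp_left Complex.ofReal_zero
  have hsm : ContDiff ℝ (⊤ : ℕ∞) (fun x ↦ (χ x : ℂ)) := Complex.ofRealCLM.contDiff.comp χ.contDiff
  set X : 𝓢(Space d, ℂ) := hcs.toSchwartzMap hsm
  have hX : ∀ ξ, X ξ = (χ ξ : ℂ) := fun ξ ↦ rfl
  set x₀ := (profile k g).toLp 2 volume with hx₀
  obtain ⟨S, hS⟩ : ∃ S, ∀ ξ, ‖profile k g ξ‖ ≤ S := by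
    refine ⟨_, (profile k g).norm_le_seminorm ℝ⟩
  have hS0 : 0 ≤ S := (norm_nonneg _).trans (hS 0)
  obtain ⟨C, hC0, hC⟩ := integral_norm_nl_sub_le E (‖x₀‖ + 1)
  set I := ∫ x, nl ν (g x) with hI
  have hI0 : 0 < ‖I‖ := norm_pos_iff.2 (integral_nl_gauss_ne_zero E.one_lt)
  set η := min 1 (‖I‖ / (2 * (C + 1)))
  have hη : 0 < η := by positivity
  have hCη : C * η < ‖I‖ := by
    have : η ≤ ‖I‖ / (2 * (C + 1)) := min_le_right _ _
    rw [le_div_iff₀ (by positivity)] at this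
    nlinarith
  -- the scale of the cut-off
  obtain ⟨b, hb, hbη⟩ : ∃ b : ℝ, ∃ hb : 0 < b, S * ‖dilL2 hb (X.toLp 2 volume)‖ ≤ η := by
    set L := S ^ 2 * ‖X.toLp 2 volume‖ ^ 2
    have hL : 0 ≤ L := by positivity
    refine ⟨max 1 (L / η ^ 2), by positivity, ?_⟩
    set b := max 1 (L / η ^ 2)
    have hb : 0 < b := by positivity
    have h1 : (1 : ℝ) ≤ b := le_max_left _ _
    have h2 : L ≤ η ^ 2 * b ^ d := by
      have : L / η ^ 2 ≤ b ^ d := (le_max_right _ _).trans (le_self_pow₀ h1 (by omega))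
      rw [div_le_iff₀ (by positivity)] at this; linarith
    refine le_of_sq_le_sq ?_ hη.le
    rw [mul_pow, norm_dilL2_sq hb, mul_left_comm, ← div_eq_inv_mul, div_le_iff₀ (by positivity)]
    exact h2
  set f : 𝓢(Space d, ℂ) := 𝓕⁻ (𝓕 g - mulS (dilS hb X) (𝓕 g)) with hf
  have hFf : 𝓕 f = 𝓕 g - mulS (dilS hb X) (𝓕 g) := FourierTransform.fourier_fourierInv_eq _
  refine ⟨f, b⁻¹, by positivity, fun ξ hξ ↦ ?_, fun h0 ↦ ?_⟩
  · rw [hFf, _root_.sub_apply, mulS_apply, dilS_apply, hX, χ.one_of_mem_closedBall]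
    · simp
    · rw [mem_closedBall_zero_iff, hin, norm_smul, Real.norm_of_nonneg hb.le]
      calc b * ‖ξ‖ ≤ b * b⁻¹ := by gcongr
        _ = 2 / 2 := by rw [mul_inv_cancel₀ hb.ne']; norm_num
  · have hdist : ‖(profile k f).toLp 2 volume - x₀‖ ≤ η := by
      rw [hx₀, ← toLp_sub]
      refine le_trans ?_ hbη
      rw [dilL2_toLp]
      refine norm_toLp_le_mul_of_le fun ξ ↦ ?_
      have : (profile k f - profile k g) ξ = -(dilS hb X ξ * profile k g ξ) := by
        rw [_root_.sub_apply, profile_apply, profile_apply, hFf, _root_.sub_apply, mulS_apply]; ring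
      rw [this, norm_neg, norm_mul, mul_comm]
      exact mul_le_mul_of_nonneg_right (hS ξ) (norm_nonneg _)
    have hle := hC ((profile k f).toLp 2 volume) x₀ (by
      have := norm_sub_norm_le ((profile k f).toLp 2 volume) x₀
      have : η ≤ 1 := min_le_left _ _
      linarith) (by linarith)
    have hint := norm_integral_le_integral_norm (μ := volume) (fun x ↦ nl ν (ofProfile k ((profile k f).toLp 2 volume) x) -
      nl ν (ofProfile k x₀ x))
    rw [integral_sub (integrable_nl_ofProfile E _) (integrable_nl_ofProfile E _),
      integral_congr_ae (nl_ofProfile_profile_ae ν k f), integral_congr_ae (nl_ofProfile_profile_ae ν k g),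
      h0, zero_sub, norm_neg] at hint
    have : C * ‖(profile k f).toLp 2 volume - x₀‖ ≤ C * η := by gcongr
    linarith

/-! ### Creation of low frequencies -/

lemma norm_fourier_phaseS_le (s : ℝ) (Q : 𝓢(Space d, ℂ)) (x : Space d) :
    ‖𝓕 (phaseS s Q) x‖ ≤ ∫ ξ, ‖Q ξ‖ := by
  rw [SchwartzMap.fourier_coe]
  refine (VectorFourier.norm_fourierIntegral_le_integral_norm _ _ _ _ _).trans (le_of_eq ?_)
  congr 1; ext ξ
  rw [phaseS_apply, norm_mul, norm_phase, one_mul]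

lemma norm_fourier_phaseS_sub_le {r : ℝ} (s : ℝ) {Q : 𝓢(Space d, ℂ)}
    (hQ : ∀ ξ, r < ‖ξ‖ → Q ξ = 0) (x : Space d) :
    ‖𝓕 (phaseS s Q) x - ∫ ξ, Q ξ‖ ≤
      (2 * Real.pi * r * ‖x‖ + |s| * (2 * Real.pi * r) ^ 4) * ∫ ξ, ‖Q ξ‖ := by
  rw [SchwartzMap.fourier_coe, Real.fourier_eq, ← integral_sub _ Q.integrable, ← integral_const_mul]
  swap
  · exact (Real.fourierIntegral_convergent_iff x).2 (phaseS s Q).integrable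
  refine norm_integral_le_of_norm_le (Q.integrable.norm.const_mul _) (ae_of_all _ fun ξ ↦ ?_)
  rcases lt_or_ge r ‖ξ‖ with hξ | hξ
  · rw [phaseS_apply, hQ ξ hξ]; simp
  have e : (Real.fourierChar (-inner ℝ ξ x)) • phaseS s Q ξ - Q ξ =
      (Complex.exp (Complex.I * ((2 * Real.pi * (-inner ℝ ξ x) + s * symb ξ : ℝ) : ℂ)) - 1) * Q ξ := by
    rw [Circle.smul_def, Real.fourierChar_apply, smul_eq_mul, phaseS_apply, phase_apply, ← mul_assoc,
      ← Complex.exp_add, sub_mul, one_mul]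
    congr 3; push_cast; ring
  rw [e, norm_mul]
  refine mul_le_mul_of_nonneg_right ?_ (norm_nonneg _)
  refine Real.norm_exp_I_mul_ofReal_sub_one_le.trans ((norm_add_le _ _).trans (add_le_add ?_ ?_))
  · rw [norm_mul, norm_neg, Real.norm_of_nonneg Real.two_pi_pos.le,
      mul_assoc (2 * Real.pi) r]
    refine mul_le_mul_of_nonneg_left ((norm_inner_le_norm ξ x).trans ?_) Real.two_pi_pos.le
    gcongr
  · rw [norm_mul, Real.norm_eq_abs, Real.norm_of_nonneg (symb_nonneg ξ), symb]
    gcongr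

lemma testProfile_fourier_phaseS (k : ℕ) (s : ℝ) (Q : 𝓢(Space d, ℂ)) :
    testProfile k (𝓕 (phaseS s Q)) = phaseS s (testProfile k (𝓕 Q)) := by
  ext ξ
  rw [testProfile_apply, phaseS_apply, testProfile_apply, fourierInv_fourier_schwartz,
    fourierInv_fourier_schwartz, phaseS_apply]
  ring

lemma norm_integral_nl_mul_fourier_sub_le {ν : ℝ} {k : ℕ} (E : Exponents d ν k) (h : L2 d)
    {φ Q : 𝓢(Space d, ℂ)} (hφ : Integrable fun x ↦ ‖x‖ * ‖nl ν (φ x)‖) {r : ℝ} (s : ℝ)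
    (hQ : ∀ ξ, r < ‖ξ‖ → Q ξ = 0) :
    ‖(∫ x, nl ν (ofProfile k h x) * 𝓕 (phaseS s Q) x) - (∫ x, nl ν (φ x)) * ∫ ξ, Q ξ‖ ≤
      ((∫ x, ‖nl ν (ofProfile k h x) - nl ν (ofProfile k ((profile k φ).toLp 2 volume) x)‖) +
        (2 * Real.pi * r * (∫ x, ‖x‖ * ‖nl ν (φ x)‖) +
          |s| * (2 * Real.pi * r) ^ 4 * ∫ x, ‖nl ν (φ x)‖)) * ∫ ξ, ‖Q ξ‖ := by
  set x₀ := (profile k φ).toLp 2 volume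
  set ψ := 𝓕 (phaseS s Q) with hψ
  set q := ∫ ξ, ‖Q ξ‖
  have hae := nl_ofProfile_profile_ae ν k φ
  have hi : Integrable fun x ↦ nl ν (φ x) := (integrable_nl_ofProfile E x₀).congr hae
  have hψm : AEStronglyMeasurable ψ volume := ψ.continuous.aestronglyMeasurable
  have himul : ∀ f : Space d → ℂ, Integrable f → Integrable fun x ↦ f x * ψ x := fun f hf ↦
    (hf.norm.mul_const q).mono' (hf.aestronglyMeasurable.mul hψm) (ae_of_all _ fun x ↦ by
      rw [norm_mul]
      exact mul_le_mul_of_nonneg_left (norm_fourier_phaseS_le s Q x) (norm_nonneg _))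
  have hidiff := (integrable_nl_ofProfile E h).sub (integrable_nl_ofProfile E x₀)
  have e : (∫ x, nl ν (ofProfile k h x) * ψ x) - (∫ x, nl ν (φ x)) * ∫ ξ, Q ξ =
      (∫ x, (nl ν (ofProfile k h x) - nl ν (ofProfile k x₀ x)) * ψ x) +
        ∫ x, nl ν (φ x) * (ψ x - ∫ ξ, Q ξ) := by
    simp only [sub_mul, mul_sub]
    rw [integral_sub (himul _ (integrable_nl_ofProfile E h)) (himul _ (integrable_nl_ofProfile E x₀)),
      integral_sub (himul _ hi) (hi.mul_const _), integral_mul_const]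
    have : ∫ x, nl ν (ofProfile k x₀ x) * ψ x = ∫ x, nl ν (φ x) * ψ x := by
      apply integral_congr_ae
      filter_upwards [hae] with x hx
      rw [hx]
    rw [this]; ring
  rw [e, add_mul]
  refine (norm_add_le _ _).trans (add_le_add ?_ ?_)
  · rw [← integral_mul_const]
    refine norm_integral_le_of_norm_le (hidiff.norm.mul_const q) (ae_of_all _ fun x ↦ ?_)
    rw [norm_mul]
    exact mul_le_mul_of_nonneg_left (norm_fourier_phaseS_le s Q x) (norm_nonneg _)
  · have hi1 : Integrable fun x ↦ 2 * Real.pi * r * (‖x‖ * ‖nl ν (φ x)‖) := hφ.const_mul _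
    have hi2 : Integrable fun x ↦ |s| * (2 * Real.pi * r) ^ 4 * ‖nl ν (φ x)‖ := hi.norm.const_mul _
    have hsum : 2 * Real.pi * r * (∫ x, ‖x‖ * ‖nl ν (φ x)‖) +
        |s| * (2 * Real.pi * r) ^ 4 * (∫ x, ‖nl ν (φ x)‖) = ∫ x, (2 * Real.pi * r * (‖x‖ * ‖nl ν (φ x)‖) +
          |s| * (2 * Real.pi * r) ^ 4 * ‖nl ν (φ x)‖) := by
      rw [integral_add hi1 hi2, integral_const_mul, integral_const_mul]
    rw [hsum, ← integral_mul_const]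
    refine norm_integral_le_of_norm_le ((hi1.add hi2).mul_const q) (ae_of_all _ fun x ↦ ?_)
    rw [norm_mul]
    refine (mul_le_mul_of_nonneg_left (norm_fourier_phaseS_sub_le s hQ x) (norm_nonneg _)).trans
      (le_of_eq ?_)
    ring

lemma integrable_norm_mul_nl {ν : ℝ} (hν : 1 < ν) (φ : 𝓢(Space d, ℂ)) :
    Integrable fun x ↦ ‖x‖ * ‖nl ν (φ x)‖ := by
  obtain ⟨S, hS⟩ : ∃ S, ∀ x, ‖φ x‖ ≤ S := ⟨_, φ.norm_le_seminorm ℝ⟩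
  have hi := (φ.integrable_pow_mul volume 1).const_mul (S ^ (ν - 1))
  refine hi.mono' (continuous_norm.mul
    ((continuous_nl hν).comp φ.continuous).norm).aestronglyMeasurable (ae_of_all _ fun x ↦ ?_)
  rw [norm_mul, norm_norm, norm_norm, norm_nl hν, pow_one, mul_left_comm]
  refine mul_le_mul_of_nonneg_left ?_ (norm_nonneg _)
  have : ‖φ x‖ ^ ν = ‖φ x‖ ^ (ν - 1) * ‖φ x‖ := by
    rw [← Real.rpow_add_one' (norm_nonneg _) (by linarith)]; congr 1; ring
  rw [this]
  exact mul_le_mul_of_nonneg_right (Real.rpow_le_rpow (norm_nonneg _) (hS x) (by linarith))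
    (norm_nonneg _)

lemma sq_mul_lintegral_le {Q : 𝓢(Space d, ℂ)} {F : L2 d} {c : ℝ} (hc : 0 ≤ c)
    (h : c * ∫ ξ, ‖Q ξ‖ ≤ ∫ ξ, ‖Q ξ‖ * ‖F ξ‖) :
    ENNReal.ofReal (c ^ 2) * ∫⁻ ξ, ‖Q ξ‖ₑ ≤ ∫⁻ ξ, ‖Q ξ‖ₑ * ‖F ξ‖ₑ ^ 2 := by
  set A := ∫⁻ ξ, ‖Q ξ‖ₑ with hA
  have hAfin : A ≠ ∞ := Q.integrable.2.ne
  have hFm : Measurable fun ξ ↦ ‖F ξ‖ₑ := (Lp.stronglyMeasurable F).measurable.enorm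
  have hQm : Measurable fun ξ ↦ ‖Q ξ‖ₑ := Q.continuous.measurable.enorm
  have h1 : ENNReal.ofReal c * A ≤ ∫⁻ ξ, ‖Q ξ‖ₑ * ‖F ξ‖ₑ := by
    have e : ENNReal.ofReal (∫ ξ, ‖Q ξ‖) = A := ofReal_integral_norm_eq_lintegral_enorm Q.integrable
    rw [← e, ← ENNReal.ofReal_mul hc]
    refine (ENNReal.ofReal_le_ofReal h).trans ?_
    have hn : ENNReal.ofReal (∫ ξ, ‖Q ξ‖ * ‖F ξ‖) = ‖∫ ξ, ‖Q ξ‖ * ‖F ξ‖‖ₑ := by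
      rw [← ofReal_norm, Real.norm_of_nonneg (integral_nonneg fun ξ ↦ by positivity)]
    rw [hn]
    refine (enorm_integral_le_lintegral_enorm _).trans (le_of_eq ?_)
    simp only [enorm_mul, enorm_norm]
  have h2 := lintegral_mul_sq_le (A := fun ξ ↦ ‖Q ξ‖ₑ ^ (1 / 2 : ℝ))
    (B := fun ξ ↦ ‖Q ξ‖ₑ ^ (1 / 2 : ℝ) * ‖F ξ‖ₑ) (hQm.pow_const _) ((hQm.pow_const _).mul hFm)
  have e2 : ∀ x : ℝ≥0∞, x ^ (1 / 2 : ℝ) * x ^ (1 / 2 : ℝ) = x := fun x ↦ by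
    rw [← ENNReal.rpow_add_of_nonneg _ _ (by norm_num) (by norm_num)]; norm_num
  simp only [mul_pow, ← mul_assoc, e2, sq (_ ^ (1 / 2 : ℝ))] at h2
  have h3 : A * (ENNReal.ofReal (c ^ 2) * A) ≤ A * ∫⁻ ξ, ‖Q ξ‖ₑ * ‖F ξ‖ₑ ^ 2 := by
    refine le_trans (le_of_eq ?_) ((pow_le_pow_left' h1 2).trans h2)
    rw [ENNReal.ofReal_pow hc]; ring
  rcases eq_or_ne A 0 with h0 | h0
  · rw [h0]; simp
  · exact (ENNReal.mul_le_mul_iff_right h0 hAfin).1 h3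

/-- The nonlinearity creates low frequencies, uniformly in the strength of the dispersion. -/
lemma exists_low_frequency {ν μ : ℝ} {k : ℕ} (E : Exponents d ν k) (hd : 1 ≤ d)
    (hμ : μ = 1 ∨ μ = -1) :
    ∃ (φ : 𝓢(Space d, ℂ)) (r₀ r c T κ₀ : ℝ), 0 < r₀ ∧ 0 < r ∧ 0 < c ∧ 0 < T ∧ 0 < κ₀ ∧
      (∀ ξ, ‖ξ‖ ≤ r₀ → 𝓕 φ ξ = 0) ∧ ∀ κ, 0 < κ → κ < κ₀ → ∃ h, Mild flow (force ν μ k) κ T h ∧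
        h 0 = (profile k φ).toLp 2 volume ∧ ∀ Q : 𝓢(Space d, ℂ), (∀ ξ, Q ξ = (‖Q ξ‖ : ℂ)) →
          (∀ ξ, r < ‖ξ‖ → Q ξ = 0) →
          c * ∫ ξ, ‖Q ξ‖ ≤ ∫ ξ, ‖Q ξ‖ * ‖(𝓕 (ofProfile k (h T)) : L2 d) ξ‖ := by
  obtain ⟨φ, r₀, hr₀, hφ, hI⟩ := exists_datum E hd
  set x₀ := (profile k φ).toLp 2 volume with hx₀
  set I₀ := ∫ x, nl ν (φ x) with hI₀
  set a := ‖I₀‖ with ha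
  have ha0 : 0 < a := norm_pos_iff.2 hI
  set n₁ := ∫ x, ‖nl ν (φ x)‖ with hn₁
  set n₂ := ∫ x, ‖x‖ * ‖nl ν (φ x)‖ with hn₂
  have hn₁0 : 0 ≤ n₁ := integral_nonneg fun x ↦ norm_nonneg _
  have hn₂0 : 0 ≤ n₂ := integral_nonneg fun x ↦ by positivity
  have hn₂i : Integrable fun x ↦ ‖x‖ * ‖nl ν (φ x)‖ := integrable_norm_mul_nl E.one_lt φ
  obtain ⟨C, hC0, hC⟩ := integral_norm_nl_sub_le E (‖x₀‖ + 2)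
  set η := min 1 (a / (8 * (C + 1)))
  have hη : 0 < η := by positivity
  have hη1 : η ≤ 1 := min_le_left _ _
  have hCη : C * (2 * η) ≤ a / 4 := by
    have : η ≤ a / (8 * (C + 1)) := min_le_right _ _
    rw [le_div_iff₀ (by positivity)] at this
    nlinarith
  set r := min r₀ (a / (8 * Real.pi * (n₂ + 1)))
  have hr : 0 < r := by positivity
  have hrn : 2 * Real.pi * r * n₂ ≤ a / 4 := by
    have h1 : r ≤ a / (8 * Real.pi * (n₂ + 1)) := min_le_right _ _
    rw [le_div_iff₀ (by positivity)] at h1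
    have : 0 ≤ Real.pi * r := by positivity
    nlinarith
  obtain ⟨T, hT, hmild⟩ := exists_mild_local isometryGroup_flow (locLip_force E μ) ‖x₀‖ hη
  obtain ⟨s₀, hs₀, hcont⟩ := isometryGroup_flow.uniform_of_compact (isCompact_singleton (x := x₀)) hη
  set L := (2 * Real.pi * r) ^ 4 * n₁ with hL
  have hL0 : 0 ≤ L := by positivity
  refine ⟨φ, r₀, r, T * a / 4, T, min (s₀ / T) (a / (4 * (T * (L + 1)))), hr₀, hr, by positivity, hT,
    by positivity, hφ, fun κ hκ hκ₀ ↦ ?_⟩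
  obtain ⟨h, hm, h0, hclose⟩ := hmild κ x₀ le_rfl
  have hκ1 : κ * T < s₀ := (lt_div_iff₀ hT).1 (hκ₀.trans_le (min_le_left _ _))
  have hκ2 : κ * T * L ≤ a / 4 := by
    have := hκ₀.trans_le (min_le_right _ _)
    rw [lt_div_iff₀ (by positivity)] at this
    have : 0 < κ * T := by positivity
    nlinarith
  refine ⟨h, hm, h0, fun Q hQ hQr ↦ ?_⟩
  set q := ∫ ξ, ‖Q ξ‖ with hq
  have hq0 : 0 ≤ q := integral_nonneg fun _ ↦ norm_nonneg _
  have hqQ : ∫ ξ, Q ξ = (q : ℂ) := by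
    rw [hq, ← integral_complex_ofReal]; congr 1; ext ξ; exact hQ ξ
  set ψ := testProfile k (𝓕 Q) with hψ
  have hψa : ∀ ξ, ψ ξ = wt (-k) ξ * Q ξ := fun ξ ↦ by
    rw [hψ, testProfile_apply, fourierInv_fourier_schwartz]
  set V : ℝ → ℂ := fun t ↦ pair ψ (flow (-(κ * t)) (h t)) - t * (Complex.I * μ * (I₀ * q)) with hV
  have hV' : ∀ t ∈ Set.Icc 0 T, HasDerivWithinAt V (pair ψ (flow (-(κ * t)) (force ν μ k (h t))) -
      Complex.I * μ * (I₀ * q)) (Set.Icc 0 T) t := by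
    intro t ht
    have h1 := ((pair ψ).restrictScalars ℝ).hasFDerivAt.comp_hasDerivWithinAt t (hm t ht)
    have h2 := ((Complex.ofRealCLM.hasDerivAt (x := t)).mul_const
      (Complex.I * μ * (I₀ * q))).hasDerivWithinAt (s := Set.Icc 0 T)
    have h3 := h1.sub h2
    simp only [Complex.ofRealCLM_apply, Complex.ofReal_one, one_mul] at h3
    exact h3
  have hμn : ‖Complex.I * (μ : ℂ)‖ = 1 := by
    rcases hμ with rfl | rfl <;> simp
  have hbound : ∀ t ∈ Set.Icc 0 T, ‖pair ψ (flow (-(κ * t)) (force ν μ k (h t))) -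
      Complex.I * μ * (I₀ * q)‖ ≤ 3 * a / 4 * q := by
    intro t ht
    have hκt : 0 ≤ κ * t := mul_nonneg hκ.le ht.1
    have hκtT : κ * t ≤ κ * T := mul_le_mul_of_nonneg_left ht.2 hκ.le
    have hdist : ‖h t - x₀‖ ≤ 2 * η := by
      have h1 := hclose t ht
      have h2 := hcont (κ * t) (by rw [abs_of_nonneg hκt]; linarith) x₀ rfl
      rw [← norm_flow (κ * t), map_sub, isometryGroup_flow.apply_neg] at h1
      calc ‖h t - x₀‖ = ‖(h t - flow (κ * t) x₀) + (flow (κ * t) x₀ - x₀)‖ := by congr 1; abel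
        _ ≤ η + η := (norm_add_le _ _).trans (add_le_add h1 h2.le)
        _ = 2 * η := by ring
    have e : pair ψ (flow (-(κ * t)) (force ν μ k (h t))) = Complex.I * μ *
        ∫ x, nl ν (ofProfile k (h t) x) * 𝓕 (phaseS (-(κ * t)) Q) x := by
      rw [pair_flow, hψ, ← testProfile_fourier_phaseS, force, map_smul, smul_eq_mul,
        ← integral_nl_ofProfile E]
      rfl
    have hmain := norm_integral_nl_mul_fourier_sub_le E (h t) (Q := Q) hn₂i (-(κ * t)) hQr
    rw [hqQ, ← hI₀, ← hn₁, ← hn₂, ← hx₀, abs_neg, abs_of_nonneg hκt] at hmain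
    rw [e, ← mul_sub, norm_mul, hμn, one_mul]
    refine hmain.trans (mul_le_mul_of_nonneg_right ?_ hq0)
    have h1 := hC (h t) x₀ (by
      have := norm_sub_norm_le (h t) x₀
      linarith) (by linarith)
    have h2 : C * ‖h t - x₀‖ ≤ C * (2 * η) := by gcongr
    have h3 : κ * t * (2 * Real.pi * r) ^ 4 * n₁ ≤ κ * T * L := by
      rw [mul_assoc, ← hL]; gcongr
    linarith
  have hfin := norm_image_sub_le_of_norm_deriv_le_segment' hV'
    (fun t ht ↦ hbound t ⟨ht.1, ht.2.le⟩) T ⟨hT.le, le_rfl⟩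
  have hV0 : V 0 = 0 := by
    simp only [hV, mul_zero, neg_zero, isometryGroup_flow.zero, h0, Complex.ofReal_zero, zero_mul,
      sub_zero]
    rw [pair_apply, ← integral_zero (Space d) ℂ]
    apply integral_congr_ae
    filter_upwards [(profile k φ).coeFn_toLp 2 volume] with ξ hξ
    rw [hx₀, hξ, profile_apply, hψa]
    rcases lt_or_ge r ‖ξ‖ with h1 | h1
    · rw [hQr ξ h1]; simp
    · rw [hφ ξ (h1.trans (min_le_left _ _))]; simp
  rw [hV0, sub_zero, sub_zero] at hfin
  have hlow : T * a / 4 * q ≤ ‖pair ψ (flow (-(κ * T)) (h T))‖ := by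
    have h1 : ‖(T : ℂ) * (Complex.I * μ * (I₀ * q))‖ = T * a * q := by
      rw [norm_mul, norm_mul, hμn, norm_mul, Complex.norm_real, Complex.norm_real,
        Real.norm_of_nonneg hT.le, Real.norm_of_nonneg hq0, ha]; ring
    have h2 := norm_sub_norm_le ((T : ℂ) * (Complex.I * μ * (I₀ * q)))
      (pair ψ (flow (-(κ * T)) (h T)))
    rw [norm_sub_rev, h1] at h2
    simp only [hV] at hfin
    linarith
  refine hlow.trans ?_
  rw [pair_flow, pair_apply]
  refine (norm_integral_le_integral_norm _).trans (le_of_eq ?_)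
  apply integral_congr_ae
  filter_upwards [fourier_ofProfile_coe k (h T)] with ξ hξ
  rw [hξ, phaseS_apply, hψa, norm_mul, norm_mul, norm_mul, norm_mul, norm_phase]
  ring

/-! ### Norm inflation at low regularity -/

lemma inv_rpow_mul_wt_smul {b : ℝ} (hb : 0 < b) (γ : ℝ) (ξ : Space d) :
    (b ^ γ)⁻¹ * wt γ (b • ξ) = ((b ^ 2)⁻¹ + (2 * Real.pi * ‖ξ‖) ^ 2) ^ (γ / 2) := by
  have e : b ^ γ = (b ^ 2) ^ (γ / 2) := by
    rw [← Real.rpow_natCast, ← Real.rpow_mul hb.le]; congr 1; push_cast; ring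
  rw [e, wt, norm_smul, Real.norm_of_nonneg hb.le, ← Real.inv_rpow (by positivity),
    ← Real.mul_rpow (by positivity) (by positivity)]
  congr 1
  field_simp

lemma lintegral_ball_rpow_eq_top (hd : 1 ≤ d) {γ : ℝ} (hγ : γ ≤ -(d : ℝ) / 2) {ρ : ℝ} (hρ : 0 < ρ) :
    ∫⁻ ξ in Metric.ball (0 : Space d) ρ, ENNReal.ofReal ((2 * Real.pi * ‖ξ‖) ^ (2 * γ)) = ∞ := by
  have : Nonempty (Fin d) := ⟨⟨0, hd⟩⟩
  by_contra hne
  have hi : IntegrableOn (fun ξ : Space d ↦ (fun y : ℝ ↦ (2 * Real.pi * y) ^ (2 * γ)) ‖ξ‖)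
      (Metric.ball 0 ρ) := by
    refine ⟨Measurable.aestronglyMeasurable (by fun_prop), ?_⟩
    rw [hasFiniteIntegral_iff_ofReal (ae_of_all _ fun ξ ↦ by positivity)]
    exact lt_top_iff_ne_top.2 hne
  have hi := (integrableOn_fun_norm_addHaar (volume : Measure (Space d))
    (f := fun y : ℝ ↦ (2 * Real.pi * y) ^ (2 * γ)) (r := ρ)).1 hi
  have hi2 : IntegrableOn (fun y : ℝ ↦ y ^ ((d : ℝ) - 1 + 2 * γ)) (Set.Ioo 0 ρ) := by
    refine IntegrableOn.congr_fun (hi.const_mul ((2 * Real.pi) ^ (2 * γ))⁻¹) ?_ measurableSet_Ioo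
    intro y hy
    have hy0 : 0 < y := hy.1
    simp only [finrank_euclideanSpace, Fintype.card_fin, smul_eq_mul]
    rw [Real.mul_rpow (by positivity) hy0.le, Real.rpow_add hy0, ← Nat.cast_pred hd, Real.rpow_natCast]
    have : 0 < (2 * Real.pi) ^ (2 * γ) := by positivity
    field_simp
  rw [intervalIntegral.integrableOn_Ioo_rpow_iff hρ] at hi2
  linarith

lemma tendsto_lintegral_ball_wt (hd : 1 ≤ d) {γ : ℝ} (hγ : γ ≤ -(d : ℝ) / 2) {ρ : ℝ} (hρ : 0 < ρ) :
    Tendsto (fun n : ℕ ↦ ∫⁻ ξ in Metric.ball (0 : Space d) ρ,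
      ENNReal.ofReal (((((n : ℝ) + 1) ^ 2)⁻¹ + (2 * Real.pi * ‖ξ‖) ^ 2) ^ γ)) atTop (𝓝 ∞) := by
  have : Nonempty (Fin d) := ⟨⟨0, hd⟩⟩
  have hγ0 : γ ≤ 0 := hγ.trans (by
    have : (0 : ℝ) ≤ d := by positivity
    linarith)
  rw [← lintegral_ball_rpow_eq_top hd hγ hρ]
  refine lintegral_tendsto_of_tendsto_of_monotone (fun n ↦ Measurable.aemeasurable (by fun_prop)) ?_ ?_
  · refine ae_of_all _ fun ξ m n hmn ↦ ENNReal.ofReal_le_ofReal ?_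
    refine Real.rpow_le_rpow_of_nonpos (by positivity) ?_ hγ0
    gcongr
  · have hne : ∀ᵐ ξ ∂(volume : Measure (Space d)), ξ ≠ 0 := by
      simp [ae_iff]
    filter_upwards [ae_restrict_of_ae hne] with ξ hξ
    refine ENNReal.tendsto_ofReal ?_
    have hpos : 0 < 2 * Real.pi * ‖ξ‖ := by positivity
    have e : (2 * Real.pi * ‖ξ‖) ^ (2 * γ) = (0 + (2 * Real.pi * ‖ξ‖) ^ 2) ^ γ := by
      rw [zero_add, ← Real.rpow_natCast, ← Real.rpow_mul hpos.le]; norm_num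
    rw [e]
    refine Tendsto.rpow_const (Tendsto.add_const _ ?_) (Or.inl (by positivity))
    have h1 : Tendsto (fun n : ℕ ↦ (n : ℝ) + 1) atTop atTop :=
      tendsto_atTop_add_const_right _ _ tendsto_natCast_atTop_atTop
    exact ((tendsto_pow_atTop two_ne_zero).comp h1).inv_tendsto_atTop

theorem normInflation_of_le {ν μ γ : ℝ} {k : ℕ} (E : Exponents d ν k) (hd : 1 ≤ d)
    (hμ : μ = 1 ∨ μ = -1) (hγ : γ ≤ -(d : ℝ) / 2) (hγc : γ < criticalExponent d ν) :
    NormInflation d ν μ k γ := by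
  intro ε hε
  have hγ0 : γ ≤ 0 := hγ.trans (by
    have : (0 : ℝ) ≤ d := by positivity
    linarith)
  obtain ⟨φ, r₀, r, c, T, κ₀, hr₀, hr, hc, hT, hκ₀, hφ, hex⟩ := exists_low_frequency (μ := μ) E hd hμ
  set D := (2 * Real.pi * r₀) ^ γ * ‖φ.toLp 2 volume‖ with hD
  have hD0 : 0 ≤ D := by positivity
  set ε₀ := ε / (D + 1) with hε₀
  have hε₀0 : 0 < ε₀ := by positivity
  have hnat : Tendsto (fun n : ℕ ↦ (n : ℝ) + 1) atTop atTop :=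
    tendsto_atTop_add_const_right _ _ tendsto_natCast_atTop_atTop
  obtain ⟨n, ⟨hb1, hb2⟩, hbig⟩ := ((hnat.eventually (eventually_scale E.one_lt hγc T hε₀0 hκ₀ hε)).and
    ((tendsto_lintegral_ball_wt hd hγ (half_pos hr)).eventually_const_lt
      (ENNReal.ofReal_lt_top (r := (ε⁻¹ / (c * ε₀)) ^ 2)))).exists
  set b : ℝ := (n : ℝ) + 1
  have hb0 : 0 < b := by positivity
  set A := ε₀ * b ^ ((d : ℝ) / 2 - γ) with hA
  have hA0 : 0 < A := by positivity
  have hAp : 0 < A ^ (ν - 1) := by positivity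
  obtain ⟨h, hm, h0, hlow⟩ := hex (b ^ 4 / A ^ (ν - 1)) (by positivity) hb1
  set w : Space d → ℝ := fun ξ ↦ ε₀ * (b ^ γ)⁻¹ * wt γ (b • ξ) with hw
  have hw0 : ∀ ξ, 0 < w ξ := fun ξ ↦ by have := wt_pos γ (b • ξ); simp only [hw]; positivity
  have hwe : ∀ ξ, w ξ = ε₀ * ((b ^ 2)⁻¹ + (2 * Real.pi * ‖ξ‖) ^ 2) ^ (γ / 2) := fun ξ ↦ by
    simp only [hw]; rw [mul_assoc, inv_rpow_mul_wt_smul hb0]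
  refine ⟨_, T / A ^ (ν - 1), _, by positivity, hb2,
    hm.isSolution_scale E hA0 hb0 (by field_simp) h0, ?_, ?_⟩
  · have hle : sobolevNorm γ ((((A : ℝ) : ℂ) • dilS hb0 φ).toLp 2 volume) ^ 2 ≤
        ENNReal.ofReal ((ε₀ * D) ^ 2) := by
      have e : ENNReal.ofReal ((ε₀ * D) ^ 2) = ENNReal.ofReal ((ε₀ * (2 * Real.pi * r₀) ^ γ) ^ 2) *
          ENNReal.ofReal (‖(𝓕 (φ.toLp 2 volume) : L2 d)‖ ^ 2) := by
        rw [Lp.norm_fourier_eq, ← ENNReal.ofReal_mul (by positivity), hD]; congr 1; ring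
      rw [toLp_real_smul, ← dilL2_toLp, hA, sobolevNorm_scale_sq hb0 hε₀0, e,
        ofReal_norm_sq_eq_lintegral, ← lintegral_const_mul' _ _ ENNReal.ofReal_ne_top]
      refine lintegral_mono_ae ?_
      rw [SchwartzMap.toLp_fourier_eq]
      filter_upwards [(𝓕 φ).coeFn_toLp 2 volume] with ξ hξ
      rw [hξ]
      rcases le_or_gt ‖ξ‖ r₀ with h1 | h1
      · rw [hφ ξ h1]; simp
      · rw [← ENNReal.ofReal_pow (hw0 ξ).le]
        gcongr
        · exact (hw0 ξ).le
        · change w ξ ≤ _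
          rw [hwe]
          refine mul_le_mul_of_nonneg_left ?_ hε₀0.le
          have e2 : (2 * Real.pi * r₀) ^ γ = ((2 * Real.pi * r₀) ^ 2) ^ (γ / 2) := by
            rw [← Real.rpow_natCast, ← Real.rpow_mul (by positivity)]; congr 1; push_cast; ring
          rw [e2]
          refine Real.rpow_le_rpow_of_nonpos (by positivity) ?_ (by linarith)
          have : (2 * Real.pi * r₀) ^ 2 ≤ (2 * Real.pi * ‖ξ‖) ^ 2 := by gcongr
          have : 0 ≤ (b ^ 2)⁻¹ := by positivity
          linarith
    rw [ENNReal.ofReal_pow (by positivity)] at hle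
    refine ((ENNReal.pow_le_pow_left_iff (by norm_num)).1 hle).trans_lt ?_
    rw [ENNReal.ofReal_lt_ofReal_iff hε, hε₀, div_mul_eq_mul_div, div_lt_iff₀ (by positivity)]
    nlinarith
  · have e : A ^ (ν - 1) * (T / A ^ (ν - 1)) = T := by field_simp
    simp only [e]
    obtain ⟨χ, hin, hout⟩ := exists_bump (d := d) hr
    have hcs : HasCompactSupport (fun ξ ↦ ((χ ξ * w ξ ^ 2 : ℝ) : ℂ)) :=
      (χ.hasCompactSupport.mul_right (f' := fun ξ ↦ w ξ ^ 2)).comp_left Complex.ofReal_zero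
    have hwsm : ContDiff ℝ (⊤ : ℕ∞) w :=
      contDiff_const.mul ((hasTemperateGrowth_wt γ).1.comp (contDiff_const_smul b))
    have hsm : ContDiff ℝ (⊤ : ℕ∞) (fun ξ ↦ ((χ ξ * w ξ ^ 2 : ℝ) : ℂ)) :=
      Complex.ofRealCLM.contDiff.comp (χ.contDiff.mul (hwsm.pow 2))
    set Q : 𝓢(Space d, ℂ) := hcs.toSchwartzMap hsm
    have hQa : ∀ ξ, Q ξ = ((χ ξ * w ξ ^ 2 : ℝ) : ℂ) := fun ξ ↦ rfl
    have hQn : ∀ ξ, ‖Q ξ‖ = χ ξ * w ξ ^ 2 := fun ξ ↦ by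
      rw [hQa, Complex.norm_real, Real.norm_of_nonneg (mul_nonneg χ.nonneg (by positivity))]
    have hmain := sq_mul_lintegral_le hc.le (hlow Q (fun ξ ↦ by rw [hQn, hQa]) fun ξ hξ ↦ by
      rw [hQa, χ.zero_of_le_dist (by rw [dist_zero_right, hout]; exact hξ.le)]; simp)
    have hge : ENNReal.ofReal ε⁻¹ ^ 2 < sobolevNorm γ (A • dilL2 hb0 (ofProfile k (h T))) ^ 2 := by
      calc ENNReal.ofReal ε⁻¹ ^ 2 = ENNReal.ofReal ((c * ε₀) ^ 2) *
            ENNReal.ofReal ((ε⁻¹ / (c * ε₀)) ^ 2) := by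
            rw [← ENNReal.ofReal_mul (by positivity), ← ENNReal.ofReal_pow (by positivity), ← mul_pow,
              mul_div_cancel₀ _ (by positivity)]
        _ < ENNReal.ofReal ((c * ε₀) ^ 2) * ∫⁻ ξ in Metric.ball (0 : Space d) (r / 2),
              ENNReal.ofReal (((b ^ 2)⁻¹ + (2 * Real.pi * ‖ξ‖) ^ 2) ^ γ) :=
            (ENNReal.mul_lt_mul_iff_right (ENNReal.ofReal_pos.2 (by positivity)).ne' ENNReal.ofReal_ne_top).2 hbig
        _ = ENNReal.ofReal (c ^ 2) * ∫⁻ ξ in Metric.ball (0 : Space d) (r / 2), ‖Q ξ‖ₑ := by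
            rw [mul_pow, ENNReal.ofReal_mul (by positivity), mul_assoc,
              ← lintegral_const_mul' _ _ ENNReal.ofReal_ne_top]
            congr 1
            refine setLIntegral_congr_fun measurableSet_ball fun ξ hξ ↦ ?_
            rw [mem_ball_zero_iff] at hξ
            rw [← ofReal_norm, hQn, χ.one_of_mem_closedBall (by
              rw [mem_closedBall_zero_iff, hin]; exact hξ.le), one_mul, hwe,
              ← ENNReal.ofReal_mul (by positivity), mul_pow ε₀, ← Real.rpow_natCast (_ ^ (γ / 2)),
              ← Real.rpow_mul (by positivity)]
            congr 3; push_cast; ring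
        _ ≤ ENNReal.ofReal (c ^ 2) * ∫⁻ ξ, ‖Q ξ‖ₑ := by
            gcongr
            exact Measure.restrict_le_self
        _ ≤ _ := hmain
        _ ≤ sobolevNorm γ (A • dilL2 hb0 (ofProfile k (h T))) ^ 2 := by
            rw [hA, sobolevNorm_scale_sq hb0 hε₀0]
            refine lintegral_mono fun ξ ↦ ?_
            rw [← ofReal_norm (Q ξ), hQn, ← ENNReal.ofReal_pow (hw0 ξ).le]
            gcongr
            exact mul_le_of_le_one_left (by positivity) χ.le_one
    exact (ENNReal.pow_lt_pow_left_iff (by norm_num)).1 hge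

/-! ### Changing the time of existence by scaling -/

lemma wt_smul_le_of_le_two {b : ℝ} (hb : 1 / 2 ≤ b) (hb' : b ≤ 2) (γ : ℝ) (ξ : Space d) :
    wt γ (b • ξ) ≤ 2 ^ |γ| * wt γ ξ := by
  have hb0 : 0 < b := by linarith
  have e : (2 : ℝ) ^ |γ| = 4 ^ (|γ| / 2) := by
    rw [show (4 : ℝ) = 2 ^ (2 : ℝ) by norm_num, ← Real.rpow_mul (by norm_num)]; congr 1; ring
  have hn : (2 * Real.pi * ‖b • ξ‖) ^ 2 = b ^ 2 * (2 * Real.pi * ‖ξ‖) ^ 2 := by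
    rw [norm_smul, Real.norm_of_nonneg hb0.le]; ring
  have hy : 0 ≤ (2 * Real.pi * ‖ξ‖) ^ 2 := by positivity
  rw [wt, wt, e, hn]
  set y := (2 * Real.pi * ‖ξ‖) ^ 2
  rcases le_or_gt 0 γ with hγ | hγ
  · rw [abs_of_nonneg hγ, ← Real.mul_rpow (by norm_num) (by positivity)]
    refine Real.rpow_le_rpow (by positivity) ?_ (by positivity)
    have : b ^ 2 ≤ 4 := by nlinarith
    nlinarith
  · have e2 : (4 : ℝ) ^ (|γ| / 2) = (1 / 4) ^ (γ / 2) := by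
      rw [abs_of_neg hγ, one_div, Real.inv_rpow (by norm_num), ← Real.rpow_neg (by norm_num)]
      congr 1; ring
    rw [e2, ← Real.mul_rpow (by norm_num) (by positivity)]
    refine Real.rpow_le_rpow_of_nonpos (by positivity) ?_ (by linarith)
    have : 1 / 4 ≤ b ^ 2 := by nlinarith
    nlinarith

lemma sobolevNorm_dilL2_le {b : ℝ} (hb : 1 / 2 ≤ b) (hb' : b ≤ 2) (hb0 : 0 < b) (γ : ℝ) (f : L2 d) :
    sobolevNorm γ (dilL2 hb0 f) ≤ ENNReal.ofReal (2 ^ d * 2 ^ |γ|) * sobolevNorm γ f := by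
  rw [← ENNReal.pow_le_pow_left_iff two_ne_zero, sobolevNorm_dilL2_sq, mul_pow, sobolevNorm,
    eLpNorm_two_sq, ← ENNReal.ofReal_pow (by positivity), mul_pow, ENNReal.ofReal_mul (by positivity),
    mul_assoc, ← lintegral_const_mul' (ENNReal.ofReal ((2 ^ |γ|) ^ 2)) _ ENNReal.ofReal_ne_top]
  refine mul_le_mul' (ENNReal.ofReal_le_ofReal ?_) (lintegral_mono fun ξ ↦ ?_)
  · have h1 : (b ^ d)⁻¹ ≤ 2 ^ d := by
      rw [← inv_pow]
      refine pow_le_pow_left₀ (by positivity) ?_ d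
      rw [inv_le_comm₀ hb0 two_pos]; linarith
    exact h1.trans (le_self_pow₀ (one_le_pow₀ one_le_two) two_ne_zero)
  · rw [enorm_mul, mul_pow, ← mul_assoc]
    gcongr
    change _ ≤ _ * ‖((wt γ ξ : ℝ) : ℂ)‖ₑ ^ 2
    rw [← ofReal_norm, Complex.norm_real, Real.norm_of_nonneg (wt_nonneg _ _),
      ← ENNReal.ofReal_pow (wt_nonneg _ _), ← ENNReal.ofReal_mul (by positivity), ← mul_pow]
    exact ENNReal.ofReal_le_ofReal
      (pow_le_pow_left₀ (wt_nonneg _ _) (wt_smul_le_of_le_two hb hb' γ ξ) 2)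

/-- The `H^γ` norm on the profile side. -/
def low (k : ℕ) (γ : ℝ) : L2 d →L[ℂ] L2 d := mulL2 (wtB (k - γ))

lemma sobolevNorm_ofProfile_eq_low {k : ℕ} {γ : ℝ} (hγ : γ ≤ k) (h : L2 d) :
    sobolevNorm γ (ofProfile k h) = ENNReal.ofReal ‖low k γ h‖ := sobolevNorm_ofProfile_eq_ofReal hγ h

lemma norm_low_le {k : ℕ} {γ : ℝ} (hγ : γ ≤ k) (h : L2 d) : ‖low k γ h‖ ≤ ‖h‖ := by
  rw [low, ← one_mul ‖h‖]
  refine norm_mulL2_le _ (fun ξ ↦ ?_) h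
  rw [wtB_apply (by linarith), Complex.norm_real, Real.norm_of_nonneg (wt_nonneg _ _)]
  exact wt_le_one (by linarith) ξ

lemma norm_low_zero (k : ℕ) (h : L2 d) : ‖low k 0 h‖ = ‖ofProfile k h‖ := by
  rw [low, sub_zero, ← fourier_ofProfile, Lp.norm_fourier_eq]

lemma norm_low_conjProfile {k : ℕ} {γ : ℝ} (hγ : γ ≤ k) (h : L2 d) :
    ‖low k γ (conjProfile h)‖ = ‖low k γ h‖ := by
  have := sobolevNorm_ofProfile_conjProfile k γ h
  rwa [sobolevNorm_ofProfile_eq_low hγ, sobolevNorm_ofProfile_eq_low hγ,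
    ENNReal.ofReal_eq_ofReal_iff (norm_nonneg _) (norm_nonneg _)] at this

lemma norm_low_smul_dilProfile_le {k : ℕ} {γ p : ℝ} (hγ : γ ≤ k) (hp : 0 ≤ p) {b : ℝ}
    (hb : 1 / 2 ≤ b) (hb' : b ≤ 2) (hb0 : 0 < b) (h : L2 d) :
    ‖low k γ (b ^ p • dilProfile k hb0 h)‖ ≤ 2 ^ p * (2 ^ d * 2 ^ |γ|) * ‖low k γ h‖ := by
  have h1 : sobolevNorm γ (ofProfile k (b ^ p • dilProfile k hb0 h)) ≤
      ENNReal.ofReal (2 ^ p) * (ENNReal.ofReal (2 ^ d * 2 ^ |γ|) * sobolevNorm γ (ofProfile k h)) := by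
    rw [ofProfile_real_smul, ofProfile_dilProfile, sobolevNorm_real_smul _ (by positivity)]
    exact mul_le_mul' (ENNReal.ofReal_le_ofReal (Real.rpow_le_rpow hb0.le hb' hp))
      (sobolevNorm_dilL2_le hb hb' hb0 γ _)
  rw [sobolevNorm_ofProfile_eq_low hγ, sobolevNorm_ofProfile_eq_low hγ,
    ← ENNReal.ofReal_mul (by positivity), ← ENNReal.ofReal_mul (by positivity),
    ENNReal.ofReal_le_ofReal_iff (by positivity)] at h1
  linarith

lemma smul_dilProfile_profile (k : ℕ) {b : ℝ} (hb : 0 < b) (r : ℝ) (φ : 𝓢(Space d, ℂ)) :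
    r • dilProfile k hb ((profile k φ).toLp 2 volume) =
      (profile k ((r : ℂ) • dilS hb φ)).toLp 2 volume := by
  apply ofProfile_injective k
  rw [ofProfile_real_smul, ofProfile_dilProfile, ofProfile_profile, ofProfile_profile, dilL2_toLp,
    toLp_real_smul]

/-- Solutions up to time `t` with data `P φ` give solutions up to time `t'` with data `φ`. -/
lemma exists_rescale {ν : ℝ} {k : ℕ} (E : Exponents d ν k) (μ : ℝ) {γ : ℝ} (hγ : γ ≤ k) :
    ∃ K > 0, ∀ t t' : ℝ, 0 < t' → t' ≤ t → t ≤ 2 * t' →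
      ∃ (P : 𝓢(Space d, ℂ) → 𝓢(Space d, ℂ)) (D D' : L2 d →ₗ[ℝ] L2 d),
        (∀ g, ‖low k γ (D g)‖ ≤ K * ‖low k γ g‖) ∧ (∀ g, ‖low k γ (D' g)‖ ≤ K * ‖low k γ g‖) ∧
        (∀ φ, (profile k (P φ)).toLp 2 volume = D' ((profile k φ).toLp 2 volume)) ∧
        ∀ φ h, Mild flow (force ν μ k) 1 t h → h 0 = (profile k (P φ)).toLp 2 volume →
          ∃ h', Mild flow (force ν μ k) 1 t' h' ∧ h' 0 = (profile k φ).toLp 2 volume ∧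
            h' t' = D (h t) := by
  have hν' : 0 < ν - 1 := by linarith [E.one_lt]
  set p := 4 / (ν - 1) with hp
  have hp0 : 0 < p := by positivity
  refine ⟨2 ^ p * (2 ^ d * 2 ^ |γ|), by positivity, fun t t' ht' htt htt2 ↦ ?_⟩
  set b := (t / t') ^ (1 / 4 : ℝ)
  have ht0 : 0 < t := by linarith
  have hb0 : 0 < b := by positivity
  have hb4 : b ^ 4 = t / t' := by
    rw [← Real.rpow_natCast, ← Real.rpow_mul (by positivity)]; norm_num
  have hb1 : 1 ≤ b := Real.one_le_rpow ((one_le_div ht').2 htt) (by norm_num)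
  have hb2 : b ≤ 2 := by
    refine le_of_pow_le_pow_left₀ (n := 4) (by norm_num) (by norm_num) ?_
    rw [hb4, div_le_iff₀ ht']; linarith
  have hbi0 : 0 < b⁻¹ := by positivity
  have hAp : (b ^ p) ^ (ν - 1) = b ^ 4 := by
    rw [← Real.rpow_mul hb0.le, hp, div_mul_cancel₀ _ hν'.ne', ← Real.rpow_natCast]; norm_num
  have hbi1 : b⁻¹ ≤ 1 := inv_le_one_of_one_le₀ hb1
  have hbi2 : 1 / 2 ≤ b⁻¹ := by rw [one_div]; exact inv_anti₀ hb0 hb2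
  refine ⟨fun φ ↦ ((b⁻¹ ^ p : ℝ) : ℂ) • dilS hbi0 φ,
    (b ^ p) • ((dilProfile k hb0 : L2 d →L[ℂ] L2 d).restrictScalars ℝ : L2 d →ₗ[ℝ] L2 d),
    (b⁻¹ ^ p) • ((dilProfile k hbi0 : L2 d →L[ℂ] L2 d).restrictScalars ℝ : L2 d →ₗ[ℝ] L2 d),
    fun g ↦ ?_, fun g ↦ ?_, fun φ ↦ ?_, fun φ h hm h0 ↦ ?_⟩
  · exact norm_low_smul_dilProfile_le hγ hp0.le (by linarith) hb2 hb0 g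
  · exact norm_low_smul_dilProfile_le hγ hp0.le hbi2 (by linarith) hbi0 g
  · exact (smul_dilProfile_profile k hbi0 _ φ).symm
  · have hm' := hm.scale E (A := b ^ p) (b := b) (by positivity) hb0 (by rw [hAp, one_mul])
    rw [hAp, hb4] at hm'
    have et : t / (t / t') = t' := by field_simp
    rw [et] at hm'
    refine ⟨_, hm', ?_, ?_⟩
    · rw [mul_zero, h0, smul_dilProfile_profile]
      congr 2
      ext x
      simp only [_root_.smul_apply, dilS_apply, smul_eq_mul, smul_smul]
      rw [inv_mul_cancel₀ hb0.ne', one_smul, ← mul_assoc, ← Complex.ofReal_mul,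
        ← Real.mul_rpow hb0.le hbi0.le, mul_inv_cancel₀ hb0.ne', Real.one_rpow, Complex.ofReal_one,
        one_mul]
    · have et2 : t / t' * t' = t := by field_simp
      simp only [et2]
      rfl

/-! ### Prolonging solutions backwards in time -/

lemma Mild.prolong {ν μ : ℝ} {k : ℕ} (E : Exponents d ν k) {t₁ t₂ : ℝ} (ht₁ : 0 ≤ t₁) (ht₂ : 0 < t₂)
    {h₁ h₂ : ℝ → L2 d} {φ : 𝓢(Space d, ℂ)} (hm₁ : Mild flow (force ν μ k) 1 t₁ h₁)
    (h₁0 : h₁ 0 = (profile k (conjS φ)).toLp 2 volume) (hm₂ : Mild flow (force ν μ k) 1 t₂ h₂)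
    (h₂0 : h₂ 0 = (profile k φ).toLp 2 volume) :
    ∃ G, Mild flow (force ν μ k) 1 (t₁ + t₂) G ∧ G 0 = conjProfile (h₁ t₁) ∧ G (t₁ + t₂) = h₂ t₂ := by
  have hrev := hm₁.reverse isometryGroup_flow conjProfile_flow (force_conjProfile E μ)
  refine ⟨_, hrev.concat isometryGroup_flow ht₁ ht₂.le hm₂ ?_, ?_, ?_⟩
  · rw [sub_self, h₁0, h₂0, ← conjProfile_profile, conjProfile_conjProfile]
  · rw [if_pos ht₁, sub_zero]
  · rw [if_neg (by linarith), add_sub_cancel_left]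

/-- Schwartz data approximating the initial value of a given solution. -/
lemma Mild.exists_approx {ν μ : ℝ} {k : ℕ} (E : Exponents d ν k) {t : ℝ} (ht : 0 ≤ t) {G : ℝ → L2 d}
    (hm : Mild flow (force ν μ k) 1 t G) {η : ℝ} (hη : 0 < η) :
    ∃ u₀ : 𝓢(Space d, ℂ), ‖(profile k u₀).toLp 2 volume - G 0‖ < η ∧
      ∀ h, Mild flow (force ν μ k) 1 t h → h 0 = (profile k u₀).toLp 2 volume → ‖h t - G t‖ < η := by
  obtain ⟨δ, hδ, hst⟩ := hm.stability isometryGroup_flow (locLip_force E μ) ht hη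
  obtain ⟨u₀, hu₀⟩ := (denseRange_profile (d := d) k).exists_dist_lt (G 0) (lt_min hδ hη)
  rw [dist_comm, dist_eq_norm] at hu₀
  refine ⟨u₀, hu₀.trans_le (min_le_right _ _), fun h hh h0 ↦ ?_⟩
  obtain ⟨h', hm', h0', hc⟩ := hst _ (hu₀.trans_le (min_le_left _ _))
  rwa [hh.unique isometryGroup_flow (locLip_force E μ) hm' (h0.trans h0'.symm) t ⟨ht, le_rfl⟩]

lemma norm_low_profile_conjS {k : ℕ} {γ : ℝ} (hγ : γ ≤ k) (φ : 𝓢(Space d, ℂ)) :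
    ‖low k γ ((profile k (conjS φ)).toLp 2 volume)‖ = ‖low k γ ((profile k φ).toLp 2 volume)‖ := by
  rw [← conjProfile_profile, norm_low_conjProfile hγ]

/-! ### Failure of continuity at a fixed time -/

theorem not_solutionMapContinuousAtZero {ν μ γ : ℝ} {k : ℕ} (E : Exponents d ν k) (hγ : γ ≤ k)
    (hinf : NormInflation d ν μ k γ) {t : ℝ} (ht : 0 < t) :
    ¬ SolutionMapContinuousAtZero d ν μ k γ t := by
  intro hcont
  have hc : ∀ ε > 0, ∃ δ > 0, ∀ φ : 𝓢(Space d, ℂ), ‖low k γ ((profile k φ).toLp 2 volume)‖ < δ →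
      ∃ h, Mild flow (force ν μ k) 1 t h ∧ h 0 = (profile k φ).toLp 2 volume ∧
        ‖low k γ (h t)‖ < ε := by
    intro ε hε
    obtain ⟨δ, hδ, H⟩ := hcont ε hε
    refine ⟨δ, hδ, fun φ hφ ↦ ?_⟩
    obtain ⟨u, hu, hut⟩ := H φ (by
      rw [← ofProfile_profile k, sobolevNorm_ofProfile_eq_low hγ, ENNReal.ofReal_lt_ofReal_iff hδ]
      exact hφ)
    obtain ⟨h, hm, h0, hh⟩ := hu.exists_mild E ht.le
    rw [hh t ⟨ht.le, le_rfl⟩, sobolevNorm_ofProfile_eq_low hγ, ENNReal.ofReal_lt_ofReal_iff hε] at hut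
    exact ⟨h, hm, h0, hut⟩
  obtain ⟨K, hK, hresc⟩ := exists_rescale E μ hγ
  obtain ⟨δ₁, hδ₁, H₁⟩ := hc 1 one_pos
  obtain ⟨δ₂, hδ₂, H₂⟩ := hc (δ₁ / K) (by positivity)
  obtain ⟨φ, s, u, hs, hs', hu, hφ, hus⟩ := hinf (min (δ₂ / K) (min (t / 2) (1 / 2))) (by positivity)
  set ε := min (δ₂ / K) (min (t / 2) (1 / 2))
  have hε0 : 0 < ε := by positivity
  have hε2 : 2 ≤ ε⁻¹ := by
    rw [le_inv_comm₀ two_pos hε0, ← one_div]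
    exact (min_le_right _ _).trans (min_le_right _ _)
  have hst : s < t / 2 := hs'.trans_le ((min_le_right _ _).trans (min_le_left _ _))
  obtain ⟨h₂, hm₂, h₂0, hh₂⟩ := hu.exists_mild E hs.le
  rw [hh₂ s ⟨hs.le, le_rfl⟩, sobolevNorm_ofProfile_eq_low hγ,
    ENNReal.ofReal_lt_ofReal_iff_of_nonneg (by positivity)] at hus
  rw [← ofProfile_profile k, sobolevNorm_ofProfile_eq_low hγ, ENNReal.ofReal_lt_ofReal_iff hε0] at hφ
  obtain ⟨P, D, D', hD, hD', hP, hPD⟩ := hresc t (t - s) (by linarith) (by linarith) (by linarith)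
  obtain ⟨g, hg, hg0, hgt⟩ := H₂ (P (conjS φ)) (by
    rw [hP]
    refine (hD' _).trans_lt ?_
    rw [norm_low_profile_conjS hγ, mul_comm, ← lt_div_iff₀ hK]
    exact hφ.trans_le (min_le_left _ _))
  obtain ⟨h₁, hm₁, h₁0, h₁t⟩ := hPD (conjS φ) g hg hg0
  have hsmall : ‖low k γ (h₁ (t - s))‖ < δ₁ := by
    rw [h₁t]
    refine (hD _).trans_lt ?_
    rw [mul_comm, ← lt_div_iff₀ hK]; exact hgt
  obtain ⟨G, hG, hG0, hGt⟩ := hm₁.prolong E (by linarith) hs h₁0 hm₂ h₂0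
  rw [sub_add_cancel] at hG hGt
  rw [← norm_low_conjProfile hγ, ← hG0] at hsmall
  obtain ⟨u₀, hu₀, hclose⟩ := hG.exists_approx E ht.le
    (lt_min one_pos (sub_pos.2 hsmall) : 0 < min 1 (δ₁ - ‖low k γ (G 0)‖))
  have tri : ∀ x y : L2 d, ‖low k γ x‖ ≤ ‖low k γ y‖ + ‖x - y‖ := fun x y ↦ by
    have h1 := norm_low_le hγ (x - y)
    have h2 := norm_sub_norm_le (low k γ x) (low k γ y)
    rw [← map_sub] at h2; linarith
  obtain ⟨f, hf, hf0, hft⟩ := H₁ u₀ (by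
    have := tri ((profile k u₀).toLp 2 volume) (G 0)
    have := hu₀.trans_le (min_le_right _ _)
    linarith)
  have h1 := (hclose f hf hf0).trans_le (min_le_left _ _)
  have h2 := tri (G t) (f t)
  rw [norm_sub_rev] at h2
  rw [← hGt] at hus
  linarith

theorem not_solutionMapUniformContinuousOnBall {ν μ : ℝ} {k : ℕ} (E : Exponents d ν k)
    (hdec : Decoherence d ν μ k) {t R : ℝ} (ht : 0 < t) (hR : 0 < R) :
    ¬ SolutionMapUniformContinuousOnBall d ν μ k R t := by
  intro hcont
  have hγ : (0 : ℝ) ≤ k := by positivity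
  set N : L2 d → ℝ := fun g ↦ ‖low k 0 g‖ with hN
  set p : 𝓢(Space d, ℂ) → L2 d := fun φ ↦ (profile k φ).toLp 2 volume with hp
  have hNp : ∀ φ, N (p φ) = ‖φ.toLp 2 volume‖ := fun φ ↦ by
    simp only [hN, hp]; rw [norm_low_zero, ofProfile_profile]
  have hNpp : ∀ φ ψ, N (p φ - p ψ) = ‖φ.toLp 2 volume - ψ.toLp 2 volume‖ := fun φ ψ ↦ by
    simp only [hN, hp]; rw [norm_low_zero, map_sub, ofProfile_profile, ofProfile_profile]
  have hc : ∀ ε > 0, ∃ δ > 0, ∀ φ ψ : 𝓢(Space d, ℂ), N (p φ) ≤ R → N (p ψ) ≤ R →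
      N (p φ - p ψ) < δ → ∃ h h', Mild flow (force ν μ k) 1 t h ∧ Mild flow (force ν μ k) 1 t h' ∧
        h 0 = p φ ∧ h' 0 = p ψ ∧ N (h t - h' t) < ε := by
    intro ε hε
    obtain ⟨δ, hδ, H⟩ := hcont ε hε
    refine ⟨δ, hδ, fun φ ψ hφ hψ hφψ ↦ ?_⟩
    obtain ⟨u, v, hu, hv, huv⟩ := H φ ψ (hNp φ ▸ hφ) (hNp ψ ▸ hψ) (hNpp φ ψ ▸ hφψ)
    obtain ⟨h, hm, h0, hh⟩ := hu.exists_mild E ht.le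
    obtain ⟨h', hm', h0', hh'⟩ := hv.exists_mild E ht.le
    refine ⟨h, h', hm, hm', h0, h0', ?_⟩
    simp only [hN]
    rwa [norm_low_zero, map_sub, ← hh t ⟨ht.le, le_rfl⟩, ← hh' t ⟨ht.le, le_rfl⟩]
  obtain ⟨K, hK, hresc⟩ := exists_rescale E μ hγ
  -- the same at earlier times, on a smaller ball
  have hc' : ∀ ε > 0, ∃ δ > 0, ∀ t', 0 < t' → t' ≤ t → t ≤ 2 * t' → ∀ φ ψ : 𝓢(Space d, ℂ),
      N (p φ) ≤ R / K → N (p ψ) ≤ R / K → N (p φ - p ψ) < δ →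
      ∃ h h', Mild flow (force ν μ k) 1 t' h ∧ Mild flow (force ν μ k) 1 t' h' ∧
        h 0 = p φ ∧ h' 0 = p ψ ∧ N (h t' - h' t') < ε := by
    intro ε hε
    obtain ⟨δ, hδ, H⟩ := hc (ε / K) (by positivity)
    refine ⟨δ / K, by positivity, fun t' ht' htt htt2 φ ψ hφ hψ hφψ ↦ ?_⟩
    obtain ⟨P, D, D', hD, hD', hP, hPD⟩ := hresc t t' ht' htt htt2
    rw [le_div_iff₀ hK, mul_comm] at hφ hψ
    rw [lt_div_iff₀ hK, mul_comm] at hφψ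
    obtain ⟨g, g', hg, hg', hg0, hg0', hgg⟩ := H (P φ) (P ψ)
      (by simp only [hN, hp]; rw [hP]; exact (hD' _).trans hφ)
      (by simp only [hN, hp]; rw [hP]; exact (hD' _).trans hψ)
      (by simp only [hN, hp]; rw [hP, hP, ← map_sub]; exact (hD' _).trans_lt hφψ)
    obtain ⟨h, hm, h0, hht⟩ := hPD φ g hg hg0
    obtain ⟨h', hm', h0', hht'⟩ := hPD ψ g' hg' hg0'
    refine ⟨h, h', hm, hm', h0, h0', ?_⟩
    rw [lt_div_iff₀ hK, mul_comm] at hgg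
    rw [hht, hht', ← map_sub]
    exact (hD _).trans_lt hgg
  have hN0 : N (p 0) = 0 := by
    rw [hNp]; exact norm_eq_zero.2 (map_zero (SchwartzMap.toLpCLM ℝ ℂ 2 volume))
  have hp0 : p 0 = 0 := by
    apply ofProfile_injective k
    rw [map_zero, ← norm_eq_zero, ← norm_low_zero]; exact hN0
  have hzero : ∀ T, Mild flow (force ν μ k) 1 T (fun _ ↦ (0 : L2 d)) := by
    intro T s _
    have hf : force ν μ k (0 : L2 d) = 0 := by
      have : nlProfile ν k (0 : L2 d) = 0 := by
        apply ofProfile_injective k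
        apply Lp.ext
        filter_upwards [ofProfile_nlProfile E (0 : L2 d),
          Lp.coeFn_zero ℂ 2 (volume : Measure (Space d))] with x h1 h2
        rw [h1, map_zero, h2]; simp
      rw [force, this, smul_zero]
    simp only [hf, map_zero]
    exact hasDerivWithinAt_const _ _ _
  obtain ⟨δ₀, hδ₀, H₀⟩ := hc' (R / 2) (by positivity)
  set R₁ := min (R / K) (δ₀ / 2)
  have hR₁ : 0 < R₁ := by positivity
  have hRK : R₁ ≤ R / K := min_le_left _ _
  have hsmall : ∀ t', 0 < t' → t' ≤ t → t ≤ 2 * t' → ∀ φ, N (p φ) ≤ R₁ →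
      ∀ h, Mild flow (force ν μ k) 1 t' h → h 0 = p φ → N (h t') < R / 2 := by
    intro t' ht' htt htt2 φ hφ h hm h0
    obtain ⟨g, g', hg, hg', hg0, hg0', hgg⟩ := H₀ t' ht' htt htt2 φ 0 (hφ.trans hRK)
      (by rw [hN0]; positivity) (by
        rw [hp0, sub_zero]
        have : R₁ ≤ δ₀ / 2 := min_le_right _ _
        linarith)
    have hmem : t' ∈ Set.Icc 0 t' := ⟨ht'.le, le_rfl⟩
    rw [hg'.unique isometryGroup_flow (locLip_force E μ) (hzero t') (hg0'.trans hp0) t' hmem,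
      hg.unique isometryGroup_flow (locLip_force E μ) hm (hg0.trans h0.symm) t' hmem, sub_zero] at hgg
    exact hgg
  obtain ⟨c, hc0, hdec⟩ := hdec
  obtain ⟨δ₁, hδ₁, H₁⟩ := hc (c * R₁ / 2) (by positivity)
  obtain ⟨δ₂, hδ₂, H₂⟩ := hc' δ₁ hδ₁
  obtain ⟨φ, ψ, s, u, v, hs, hst, hu, hv, hφ, hψ, hφψ, huv⟩ := hdec R₁ δ₂ (t / 2) hR₁ hδ₂ (by positivity)
  obtain ⟨f, hfm, hf0, hfu⟩ := hu.exists_mild E hs.le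
  obtain ⟨f', hfm', hf0', hfv⟩ := hv.exists_mild E hs.le
  have hconj : ∀ φ, p (conjS φ) = conjProfile (p φ) := fun φ ↦ (conjProfile_profile k φ).symm
  have hNc : ∀ g, N (conjProfile g) = N g := fun g ↦ norm_low_conjProfile hγ g
  rw [← hNp, ← hNc, ← hconj] at hφ hψ
  rw [← hNpp, ← hNc, map_sub, ← hconj, ← hconj] at hφψ
  rw [hfu s ⟨hs.le, le_rfl⟩, hfv s ⟨hs.le, le_rfl⟩, ← map_sub, ← norm_low_zero] at huv
  have ht₁ : 0 < t - s := by linarith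
  obtain ⟨h, h', hm, hm', h0, h0', hhh⟩ := H₂ (t - s) ht₁ (by linarith) (by linarith) (conjS φ)
    (conjS ψ) (hφ.trans hRK) (hψ.trans hRK) hφψ
  have hb := hsmall (t - s) ht₁ (by linarith) (by linarith) _ hφ h hm h0
  have hb' := hsmall (t - s) ht₁ (by linarith) (by linarith) _ hψ h' hm' h0'
  obtain ⟨G, hG, hG0, hGt⟩ := hm.prolong E ht₁.le hs h0 hfm hf0
  obtain ⟨G', hG', hG0', hGt'⟩ := hm'.prolong E ht₁.le hs h0' hfm' hf0'
  rw [sub_add_cancel] at hG hGt hG' hGt'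
  rw [← hNc, ← hG0] at hb
  rw [← hNc, ← hG0'] at hb'
  rw [← hNc, map_sub, ← hG0, ← hG0'] at hhh
  set η := min (R / 2) (min (c * R₁ / 4) ((δ₁ - N (G 0 - G' 0)) / 2))
  have hη : 0 < η := lt_min (by positivity) (lt_min (by positivity) (by linarith))
  have hη1 : η ≤ R / 2 := min_le_left _ _
  have hη2 : η ≤ c * R₁ / 4 := (min_le_right _ _).trans (min_le_left _ _)
  have hη3 : η ≤ (δ₁ - N (G 0 - G' 0)) / 2 := (min_le_right _ _).trans (min_le_right _ _)
  obtain ⟨u₀, hu₀, hucl⟩ := hG.exists_approx E ht.le hη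
  obtain ⟨v₀, hv₀, hvcl⟩ := hG'.exists_approx E ht.le hη
  have tri : ∀ x y : L2 d, N x ≤ N y + ‖x - y‖ := fun x y ↦ by
    have h1 := norm_low_le hγ (x - y)
    have h2 := norm_sub_norm_le (low k 0 x) (low k 0 y)
    rw [← map_sub] at h2; simp only [hN]; linarith
  have tri2 : ∀ x y x' y' : L2 d, N (x - y) ≤ N (x' - y') + (‖x - x'‖ + ‖y - y'‖) := fun x y x' y' ↦ by
    refine (tri (x - y) (x' - y')).trans ?_
    have : x - y - (x' - y') = (x - x') - (y - y') := by abel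
    rw [this]
    gcongr
    exact norm_sub_le _ _
  change ‖p u₀ - G 0‖ < η at hu₀
  change ‖p v₀ - G' 0‖ < η at hv₀
  obtain ⟨g, g', hg, hg', hg0, hg0', hgg⟩ := H₁ u₀ v₀
    (by have := tri (p u₀) (G 0); linarith) (by have := tri (p v₀) (G' 0); linarith)
    (by have := tri2 (p u₀) (p v₀) (G 0) (G' 0); linarith)
  have h1 := hucl g hg hg0
  have h2 := hvcl g' hg' hg0'
  have h3 := tri2 (G t) (G' t) (g t) (g' t)
  rw [norm_sub_rev, norm_sub_rev (G' t)] at h3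
  rw [← hGt, ← hGt'] at huv
  change c * R₁ ≤ N (G t - G' t) at huv
  linarith

end NL4S

end

theorem theorem1p8 (d : ℕ) (hd : 1 ≤ d) (ν μ : ℝ) (hν : 1 < ν) (hμ : μ = 1 ∨ μ = -1)
    (k : ℕ) (hk : (d : ℝ) / 2 < k)
    (hνk : (∃ m : ℕ, ν = 2 * (m : ℝ) + 1) ∨ (k : ℝ) + 1 ≤ ν) :
    (∀ γ : ℝ,
      γ ∈ (Set.Iic (-(d : ℝ) / 2) ∩ Set.Iio (NL4S.criticalExponent d ν)) ∪
        Set.Ioo 0 (NL4S.criticalExponent d ν) →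
      (∀ t : ℝ, 0 < t → ¬ NL4S.SolutionMapContinuousAtZero d ν μ k γ t) ∧
        NL4S.NormInflation d ν μ k γ) ∧
    (0 < NL4S.criticalExponent d ν →
      (∀ t R : ℝ, 0 < t → 0 < R → ¬ NL4S.SolutionMapUniformContinuousOnBall d ν μ k R t) ∧
        NL4S.Decoherence d ν μ k) := by
  have E : NL4S.Exponents d ν k := ⟨hν, hk, hνk⟩
  refine ⟨fun γ hγ ↦ ?_, fun hc ↦ ?_⟩
  · have hinf : NL4S.NormInflation d ν μ k γ := by
      rcases hγ with ⟨h1, h2⟩ | ⟨h1, h2⟩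
      · exact NL4S.normInflation_of_le E hd hμ h1 h2
      · exact NL4S.normInflation_of_pos E hd hμ h1 h2
    have hlt : γ < NL4S.criticalExponent d ν := by
      rcases hγ with h | h
      · exact h.2
      · exact h.2
    have hγk : γ ≤ k := by
      have h4 : 0 < 4 / (ν - 1) := div_pos (by norm_num) (by linarith)
      rw [NL4S.criticalExponent] at hlt
      linarith
    exact ⟨fun t ht ↦ NL4S.not_solutionMapContinuousAtZero E hγk hinf ht, hinf⟩
  · have hdec := NL4S.decoherence E hμ hc
    exact ⟨fun t R ht hR ↦ NL4S.not_solutionMapUniformContinuousOnBall E hdec ht hR, hdec⟩
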